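/- **Theorem 3.1 (local boundary determination).** Let $\Omega\subset\mathbb R^n$, $n\ge 2$, be a bounded domain (open connected set) with smooth boundary, and let $\Gamma$ be a domain with smooth boundary such that $\overline\Gamma\subset\Omega$ and $\Omega\setminus\overline\Gamma$ is connected. For $j=1,2$ let $g_j\in C^\infty(\overline\Omega;\mathbb R^{n\times n})$ be a Riemannian metric which is uniformly elliptic, i.e. for some $\lambda\in(0,1)$ one has $\lambda|\xi|^2\le (g_j)_{kl}(x)\xi^k\xi^l\le\lambda^{-1}|\xi|^2$ for all $x\in\Omega$, $\xi\in\mathbb R^n$, and let $0\le V_j\in C^\infty(\overline\Omega)$. Write $\widetilde g_j=(g_j)_{kl}\,dx^k\otimes dx^l+dy\otimes dy$ for the product metric on $\Omega\times(0,\infty)$. Let $H^1_0(\Omega\times[0,\infty))$ be the closure of $C^1_c(\Omega\times[0,\infty))$ in $H^1(\Omega\times(0,\infty))$. For $f\in C_c^\infty(\Gamma)$ let $u^{(j)}_f\in H^1_0(\Omega\times[0,\infty))$ be the unique weak solution of $$(-\Delta_{\widetilde g_j}+V_j)u=0\ \text{in }\Omega\times(0,\infty),\qquad -\partial_y u=f\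 \text{on }\Omega\times\{0\},\qquad u=0\ \text{on }\partial\Omega\times(0,\infty),$$ that is, $$\int_{\Omega\times(0,\infty)}\Big(g_j^{kl}\,\partial_k u\,\partial_l\varphi+\partial_y u\,\partial_y\varphi+V_j u\varphi\Big)|g_j|^{1/2}\,dx\,dy=\int_\Omega f\,|g_j|^{1/2}\,\varphi(\cdot,0)\,dx\qquad\text{for all }\varphi\in H^1_0(\Omega\times[0,\infty)),$$ where $|g_j|=\det g_j$, $(g_j^{kl})=g_j^{-1}$, and $\varphi(\cdot,0)$ is the trace of $\varphi$ on $\Omega\times\{0\}$. The partial Neumann-to-Dirichlet map is given by $\Lambda^\Gamma_{g_j,V_j}f=u_f^{(j)}(\cdot,0)|_{\Gamma}$. If $\Lambda^\Gamma_{g_1,V_1}f=\Lambda^\Gamma_{g_2,V_2}f$ on $\Gamma$ for every $f\in C_c^\infty(\Gamma)$, then $$g_1=g_2\quad\text{and}\quad V_1=V_2\qquad\text{in }\Gamma .$$ -/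

import Mathlib

open MeasureTheory Filter Set
open scoped ContDiff Topology Matrix

namespace NDMap

/-- The space of points `(x, y)` with `x ∈ ℝⁿ` and `y ∈ ℝ`. -/
abbrev Space (n : ℕ) : Type := EuclideanSpace ℝ (Fin n) × ℝ

/-- The half-cylinder `Ω × (0, ∞)`. -/
def cyl {n : ℕ} (Ω : Set (EuclideanSpace ℝ (Fin n))) : Set (Space n) := Ω ×ˢ Ioi (0 : ℝ)

/-- The boundary of the open set `Ω` is smooth: near each boundary point, `Ω` is the sublevel set
`{ρ < 0}` of a smooth function `ρ` with nonvanishing differential. -/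
def HasSmoothBoundary {n : ℕ} (Ω : Set (EuclideanSpace ℝ (Fin n))) : Prop :=
  ∀ x ∈ frontier Ω, ∃ (U : Set (EuclideanSpace ℝ (Fin n))) (ρ : EuclideanSpace ℝ (Fin n) → ℝ),
    IsOpen U ∧ x ∈ U ∧ ContDiffOn ℝ ∞ ρ U ∧ (∀ z ∈ U, fderiv ℝ ρ z ≠ 0) ∧
      Ω ∩ U = {z ∈ U | ρ z < 0}

/-- A (smooth) domain of `ℝⁿ`: an open connected set with smooth boundary. -/
structure IsSmoothDomain {n : ℕ} (Ω : Set (EuclideanSpace ℝ (Fin n))) : Prop where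
  isOpen : IsOpen Ω
  isConnected : IsConnected Ω
  smoothBoundary : HasSmoothBoundary Ω

/-- `g` is a Riemannian metric on `Ω`, smooth up to the boundary and uniformly elliptic.
The value `g x` is the matrix `(g_{ij}(x))`. -/
structure IsEllipticMetric {n : ℕ} (Ω : Set (EuclideanSpace ℝ (Fin n)))
    (g : EuclideanSpace ℝ (Fin n) → Matrix (Fin n) (Fin n) ℝ) : Prop where
  smooth : ∀ i j, ContDiffOn ℝ ∞ (fun x => g x i j) (closure Ω)
  symm : ∀ x ∈ Ω, (g x).IsSymm
  elliptic : ∃ l : ℝ, 0 < l ∧ l < 1 ∧ ∀ x ∈ Ω, ∀ ξ : Fin n → ℝ,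
    l * (ξ ⬝ᵥ ξ) ≤ ξ ⬝ᵥ (g x *ᵥ ξ) ∧ ξ ⬝ᵥ (g x *ᵥ ξ) ≤ l⁻¹ * (ξ ⬝ᵥ ξ)

/-- `V` is a nonnegative potential on `Ω`, smooth up to the boundary (it depends on `x` only). -/
structure IsPotential {n : ℕ} (Ω : Set (EuclideanSpace ℝ (Fin n)))
    (V : EuclideanSpace ℝ (Fin n) → ℝ) : Prop where
  smooth : ContDiffOn ℝ ∞ V (closure Ω)
  nonneg : ∀ x ∈ Ω, 0 ≤ V x

/-- `f ∈ C_c^∞(U)` (real valued, extended by zero). -/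
structure IsTestFunction {E : Type*} [NormedAddCommGroup E] [NormedSpace ℝ E] (U : Set E)
    (f : E → ℝ) : Prop where
  smooth : ContDiff ℝ ∞ f
  compactSupport : HasCompactSupport f
  tsupport_subset : tsupport f ⊆ U

/-- The `x`-gradient of a differentiable function of `(x, y)`. -/
noncomputable def gradX {n : ℕ} (φ : Space n → ℝ) (z : Space n) : EuclideanSpace ℝ (Fin n) :=
  WithLp.toLp 2 (fun i => fderiv ℝ φ z (EuclideanSpace.single i (1 : ℝ), (0 : ℝ)))

/-- The `y`-derivative of a differentiable function of `(x, y)`. -/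
noncomputable def derivY {n : ℕ} (φ : Space n → ℝ) (z : Space n) : ℝ :=
  fderiv ℝ φ z ((0 : EuclideanSpace ℝ (Fin n)), (1 : ℝ))

/-- An element of `H¹(Ω × (0, ∞))`: a function in `L²` together with (a representative of) its
weak gradient, which is in `L²` and is split into the `x`-part and the `y`-part. -/
structure H1 {n : ℕ} (Ω : Set (EuclideanSpace ℝ (Fin n))) where
  val : Space n → ℝ
  dx : Space n → EuclideanSpace ℝ (Fin n)
  dy : Space n → ℝ
  memLp_val : MemLp val 2 (volume.restrict (cyl Ω))
  memLp_dx : MemLp dx 2 (volume.restrict (cyl Ω))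
  memLp_dy : MemLp dy 2 (volume.restrict (cyl Ω))
  weak_dx : ∀ φ : Space n → ℝ, IsTestFunction (cyl Ω) φ → ∀ i : Fin n,
    ∫ z in cyl Ω, val z * gradX φ z i = -∫ z in cyl Ω, dx z i * φ z
  weak_dy : ∀ φ : Space n → ℝ, IsTestFunction (cyl Ω) φ →
    ∫ z in cyl Ω, val z * derivY φ z = -∫ z in cyl Ω, dy z * φ z

/-- `φ` represents an element of `C_c¹(Ω × [0, ∞))`, that is, its restriction to `Ω × [0, ∞)`
is one. The support of `φ` may meet the bottom `Ω × {0}`. -/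
structure IsC1Bottom {n : ℕ} (Ω : Set (EuclideanSpace ℝ (Fin n))) (φ : Space n → ℝ) : Prop where
  contDiff : ContDiff ℝ 1 φ
  compactSupport : HasCompactSupport φ
  tsupport_subset : tsupport φ ⊆ Ω ×ˢ (univ : Set ℝ)

/-- The sequence `φ k` of differentiable functions converges to `u` in `H¹(Ω × (0, ∞))`. -/
def TendstoH1 {n : ℕ} {Ω : Set (EuclideanSpace ℝ (Fin n))} (φ : ℕ → Space n → ℝ) (u : H1 Ω) :
    Prop :=
  Tendsto (fun k => eLpNorm (fun z => φ k z - u.val z) 2 (volume.restrict (cyl Ω))) atTop (𝓝 0) ∧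
  Tendsto (fun k => eLpNorm (fun z => gradX (φ k) z - u.dx z) 2 (volume.restrict (cyl Ω)))
    atTop (𝓝 0) ∧
  Tendsto (fun k => eLpNorm (fun z => derivY (φ k) z - u.dy z) 2 (volume.restrict (cyl Ω)))
    atTop (𝓝 0)

/-- `u ∈ H¹₀(Ω × [0, ∞))`, the closure of `C_c¹(Ω × [0, ∞))` in `H¹(Ω × (0, ∞))`. -/
def MemH10 {n : ℕ} {Ω : Set (EuclideanSpace ℝ (Fin n))} (u : H1 Ω) : Prop :=
  ∃ φ : ℕ → Space n → ℝ, (∀ k, IsC1Bottom Ω (φ k)) ∧ TendstoH1 φ u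

/-- `w ∈ L²(Ω)` is the trace of `u ∈ H¹₀(Ω × [0, ∞))` on the bottom `Ω × {0}`. The trace operator
is the continuous extension of `φ ↦ φ(·, 0)` from `C_c¹(Ω × [0, ∞))`. -/
def IsTrace {n : ℕ} {Ω : Set (EuclideanSpace ℝ (Fin n))} (u : H1 Ω)
    (w : EuclideanSpace ℝ (Fin n) → ℝ) : Prop :=
  MemLp w 2 (volume.restrict Ω) ∧
  ∃ φ : ℕ → Space n → ℝ, (∀ k, IsC1Bottom Ω (φ k)) ∧ TendstoH1 φ u ∧
    Tendsto (fun k => eLpNorm (fun x => φ k (x, 0) - w x) 2 (volume.restrict Ω)) atTop (𝓝 0)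

/-- The bilinear form `B_{g,V}(u, v) = ∫ (du · dv + V u v) dV_g̃` over `Ω × (0, ∞)`, for the metric
`g̃ = g_{ij} dxⁱ ⊗ dxʲ + dy ⊗ dy`, whose inverse is `diag(g⁻¹, 1)` and whose determinant
is `det g`. -/
noncomputable def bilin {n : ℕ} {Ω : Set (EuclideanSpace ℝ (Fin n))}
    (g : EuclideanSpace ℝ (Fin n) → Matrix (Fin n) (Fin n) ℝ)
    (V : EuclideanSpace ℝ (Fin n) → ℝ) (u v : H1 Ω) : ℝ :=
  ∫ z in cyl Ω,
    ((u.dx z).ofLp ⬝ᵥ ((g z.1)⁻¹ *ᵥ (v.dx z).ofLp) + u.dy z * v.dy z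
      + V z.1 * u.val z * v.val z) * √((g z.1).det)

/-- `u` is the weak solution in `H¹₀(Ω × [0, ∞))` of `(-Δ_g̃ + V) u = 0` in `Ω × (0, ∞)`,
`-∂_y u = f` on `Ω × {0}`, `u = 0` on `∂Ω × (0, ∞)`. -/
def IsWeakSolution {n : ℕ} {Ω : Set (EuclideanSpace ℝ (Fin n))}
    (g : EuclideanSpace ℝ (Fin n) → Matrix (Fin n) (Fin n) ℝ)
    (V : EuclideanSpace ℝ (Fin n) → ℝ) (f : EuclideanSpace ℝ (Fin n) → ℝ) (u : H1 Ω) : Prop :=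
  MemH10 u ∧ ∀ (v : H1 Ω) (w : EuclideanSpace ℝ (Fin n) → ℝ), MemH10 v → IsTrace v w →
    bilin g V u v = ∫ x in Ω, f x * (√((g x).det) * w x)

/-- The graph of the Neumann-to-Dirichlet map on `Ω`: `w` is the trace on `Ω × {0}` of the weak
solution with Neumann datum `f`. The partial map on `Γ` takes `f` supported in `Γ` to the
restriction of `w` to `Γ`. -/
def IsNDImage {n : ℕ} (Ω : Set (EuclideanSpace ℝ (Fin n)))
    (g : EuclideanSpace ℝ (Fin n) → Matrix (Fin n) (Fin n) ℝ)
    (V : EuclideanSpace ℝ (Fin n) → ℝ) (f w : EuclideanSpace ℝ (Fin n) → ℝ) : Prop :=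
  ∃ u : H1 Ω, IsWeakSolution g V f u ∧ IsTrace u w

/-- The partial Neumann-to-Dirichlet maps on `Γ` of `(g₁, V₁)` and `(g₂, V₂)` agree:
`Λ₁ f = Λ₂ f` on `Γ` for every `f ∈ C_c^∞(Γ)`. -/
def SamePartialND {n : ℕ} (Ω Γ : Set (EuclideanSpace ℝ (Fin n)))
    (g₁ : EuclideanSpace ℝ (Fin n) → Matrix (Fin n) (Fin n) ℝ)
    (V₁ : EuclideanSpace ℝ (Fin n) → ℝ)
    (g₂ : EuclideanSpace ℝ (Fin n) → Matrix (Fin n) (Fin n) ℝ)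
    (V₂ : EuclideanSpace ℝ (Fin n) → ℝ) : Prop :=
  ∀ f : EuclideanSpace ℝ (Fin n) → ℝ, IsTestFunction Γ f →
    ∀ w₁ w₂ : EuclideanSpace ℝ (Fin n) → ℝ,
      IsNDImage Ω g₁ V₁ f w₁ → IsNDImage Ω g₂ V₂ f w₂ → w₁ =ᵐ[volume.restrict Γ] w₂

end NDMap

/-! The boundary maps are tested on highly oscillating data `t α(x) cos(t θ(x) + τ)`, where `α` is a
bump in `Γ`, `θ(x) = ξ · x` is linear and `t → ∞`. The solution concentrates in a layer of thickness
of order `1/t` above the support `K` of `α`, where it looks like `(α/p) e^{-t p y} cos(t θ + τ)`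
with `p = |ξ|` measured in the dual metric. This choice of `p` is the eikonal equation, which
removes the terms of size `t²` from the equation. Corrections with phase shifted by `π/2` remove the
remaining growing terms, so that the residual of the ansatz `wkb` is bounded by a multiple of
`e^{-mty}` (`IsEikonal.isDecaying_ellOp_wkb`), while the Neumann datum is attained exactly.

By coercivity of the energy form, a consequence of the Poincaré and trace inequalities
(`IsEllipticMetric.coercive`), the squared energy distance between the solution and the ansatz is
`O(1/t)` (`WKBData.exists_error_le`). The distance includes the trace. If the boundary maps agree,
then `(α/p₁ - α/p₂) cos(t θ + τ)` therefore tends to zero in `L²`. Adding the estimates for two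
phases in quadrature removes the oscillation, so `p₁ = p₂` wherever `α ≠ 0` (`WKBData.rate_eq`). The
dual norms of all covectors agree and polarization gives equality of the metrics.

The metrics being equal on `Γ`, one ansatz `W` serves both problems, and the two residuals differ by
`(V₂ - V₁) s W`, where `s` is the density. Symmetry of the forms and equality of the traces give `∫
R₁ (u₁ - u₂) = ∫ (V₂ - V₁) s W u₂` (`WKBData.integral_residual_mul_sub`). A Hardy inequality with
weight `e^{-mty}` gains two powers of `1/t` for `u₁ - u₂`, whose trace vanishes over `K`, and one
power for `u₂ - W`. Hence `∫ (V₂ - V₁) s W² = O(t^{-3/2})`. If `V₂ - V₁` were bounded below by a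
positive constant on `K`, the sum of this integral over the two phases would be at least a multiple
of `1/t`, the thickness of the layer. This contradiction gives one inequality between the
potentials, and exchanging the two problems gives the other. -/

namespace NDMap

/-! ### Partial derivatives and the divergence theorem on a half space -/

lemma volume_restrict_prod_Ioi {n : ℕ} (S : Set (EuclideanSpace ℝ (Fin n))) :
    (volume : Measure (Space n)).restrict (cyl S)
      = (volume.restrict S).prod (volume.restrict (Ioi (0 : ℝ))) := by
  rw [cyl, Measure.prod_restrict]; rfl

/-- The slice of a compactly supported function at a fixed `x`. -/
lemma hasCompactSupport_slice_right {n : ℕ} {h : Space n → ℝ} (hs : HasCompactSupport h)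
    (x : EuclideanSpace ℝ (Fin n)) : HasCompactSupport (fun y => h (x, y)) := by
  refine HasCompactSupport.of_support_subset_isCompact (hs.isCompact.image continuous_snd) ?_
  intro y hy
  exact ⟨(x, y), subset_tsupport _ hy, rfl⟩

lemma hasCompactSupport_slice_left {n : ℕ} {h : Space n → ℝ} (hs : HasCompactSupport h)
    (y : ℝ) : HasCompactSupport (fun x => h (x, y)) := by
  refine HasCompactSupport.of_support_subset_isCompact (hs.isCompact.image continuous_fst) ?_
  intro x hx
  exact ⟨(x, y), subset_tsupport _ hx, rfl⟩

lemma continuous_gradX_apply {n : ℕ} {h : Space n → ℝ} (hc : ContDiff ℝ 1 h) (k : Fin n) :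
    Continuous (fun z => gradX h z k) := by
  have := hc.continuous_fderiv one_ne_zero
  simp only [gradX]
  fun_prop

lemma continuous_gradX {n : ℕ} {h : Space n → ℝ} (hc : ContDiff ℝ 1 h) :
    Continuous (gradX h) := by
  have := hc.continuous_fderiv one_ne_zero
  unfold gradX
  fun_prop

lemma continuous_derivY {n : ℕ} {h : Space n → ℝ} (hc : ContDiff ℝ 1 h) :
    Continuous (derivY h) := by
  have := hc.continuous_fderiv one_ne_zero
  unfold derivY
  fun_prop

lemma gradX_eq_zero_of_fderiv {n : ℕ} {h : Space n → ℝ} {z : Space n} (hz : fderiv ℝ h z = 0) :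
    gradX h z = 0 := by
  ext k; simp [gradX, hz]

lemma hasCompactSupport_gradX {n : ℕ} {h : Space n → ℝ} (hs : HasCompactSupport h) :
    HasCompactSupport (gradX h) :=
  (hs.fderiv (𝕜 := ℝ)).mono fun _ hz hf => hz (gradX_eq_zero_of_fderiv hf)

lemma hasCompactSupport_gradX_apply {n : ℕ} {h : Space n → ℝ} (hs : HasCompactSupport h)
    (k : Fin n) : HasCompactSupport (fun z => gradX h z k) :=
  (hs.fderiv (𝕜 := ℝ)).mono fun z hz hf => hz (by simp [gradX_eq_zero_of_fderiv hf])

lemma hasCompactSupport_derivY {n : ℕ} {h : Space n → ℝ} (hs : HasCompactSupport h) :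
    HasCompactSupport (derivY h) :=
  (hs.fderiv (𝕜 := ℝ)).mono fun z hz hf => hz (by simp [derivY, hf])

lemma hasDerivAt_slice {n : ℕ} {h : Space n → ℝ} {z : Space n}
    (hd : DifferentiableAt ℝ h z) : HasDerivAt (fun y => h (z.1, y)) (derivY h z) z.2 := by
  have h1 : HasDerivAt (fun y : ℝ => ((z.1, y) : Space n)) (0, 1) z.2 :=
    (hasDerivAt_const _ _).prodMk (hasDerivAt_id _)
  exact HasFDerivAt.comp_hasDerivAt (f := fun y : ℝ => ((z.1, y) : Space n)) z.2 hd.hasFDerivAt h1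

lemma fderiv_slice {n : ℕ} {h : Space n → ℝ} {z : Space n}
    (hd : DifferentiableAt ℝ h z) (k : Fin n) :
    fderiv ℝ (fun x => h (x, z.2)) z.1 (EuclideanSpace.single k 1) = gradX h z k := by
  have h1 : HasFDerivAt (fun x => ((x, z.2) : Space n))
      (ContinuousLinearMap.inl ℝ (EuclideanSpace ℝ (Fin n)) ℝ) z.1 :=
    hasFDerivAt_prodMk_left _ _
  have h2 := HasFDerivAt.comp (f := fun x => ((x, z.2) : Space n)) z.1 hd.hasFDerivAt h1
  have := h2.fderiv
  simp only [Function.comp_def] at this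
  rw [this]; simp [gradX]

/-- The divergence theorem on the half space, vertical component. -/
lemma setIntegral_derivY {n : ℕ} {h : Space n → ℝ} (hc : ContDiff ℝ 1 h)
    (hs : HasCompactSupport h) (S : Set (EuclideanSpace ℝ (Fin n))) :
    ∫ z in cyl S, derivY h z = -∫ x in S, h (x, 0) := by
  have hi : Integrable (derivY h) :=
    (continuous_derivY hc).integrable_of_hasCompactSupport (hasCompactSupport_derivY hs)
  have hi' : Integrable (derivY h) ((volume.restrict S).prod (volume.restrict (Ioi (0 : ℝ)))) := by
    rw [← volume_restrict_prod_Ioi]; exact hi.restrict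
  rw [volume_restrict_prod_Ioi, integral_prod _ hi', ← integral_neg]
  congr 1; ext x
  have hcx : ContDiff ℝ 1 (fun y => h (x, y)) := hc.comp (contDiff_const.prodMk contDiff_id)
  rw [← (hasCompactSupport_slice_right hs x).integral_Ioi_deriv_eq hcx 0]
  congr 1; ext y
  exact ((hasDerivAt_slice (z := (x, y)) (hc.differentiable one_ne_zero _)).deriv).symm

/-- The divergence theorem on the half space, horizontal components. -/
lemma setIntegral_gradX {n : ℕ} {h : Space n → ℝ} (hc : ContDiff ℝ 1 h)
    (hs : HasCompactSupport h) (k : Fin n) :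
    ∫ z in cyl univ, gradX h z k = 0 := by
  have hi : Integrable (fun z => gradX h z k) :=
    (continuous_gradX_apply hc k).integrable_of_hasCompactSupport (hasCompactSupport_gradX_apply hs k)
  have hi' : Integrable (fun z => gradX h z k)
      ((volume.restrict univ).prod (volume.restrict (Ioi (0 : ℝ)))) := by
    rw [← volume_restrict_prod_Ioi]; exact hi.restrict
  rw [volume_restrict_prod_Ioi, integral_prod_symm _ hi']
  refine (integral_congr_ae (Eventually.of_forall fun y => ?_)).trans
    (integral_zero ℝ ℝ (μ := volume.restrict (Ioi (0 : ℝ))))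
  have hcx : ContDiff ℝ 1 (fun x => h (x, y)) := hc.comp (contDiff_id.prodMk contDiff_const)
  have hsx := hasCompactSupport_slice_left hs y
  have hcf := hcx.continuous_fderiv one_ne_zero
  -- Integration by parts on each horizontal slice against the constant `1`, whose derivative
  -- vanishes.
  have := integral_mul_fderiv_eq_neg_fderiv_mul_of_integrable (μ := volume)
    (f := fun _ : EuclideanSpace ℝ (Fin n) => (1 : ℝ)) (g := fun x => h (x, y))
    (v := EuclideanSpace.single k 1) (by simp)
    (by
      simp only [one_mul]
      exact Continuous.integrable_of_hasCompactSupport (by fun_prop)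
        (hsx.fderiv_apply (𝕜 := ℝ) _))
    (by simpa using hcx.continuous.integrable_of_hasCompactSupport hsx)
    (fun x _ => differentiableAt_const _) (fun x _ => hcx.differentiable one_ne_zero _)
  simp only [one_mul, fderiv_fun_const, Pi.zero_apply, _root_.zero_apply, zero_mul,
    integral_zero, neg_zero] at this
  simp only [Measure.restrict_univ]
  rw [← this]
  congr 1; ext x
  exact (fderiv_slice (z := (x, y)) (hc.differentiable one_ne_zero _) k).symm

lemma measurableSet_cyl {n : ℕ} {S : Set (EuclideanSpace ℝ (Fin n))} (hS : MeasurableSet S) :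
    MeasurableSet (cyl S) := hS.prod measurableSet_Ioi

/-- Integrals over a cylinder depend only on the values over the support in `x`. -/
lemma setIntegral_cyl_eq {n : ℕ} {S T : Set (EuclideanSpace ℝ (Fin n))} (hT : MeasurableSet T)
    {h : Space n → ℝ} (hST : S ⊆ T) (h0 : ∀ z : Space n, z.1 ∉ S → h z = 0) :
    ∫ z in cyl T, h z = ∫ z in cyl S, h z := by
  refine setIntegral_eq_of_subset_of_forall_sdiff_eq_zero (measurableSet_cyl hT)
    (Set.prod_mono_left hST) ?_
  rintro ⟨x, y⟩ ⟨hz1, hz2⟩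
  refine h0 _ fun hx => hz2 ⟨hx, hz1.2⟩

lemma derivY_mul {n : ℕ} {f h : Space n → ℝ} {z : Space n} (hf : DifferentiableAt ℝ f z)
    (hh : DifferentiableAt ℝ h z) :
    derivY (fun z => f z * h z) z = derivY f z * h z + f z * derivY h z := by
  simp only [derivY, fderiv_fun_mul hf hh]; simp; ring

lemma gradX_mul {n : ℕ} {f h : Space n → ℝ} {z : Space n} (hf : DifferentiableAt ℝ f z)
    (hh : DifferentiableAt ℝ h z) (k : Fin n) :
    gradX (fun z => f z * h z) z k = gradX f z k * h z + f z * gradX h z k := by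
  simp only [gradX, fderiv_fun_mul hf hh]; simp; ring

lemma derivY_eq_of_hasDerivAt {n : ℕ} {h : Space n → ℝ} {z : Space n} {d : ℝ}
    (hd : DifferentiableAt ℝ h z) (h' : HasDerivAt (fun y => h (z.1, y)) d z.2) :
    derivY h z = d := (hasDerivAt_slice hd).unique h'


/-! ### Poincaré, trace and weighted Hardy inequalities for `C¹` functions -/

lemma IsC1Bottom.eq_zero {n : ℕ} {Ω : Set (EuclideanSpace ℝ (Fin n))} {φ : Space n → ℝ}
    (hφ : IsC1Bottom Ω φ) {z : Space n} (hz : z.1 ∉ Ω) : φ z = 0 := by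
  by_contra h
  exact hz (hφ.tsupport_subset (subset_tsupport _ h)).1

lemma IsC1Bottom.fderiv_eq_zero {n : ℕ} {Ω : Set (EuclideanSpace ℝ (Fin n))} {φ : Space n → ℝ}
    (hφ : IsC1Bottom Ω φ) {z : Space n} (hz : z.1 ∉ Ω) : fderiv ℝ φ z = 0 := by
  by_contra h
  exact hz (hφ.tsupport_subset (support_fderiv_subset ℝ h)).1

lemma IsC1Bottom.gradX_eq_zero {n : ℕ} {Ω : Set (EuclideanSpace ℝ (Fin n))} {φ : Space n → ℝ}
    (hφ : IsC1Bottom Ω φ) {z : Space n} (hz : z.1 ∉ Ω) : gradX φ z = 0 :=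
  gradX_eq_zero_of_fderiv (hφ.fderiv_eq_zero hz)

/-- Poincaré's inequality on a bounded cylinder. -/
lemma IsC1Bottom.poincare {n : ℕ} (i : Fin n) {Ω : Set (EuclideanSpace ℝ (Fin n))}
    (hΩ : MeasurableSet Ω) {R : ℝ} (hR : ∀ x ∈ Ω, ‖x‖ ≤ R) {φ : Space n → ℝ}
    (hφ : IsC1Bottom Ω φ) :
    ∫ z in cyl Ω, φ z ^ 2 ≤ 4 * R ^ 2 * ∫ z in cyl Ω, ‖gradX φ z‖ ^ 2 := by
  have hd : Differentiable ℝ φ := hφ.contDiff.differentiable one_ne_zero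
  have hcφ := hφ.contDiff.continuous
  have hcg := continuous_gradX hφ.contDiff
  have hsφ := hφ.compactSupport
  have hsg := hasCompactSupport_gradX hsφ
  let X : Space n → ℝ := fun z => z.1 i
  have hX : ContDiff ℝ 1 X := by
    have : ContDiff ℝ 1 (fun x : EuclideanSpace ℝ (Fin n) => x i) := by fun_prop
    exact this.comp contDiff_fst
  have hXg : ∀ z, gradX X z i = 1 := by
    intro z
    have : X = (EuclideanSpace.proj i : EuclideanSpace ℝ (Fin n) →L[ℝ] ℝ) ∘L
      (ContinuousLinearMap.fst ℝ _ ℝ) := rfl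
    simp only [gradX, this, ContinuousLinearMap.fderiv]
    simp
  have hφ2 : ContDiff ℝ 1 (fun z => φ z * φ z) := hφ.contDiff.mul hφ.contDiff
  -- The divergence of `x_i φ² e_i` is `φ² + 2 x_i φ ∂_i φ` and integrates to zero. Since `|x_i| ≤
  -- R` on `Ω`, the cross term is absorbed.
  have key := setIntegral_gradX (hX.mul hφ2) ((hsφ.mul_left (f := φ)).mul_left (f := X)) i
  have hder : ∀ z, gradX (fun z => X z * (φ z * φ z)) z i
      = φ z ^ 2 + 2 * (X z * φ z * gradX φ z i) := by
    intro z
    rw [gradX_mul (hX.differentiable one_ne_zero z) (hφ2.differentiable one_ne_zero z),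
      gradX_mul (hd z) (hd z), hXg]
    ring
  have i1 : Integrable (fun z => φ z ^ 2) (volume.restrict (cyl Ω)) :=
    (Continuous.integrable_of_hasCompactSupport (by fun_prop)
      (hsφ.comp_left (g := fun t : ℝ => t ^ 2) (by simp))).restrict
  have i2 : Integrable (fun z => 2 * (X z * φ z * gradX φ z i)) (volume.restrict (cyl Ω)) := by
    have hXc := hX.continuous
    have hgc := continuous_gradX_apply hφ.contDiff i
    exact (Continuous.integrable_of_hasCompactSupport (by fun_prop)
      ((hasCompactSupport_gradX_apply hsφ i).mul_left.mul_left)).restrict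
  have i3 : Integrable (fun z => ‖gradX φ z‖ ^ 2) (volume.restrict (cyl Ω)) :=
    (Continuous.integrable_of_hasCompactSupport (by fun_prop)
      (hsg.comp_left (g := fun t => ‖t‖ ^ 2) (by simp))).restrict
  rw [setIntegral_congr_fun (measurableSet_cyl MeasurableSet.univ) (fun z _ => hder z),
    setIntegral_cyl_eq MeasurableSet.univ (subset_univ Ω)
      (fun z hz => by simp [hφ.eq_zero hz]), integral_add i1 i2] at key
  have hle : -∫ z in cyl Ω, 2 * (X z * φ z * gradX φ z i)
      ≤ ∫ z in cyl Ω, (1 / 2 * φ z ^ 2 + 2 * R ^ 2 * ‖gradX φ z‖ ^ 2) := by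
    rw [← integral_neg]
    refine setIntegral_mono_on i2.neg ((i1.const_mul _).add (i3.const_mul _))
      (measurableSet_cyl hΩ) ?_
    intro z hz
    have h1 : |X z| ≤ R := (PiLp.norm_apply_le z.1 i).trans (hR _ hz.1)
    have h2 : |gradX φ z i| ≤ ‖gradX φ z‖ := PiLp.norm_apply_le (gradX φ z) i
    have h3 : (X z * gradX φ z i) ^ 2 ≤ R ^ 2 * ‖gradX φ z‖ ^ 2 := by
      rw [← mul_pow, ← sq_abs, abs_mul]
      exact pow_le_pow_left₀ (by positivity)
        (mul_le_mul h1 h2 (abs_nonneg _) ((abs_nonneg _).trans h1)) 2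
    nlinarith [sq_nonneg (φ z + 2 * (X z * gradX φ z i))]
  rw [integral_add (i1.const_mul _) (i3.const_mul _), integral_const_mul (1 / 2 : ℝ),
    integral_const_mul (2 * R ^ 2)] at hle
  linarith

/-- The trace inequality. -/
lemma IsC1Bottom.trace_le {n : ℕ} {Ω : Set (EuclideanSpace ℝ (Fin n))} {φ : Space n → ℝ}
    (hφ : IsC1Bottom Ω φ) :
    ∫ x in Ω, φ (x, 0) ^ 2 ≤ ∫ z in cyl Ω, (φ z ^ 2 + derivY φ z ^ 2) := by
  have hd : Differentiable ℝ φ := hφ.contDiff.differentiable one_ne_zero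
  have hcφ := hφ.contDiff.continuous
  have hcg := continuous_derivY hφ.contDiff
  have hsφ := hφ.compactSupport
  have hsg := hasCompactSupport_derivY hsφ
  -- The trace is recovered by integrating `∂_y(φ²) = 2 φ ∂_y φ` over the half line.
  have key := setIntegral_derivY (hφ.contDiff.mul hφ.contDiff) (hsφ.mul_left (f := φ)) Ω
  have hder : ∀ z, derivY (fun z => φ z * φ z) z = 2 * (φ z * derivY φ z) := by
    intro z; rw [derivY_mul (hd z) (hd z)]; ring
  simp_rw [hder] at key
  have h2 : ∫ x in Ω, φ (x, 0) ^ 2 = ∫ z in cyl Ω, -(2 * (φ z * derivY φ z)) := by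
    rw [integral_neg, key, neg_neg]; simp_rw [pow_two]
  rw [h2]
  refine integral_mono ?_ ?_ fun z => ?_
  · exact (Continuous.integrable_of_hasCompactSupport (by fun_prop)
      (hsg.mul_left.mul_left)).neg.restrict
  · exact (Continuous.integrable_of_hasCompactSupport (by fun_prop)
      ((hsφ.comp_left (g := fun t : ℝ => t ^ 2) (by simp)).add
        (hsg.comp_left (g := fun t : ℝ => t ^ 2) (by simp)))).restrict
  · dsimp only; nlinarith [sq_nonneg (φ z + derivY φ z)]

/-- A Hardy type inequality with exponential weight. -/
lemma IsC1Bottom.weighted_le {n : ℕ} {Ω S : Set (EuclideanSpace ℝ (Fin n))} {φ : Space n → ℝ}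
    (hφ : IsC1Bottom Ω φ) (hS : MeasurableSet S) {m : ℝ} (hm : 0 < m) :
    ∫ z in cyl S, Real.exp (-(m * z.2)) * φ z ^ 2
      ≤ 2 / m * (∫ x in S, φ (x, 0) ^ 2) + 4 / m ^ 2 * ∫ z in cyl S, derivY φ z ^ 2 := by
  have hd : Differentiable ℝ φ := hφ.contDiff.differentiable one_ne_zero
  have hcφ := hφ.contDiff.continuous
  have hcg := continuous_derivY hφ.contDiff
  have hsφ := hφ.compactSupport
  have hsg := hasCompactSupport_derivY hsφ
  have hφ2 : ContDiff ℝ 1 (fun z => φ z * φ z) := hφ.contDiff.mul hφ.contDiff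
  let e : Space n → ℝ := fun z => Real.exp (-(m * z.2))
  have he : ContDiff ℝ 1 e := by fun_prop
  have hec := he.continuous
  have hed : ∀ z, derivY e z = -m * e z := by
    intro z
    refine derivY_eq_of_hasDerivAt (he.differentiable one_ne_zero z) ?_
    have := (((hasDerivAt_id z.2).const_mul m).neg).exp
    refine this.congr_deriv ?_
    simp [e]; ring
  -- Differentiating the weight in `e^{-my} φ²` produces `-m e^{-my} φ²`, which is the quantity to
  -- be bounded.
  have key := setIntegral_derivY (he.mul hφ2) ((hsφ.mul_left (f := φ)).mul_left (f := e)) S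
  have hder : ∀ z, derivY (fun z => e z * (φ z * φ z)) z
      = -m * (e z * φ z ^ 2) + 2 * (e z * (φ z * derivY φ z)) := by
    intro z
    rw [derivY_mul (he.differentiable one_ne_zero z) (hφ2.differentiable one_ne_zero z),
      derivY_mul (hd z) (hd z), hed]
    ring
  have i1 : Integrable (fun z => e z * φ z ^ 2) (volume.restrict (cyl S)) :=
    (Continuous.integrable_of_hasCompactSupport (by fun_prop)
      ((hsφ.comp_left (g := fun t : ℝ => t ^ 2) (by simp)).mul_left)).restrict
  have i2 : Integrable (fun z => 2 * (e z * (φ z * derivY φ z))) (volume.restrict (cyl S)) :=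
    (Continuous.integrable_of_hasCompactSupport (by fun_prop)
      (hsg.mul_left.mul_left.mul_left)).restrict
  have i3 : Integrable (fun z => derivY φ z ^ 2) (volume.restrict (cyl S)) :=
    (Continuous.integrable_of_hasCompactSupport (by fun_prop)
      (hsg.comp_left (g := fun t : ℝ => t ^ 2) (by simp))).restrict
  simp_rw [hder] at key
  rw [integral_add (i1.const_mul (-m)) i2, integral_const_mul (-m)] at key
  have he0 : ∀ x : EuclideanSpace ℝ (Fin n), e (x, 0) * (φ (x, 0) * φ (x, 0)) = φ (x, 0) ^ 2 := by
    intro x; simp [e, pow_two]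
  simp_rw [he0] at key
  have hle : ∫ z in cyl S, 2 * (e z * (φ z * derivY φ z))
      ≤ ∫ z in cyl S, (m / 2 * (e z * φ z ^ 2) + 2 / m * derivY φ z ^ 2) := by
    refine setIntegral_mono_on i2 ((i1.const_mul _).add (i3.const_mul _))
      (measurableSet_cyl hS) ?_
    intro z hz
    have hz2 : 0 < z.2 := hz.2
    have he1 : e z ≤ 1 := Real.exp_le_one_iff.2 (by nlinarith)
    have he0 : 0 < e z := Real.exp_pos _
    -- Young's inequality is balanced so that half of `m e^{-my} φ²` absorbs the cross term. In the
    -- derivative term the weight is then simply bounded by `1`.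
    have h1 : 2 * (φ z * derivY φ z) ≤ m / 2 * φ z ^ 2 + 2 / m * derivY φ z ^ 2 := by
      have : m / 2 * φ z ^ 2 + 2 / m * derivY φ z ^ 2 - 2 * (φ z * derivY φ z)
        = (m * φ z - 2 * derivY φ z) ^ 2 / (2 * m) := by field_simp; ring
      have h2 : 0 ≤ (m * φ z - 2 * derivY φ z) ^ 2 / (2 * m) := by positivity
      linarith
    have h3 : e z * (2 / m * derivY φ z ^ 2) ≤ 1 * (2 / m * derivY φ z ^ 2) :=
      mul_le_mul_of_nonneg_right he1 (by positivity)
    have h4 := mul_le_mul_of_nonneg_left h1 he0.le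
    linarith
  rw [integral_add (i1.const_mul _) (i3.const_mul _), integral_const_mul (m / 2),
    integral_const_mul (2 / m)] at hle
  change ∫ z in cyl S, e z * φ z ^ 2 ≤ _
  set I := ∫ z in cyl S, e z * φ z ^ 2
  set J := ∫ x in S, φ (x, 0) ^ 2
  set L := ∫ z in cyl S, derivY φ z ^ 2
  have h5 : m / 2 * I ≤ J + 2 / m * L := by linarith
  have h6 : I = 2 / m * (m / 2 * I) := by field_simp
  rw [h6]
  refine (mul_le_mul_of_nonneg_left h5 (by positivity)).trans (le_of_eq ?_)
  field_simp; ring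


/-! ### Bounded bilinear forms on `L²` given by fields of forms -/

section LpForm

variable {α F : Type*} [MeasurableSpace α] {μ : Measure α} [NormedAddCommGroup F]

lemma integral_norm_sq_eq [InnerProductSpace ℝ F] (u : Lp F 2 μ) : ∫ z, ‖u z‖ ^ 2 ∂μ = ‖u‖ ^ 2 := by
  rw [← real_inner_self_eq_norm_sq u, L2.inner_def]
  simp_rw [real_inner_self_eq_norm_sq]

lemma integrable_norm_mul_norm (u v : Lp F 2 μ) : Integrable (fun z => ‖u z‖ * ‖v z‖) μ :=
  MemLp.integrable_mul (p := 2) (q := 2) (Lp.memLp u).norm (Lp.memLp v).norm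

/-- Cauchy–Schwarz in the real-valued `L²`, applied to the pointwise norms. No inner product on `F`
is needed. -/
lemma integral_norm_mul_norm_le (u v : Lp F 2 μ) : ∫ z, ‖u z‖ * ‖v z‖ ∂μ ≤ ‖u‖ * ‖v‖ := by
  have h := real_inner_le_norm ((Lp.memLp u).norm.toLp) ((Lp.memLp v).norm.toLp)
  rw [Lp.norm_toLp, Lp.norm_toLp, eLpNorm_norm, eLpNorm_norm, L2.inner_def, ← Lp.norm_def,
    ← Lp.norm_def] at h
  refine le_trans (le_of_eq ?_) h
  refine integral_congr_ae ?_
  filter_upwards [(Lp.memLp u).norm.coeFn_toLp, (Lp.memLp v).norm.coeFn_toLp] with z h1 h2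
  rw [h1, h2]; simp [mul_comm]

variable [InnerProductSpace ℝ F]

/-- A measurable, essentially bounded field of bilinear forms. -/
structure IsBddForm (μ : Measure α) (m : α → F →ₗ[ℝ] F →ₗ[ℝ] ℝ) : Prop where
  bound : ∃ M : ℝ, 0 ≤ M ∧ ∀ᵐ z ∂μ, ∀ u v, |m z u v| ≤ M * (‖u‖ * ‖v‖)
  meas : ∀ u v : α → F, AEStronglyMeasurable u μ → AEStronglyMeasurable v μ →
    AEStronglyMeasurable (fun z => m z (u z) (v z)) μ

lemma IsBddForm.integrable {m : α → F →ₗ[ℝ] F →ₗ[ℝ] ℝ} (h : IsBddForm μ m) (u v : Lp F 2 μ) :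
    Integrable (fun z => m z (u z) (v z)) μ := by
  obtain ⟨M, -, hM⟩ := h.bound
  refine ((integrable_norm_mul_norm u v).const_mul M).mono'
    (h.meas _ _ (Lp.aestronglyMeasurable u) (Lp.aestronglyMeasurable v)) ?_
  filter_upwards [hM] with z hz using hz _ _

/-- The bounded bilinear form on `L²` obtained by integrating a bounded field of forms. -/
noncomputable def lpForm {m : α → F →ₗ[ℝ] F →ₗ[ℝ] ℝ} (h : IsBddForm μ m) :
    Lp F 2 μ →L[ℝ] Lp F 2 μ →L[ℝ] ℝ :=
  LinearMap.mkContinuous₂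
    (LinearMap.mk₂ ℝ (fun u v : Lp F 2 μ => ∫ z, m z (u z) (v z) ∂μ)
      (fun u u' v => by
        rw [← integral_add (h.integrable _ _) (h.integrable _ _)]
        refine integral_congr_ae ?_
        filter_upwards [Lp.coeFn_add u u'] with z hz
        simp only [hz, Pi.add_apply, map_add, LinearMap.add_apply])
      (fun c u v => by
        rw [smul_eq_mul, ← integral_const_mul]
        refine integral_congr_ae ?_
        filter_upwards [Lp.coeFn_smul c u] with z hz
        simp only [hz, Pi.smul_apply, map_smul, LinearMap.smul_apply, smul_eq_mul])
      (fun u v v' => by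
        rw [← integral_add (h.integrable _ _) (h.integrable _ _)]
        refine integral_congr_ae ?_
        filter_upwards [Lp.coeFn_add v v'] with z hz
        simp only [hz, Pi.add_apply, map_add])
      (fun c u v => by
        rw [smul_eq_mul, ← integral_const_mul]
        refine integral_congr_ae ?_
        filter_upwards [Lp.coeFn_smul c v] with z hz
        simp only [hz, Pi.smul_apply, map_smul, smul_eq_mul]))
    h.bound.choose
    (fun u v => by
      obtain ⟨h0, hM⟩ := h.bound.choose_spec
      simp only [LinearMap.mk₂_apply]
      refine (norm_integral_le_integral_norm _).trans ?_
      rw [mul_assoc]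
      refine le_trans ?_ (mul_le_mul_of_nonneg_left (integral_norm_mul_norm_le u v) h0)
      rw [← integral_const_mul]
      refine integral_mono_ae (h.integrable u v).norm
        ((integrable_norm_mul_norm u v).const_mul _) ?_
      filter_upwards [hM] with z hz using hz _ _)

lemma lpForm_apply {m : α → F →ₗ[ℝ] F →ₗ[ℝ] ℝ} (h : IsBddForm μ m) (u v : Lp F 2 μ) :
    lpForm h u v = ∫ z, m z (u z) (v z) ∂μ := rfl

end LpForm

/-! ### Jets, the energy space and the closure of the `C¹` functions -/

/-- Triples (value, `x`-gradient, `y`-derivative). -/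
abbrev Jet (n : ℕ) : Type := WithLp 2 (ℝ × WithLp 2 (EuclideanSpace ℝ (Fin n) × ℝ))

/-- The jet with the given components. -/
abbrev Jet.mk {n : ℕ} (a : ℝ) (b : EuclideanSpace ℝ (Fin n)) (c : ℝ) : Jet n :=
  WithLp.toLp 2 (a, WithLp.toLp 2 (b, c))

lemma Jet.norm_sq {n : ℕ} (j : Jet n) :
    ‖j‖ ^ 2 = j.fst ^ 2 + ‖j.snd.fst‖ ^ 2 + j.snd.snd ^ 2 := by
  rw [WithLp.prod_norm_sq_eq_of_L2, WithLp.prod_norm_sq_eq_of_L2]; simp [add_assoc]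

lemma Jet.abs_fst_le {n : ℕ} (j : Jet n) : |j.fst| ≤ ‖j‖ := WithLp.norm_fst_le _ j

lemma Jet.norm_snd_fst_le {n : ℕ} (j : Jet n) : ‖j.snd.fst‖ ≤ ‖j‖ :=
  (WithLp.norm_fst_le _ _).trans (WithLp.norm_snd_le _ j)

lemma Jet.abs_snd_snd_le {n : ℕ} (j : Jet n) : |j.snd.snd| ≤ ‖j‖ :=
  (WithLp.norm_snd_le _ j.snd).trans (WithLp.norm_snd_le _ j)

lemma Jet.continuous_mk {n : ℕ} {α : Type*} [TopologicalSpace α] {a : α → ℝ}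
    {b : α → EuclideanSpace ℝ (Fin n)} {c : α → ℝ} (ha : Continuous a) (hb : Continuous b)
    (hc : Continuous c) : Continuous (fun z => Jet.mk (a z) (b z) (c z)) :=
  (WithLp.prod_continuous_toLp 2 _ _).comp
    (ha.prodMk ((WithLp.prod_continuous_toLp 2 _ _).comp (hb.prodMk hc)))

lemma Jet.continuous_fst {n : ℕ} : Continuous (fun j : Jet n => j.fst) :=
  WithLp.continuous_fst 2 _ _

lemma Jet.continuous_snd_fst {n : ℕ} : Continuous (fun j : Jet n => j.snd.fst) :=
  (WithLp.continuous_fst 2 _ _).comp (WithLp.continuous_snd 2 _ _)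

lemma Jet.continuous_snd_snd {n : ℕ} : Continuous (fun j : Jet n => j.snd.snd) :=
  (WithLp.continuous_snd 2 _ _).comp (WithLp.continuous_snd 2 _ _)

/-- Functionals that involve only some components of a jet become inner products with a fixed jet,
and hence are continuous on `L²`. -/
lemma Jet.inner_mk {n : ℕ} (a : ℝ) (b : EuclideanSpace ℝ (Fin n)) (c : ℝ) (j : Jet n) :
    inner ℝ (Jet.mk a b c) j = a * j.fst + (inner ℝ b j.snd.fst + c * j.snd.snd) := by
  rw [WithLp.prod_inner_apply, WithLp.prod_inner_apply]
  simp [mul_comm]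

lemma Jet.norm_mk_le {n : ℕ} (a : ℝ) (b : EuclideanSpace ℝ (Fin n)) (c : ℝ) :
    ‖Jet.mk a b c‖ ≤ |a| + (‖b‖ + |c|) := by
  refine abs_le_of_sq_le_sq' ?_ (by positivity) |>.2
  rw [Jet.norm_sq]
  change a ^ 2 + ‖b‖ ^ 2 + c ^ 2 ≤ _
  rw [← sq_abs a, ← sq_abs c]
  have := abs_nonneg a
  have := abs_nonneg c
  have := norm_nonneg b
  nlinarith [mul_nonneg (abs_nonneg a) (norm_nonneg b), mul_nonneg (abs_nonneg a) (abs_nonneg c),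
    mul_nonneg (norm_nonneg b) (abs_nonneg c)]

/-- The first order jet of a differentiable function. -/
noncomputable def jet {n : ℕ} (φ : Space n → ℝ) (z : Space n) : Jet n :=
  Jet.mk (φ z) (gradX φ z) (derivY φ z)

/-- The first order jet of an element of `H¹`. -/
noncomputable def H1.jet {n : ℕ} {Ω : Set (EuclideanSpace ℝ (Fin n))} (u : H1 Ω) (z : Space n) :
    Jet n :=
  Jet.mk (u.val z) (u.dx z) (u.dy z)

/-- Pairs of a jet in `L²` of the cylinder and a boundary value in `L²` of the bottom. -/
abbrev EnergySpace {n : ℕ} (Ω : Set (EuclideanSpace ℝ (Fin n))) : Type :=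
  WithLp 2 (Lp (Jet n) 2 (volume.restrict (cyl Ω)) × Lp ℝ 2 (volume.restrict Ω))

lemma IsC1Bottom.continuous_jet {n : ℕ} {Ω : Set (EuclideanSpace ℝ (Fin n))} {φ : Space n → ℝ}
    (hφ : IsC1Bottom Ω φ) : Continuous (NDMap.jet φ) :=
  Jet.continuous_mk hφ.contDiff.continuous (continuous_gradX hφ.contDiff)
    (continuous_derivY hφ.contDiff)

lemma IsC1Bottom.memLp_jet {n : ℕ} {Ω : Set (EuclideanSpace ℝ (Fin n))} {φ : Space n → ℝ}
    (hφ : IsC1Bottom Ω φ) : MemLp (NDMap.jet φ) 2 (volume.restrict (cyl Ω)) := by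
  refine (hφ.continuous_jet.memLp_of_hasCompactSupport ?_).restrict _
  refine HasCompactSupport.intro hφ.compactSupport fun z hz => ?_
  have h0 : φ z = 0 := image_eq_zero_of_notMem_tsupport hz
  have h1 : fderiv ℝ φ z = 0 := by
    by_contra h; exact hz (support_fderiv_subset ℝ h)
  simp only [NDMap.jet, h0, gradX_eq_zero_of_fderiv h1, derivY, h1]
  rfl

lemma IsC1Bottom.memLp_bottom {n : ℕ} {Ω : Set (EuclideanSpace ℝ (Fin n))} {φ : Space n → ℝ}
    (hφ : IsC1Bottom Ω φ) : MemLp (fun x => φ (x, 0)) 2 (volume.restrict Ω) := by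
  have := hφ.contDiff.continuous
  exact (Continuous.memLp_of_hasCompactSupport (by fun_prop)
    (hasCompactSupport_slice_left hφ.compactSupport 0)).restrict _

/-- The element of the energy space given by a `C¹` function. -/
noncomputable def IsC1Bottom.toEnergy {n : ℕ} {Ω : Set (EuclideanSpace ℝ (Fin n))}
    {φ : Space n → ℝ} (hφ : IsC1Bottom Ω φ) : EnergySpace Ω :=
  WithLp.toLp 2 (hφ.memLp_jet.toLp _, hφ.memLp_bottom.toLp _)

lemma IsC1Bottom.toEnergy_fst {n : ℕ} {Ω : Set (EuclideanSpace ℝ (Fin n))}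
    {φ : Space n → ℝ} (hφ : IsC1Bottom Ω φ) :
    (hφ.toEnergy.fst : Space n → Jet n) =ᵐ[volume.restrict (cyl Ω)] NDMap.jet φ :=
  hφ.memLp_jet.coeFn_toLp

lemma IsC1Bottom.toEnergy_snd {n : ℕ} {Ω : Set (EuclideanSpace ℝ (Fin n))}
    {φ : Space n → ℝ} (hφ : IsC1Bottom Ω φ) :
    (hφ.toEnergy.snd : EuclideanSpace ℝ (Fin n) → ℝ) =ᵐ[volume.restrict Ω] fun x => φ (x, 0) :=
  hφ.memLp_bottom.coeFn_toLp

lemma IsC1Bottom.add {n : ℕ} {Ω : Set (EuclideanSpace ℝ (Fin n))} {φ ψ : Space n → ℝ}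
    (hφ : IsC1Bottom Ω φ) (hψ : IsC1Bottom Ω ψ) : IsC1Bottom Ω (φ + ψ) :=
  ⟨hφ.contDiff.add hψ.contDiff, hφ.compactSupport.add hψ.compactSupport,
    (tsupport_add φ ψ).trans (union_subset hφ.tsupport_subset hψ.tsupport_subset)⟩

lemma IsC1Bottom.smul {n : ℕ} {Ω : Set (EuclideanSpace ℝ (Fin n))} {φ : Space n → ℝ}
    (hφ : IsC1Bottom Ω φ) (c : ℝ) : IsC1Bottom Ω (c • φ) :=
  ⟨contDiff_const.smul hφ.contDiff, hφ.compactSupport.smul_left (f := fun _ => c),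
    (tsupport_smul_subset_right (fun _ => c) φ).trans hφ.tsupport_subset⟩

lemma isC1Bottom_zero {n : ℕ} {Ω : Set (EuclideanSpace ℝ (Fin n))} :
    IsC1Bottom Ω (0 : Space n → ℝ) :=
  ⟨contDiff_const, HasCompactSupport.zero, by simp [tsupport]⟩

lemma jet_add {n : ℕ} {φ ψ : Space n → ℝ} (hφ : Differentiable ℝ φ) (hψ : Differentiable ℝ ψ)
    (z : Space n) : jet (φ + ψ) z = jet φ z + jet ψ z := by
  have h : fderiv ℝ (φ + ψ) z = fderiv ℝ φ z + fderiv ℝ ψ z := fderiv_add (hφ z) (hψ z)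
  have h1 : gradX (φ + ψ) z = gradX φ z + gradX ψ z := by ext k; simp [gradX, h]
  have h2 : derivY (φ + ψ) z = derivY φ z + derivY ψ z := by simp [derivY, h]
  simp only [jet, h1, h2]; rfl

lemma jet_smul {n : ℕ} {φ : Space n → ℝ} (hφ : Differentiable ℝ φ) (c : ℝ)
    (z : Space n) : jet (c • φ) z = c • jet φ z := by
  have h : fderiv ℝ (c • φ) z = c • fderiv ℝ φ z := fderiv_const_smul (hφ z) c
  have h1 : gradX (c • φ) z = c • gradX φ z := by ext k; simp [gradX, h]
  have h2 : derivY (c • φ) z = c • derivY φ z := by simp [derivY, h]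
  simp only [jet, h1, h2]; rfl

/-- The `C¹` functions, as a subspace of the energy space. -/
def trialSpace {n : ℕ} (Ω : Set (EuclideanSpace ℝ (Fin n))) : Submodule ℝ (EnergySpace Ω) where
  carrier := {x | ∃ φ, ∃ hφ : IsC1Bottom Ω φ, x = hφ.toEnergy}
  zero_mem' := by
    refine ⟨0, isC1Bottom_zero, ?_⟩
    have h0 : jet (0 : Space n → ℝ) = 0 := by
      funext z
      have h : fderiv ℝ (0 : Space n → ℝ) z = 0 := by simp
      simp only [jet, gradX_eq_zero_of_fderiv h, derivY, h]; rfl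
    refine WithLp.ofLp_injective 2 (Prod.ext ?_ ?_)
    · exact (Lp.ext ((isC1Bottom_zero.toEnergy_fst).trans
        (by rw [h0]; exact (Lp.coeFn_zero _ _ _).symm))).symm
    · exact (Lp.ext ((isC1Bottom_zero.toEnergy_snd).trans (Lp.coeFn_zero _ _ _).symm)).symm
  add_mem' := by
    rintro _ _ ⟨φ, hφ, rfl⟩ ⟨ψ, hψ, rfl⟩
    refine ⟨φ + ψ, hφ.add hψ, ?_⟩
    refine WithLp.ofLp_injective 2 (Prod.ext ?_ ?_)
    · refine Lp.ext ((Lp.coeFn_add _ _).trans ?_)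
      filter_upwards [hφ.toEnergy_fst, hψ.toEnergy_fst, (hφ.add hψ).toEnergy_fst] with z h1 h2 h3
      exact ((congrArg₂ (· + ·) h1 h2).trans (jet_add (hφ.contDiff.differentiable one_ne_zero)
        (hψ.contDiff.differentiable one_ne_zero) z).symm).trans h3.symm
    · refine Lp.ext ((Lp.coeFn_add _ _).trans ?_)
      filter_upwards [hφ.toEnergy_snd, hψ.toEnergy_snd, (hφ.add hψ).toEnergy_snd] with z h1 h2 h3
      exact (congrArg₂ (· + ·) h1 h2).trans h3.symm
  smul_mem' := by
    rintro c _ ⟨φ, hφ, rfl⟩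
    refine ⟨c • φ, hφ.smul c, ?_⟩
    refine WithLp.ofLp_injective 2 (Prod.ext ?_ ?_)
    · refine Lp.ext ((Lp.coeFn_smul _ _).trans ?_)
      filter_upwards [hφ.toEnergy_fst, (hφ.smul c).toEnergy_fst] with z h1 h3
      exact ((congrArg (c • ·) h1).trans (jet_smul (hφ.contDiff.differentiable one_ne_zero) c
        z).symm).trans h3.symm
    · refine Lp.ext ((Lp.coeFn_smul _ _).trans ?_)
      filter_upwards [hφ.toEnergy_snd, (hφ.smul c).toEnergy_snd] with z h1 h3
      exact (congrArg (c • ·) h1).trans h3.symm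

/-- The closure of the `C¹` functions in the energy space: the elements of `H¹₀(Ω × [0, ∞))`
together with their traces. -/
noncomputable def energyDomain {n : ℕ} (Ω : Set (EuclideanSpace ℝ (Fin n))) : Submodule ℝ (EnergySpace Ω) :=
  (trialSpace Ω).topologicalClosure

lemma IsC1Bottom.toEnergy_mem {n : ℕ} {Ω : Set (EuclideanSpace ℝ (Fin n))}
    {φ : Space n → ℝ} (hφ : IsC1Bottom Ω φ) : hφ.toEnergy ∈ energyDomain Ω :=
  Submodule.le_topologicalClosure _ ⟨φ, hφ, rfl⟩

/-- The density principle by which identities and inequalities pass from `C¹` functions to the whole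
energy domain: both sides only have to be continuous in the energy norm. -/
lemma energyDomain_induction {n : ℕ} {Ω : Set (EuclideanSpace ℝ (Fin n))}
    {P : EnergySpace Ω → Prop} (hP : IsClosed {x | P x})
    (h : ∀ φ (hφ : IsC1Bottom Ω φ), P hφ.toEnergy) : ∀ x ∈ energyDomain Ω, P x := by
  intro x hx
  refine closure_minimal (t := {x | P x}) ?_ hP hx
  rintro _ ⟨φ, hφ, rfl⟩
  exact h φ hφ


/-! ### The energy domain as `H¹₀` with traces -/

lemma inner_toLp_eq_integral {α F : Type*} [MeasurableSpace α] {μ : Measure α}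
    [NormedAddCommGroup F] [InnerProductSpace ℝ F] {r : α → F} (hr : MemLp r 2 μ) (x : Lp F 2 μ) :
    inner ℝ (hr.toLp r) x = ∫ z, inner ℝ (r z) (x z) ∂μ := by
  rw [L2.inner_def]
  refine integral_congr_ae ?_
  filter_upwards [hr.coeFn_toLp] with z hz
  rw [hz]

lemma memLp_fst {n : ℕ} {μ : Measure (Space n)} {j : Space n → Jet n} (hj : MemLp j 2 μ) :
    MemLp (fun z => (j z).fst) 2 μ :=
  hj.mono (Jet.continuous_fst.comp_aestronglyMeasurable hj.aestronglyMeasurable)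
    (Eventually.of_forall fun z => Jet.abs_fst_le (j z))

lemma memLp_snd_fst {n : ℕ} {μ : Measure (Space n)} {j : Space n → Jet n} (hj : MemLp j 2 μ) :
    MemLp (fun z => (j z).snd.fst) 2 μ :=
  hj.mono (Jet.continuous_snd_fst.comp_aestronglyMeasurable hj.aestronglyMeasurable)
    (Eventually.of_forall fun z => Jet.norm_snd_fst_le (j z))

lemma memLp_snd_snd {n : ℕ} {μ : Measure (Space n)} {j : Space n → Jet n} (hj : MemLp j 2 μ) :
    MemLp (fun z => (j z).snd.snd) 2 μ :=
  hj.mono (Jet.continuous_snd_snd.comp_aestronglyMeasurable hj.aestronglyMeasurable)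
    (Eventually.of_forall fun z => Jet.abs_snd_snd_le (j z))

lemma memLp_snd_fst_apply {n : ℕ} {μ : Measure (Space n)} {j : Space n → Jet n} (hj : MemLp j 2 μ)
    (i : Fin n) : MemLp (fun z => (j z).snd.fst i) 2 μ :=
  (memLp_snd_fst hj).mono
    ((EuclideanSpace.proj i : EuclideanSpace ℝ (Fin n) →L[ℝ] ℝ).continuous.comp_aestronglyMeasurable
      (memLp_snd_fst hj).aestronglyMeasurable)
    (Eventually.of_forall fun _ => PiLp.norm_apply_le _ i)

lemma aestronglyMeasurable_jet_mk {n : ℕ} {μ : Measure (Space n)} {a c : Space n → ℝ}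
    {b : Space n → EuclideanSpace ℝ (Fin n)} (ha : AEStronglyMeasurable a μ)
    (hb : AEStronglyMeasurable b μ) (hc : AEStronglyMeasurable c μ) :
    AEStronglyMeasurable (fun z => Jet.mk (a z) (b z) (c z)) μ :=
  (Jet.continuous_mk (n := n) (α := ℝ × EuclideanSpace ℝ (Fin n) × ℝ) continuous_fst
    (continuous_fst.comp continuous_snd)
    (continuous_snd.comp continuous_snd)).comp_aestronglyMeasurable (ha.prodMk (hb.prodMk hc))

lemma memLp_jet_mk {n : ℕ} {μ : Measure (Space n)} {a c : Space n → ℝ}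
    {b : Space n → EuclideanSpace ℝ (Fin n)} (ha : MemLp a 2 μ) (hb : MemLp b 2 μ)
    (hc : MemLp c 2 μ) : MemLp (fun z => Jet.mk (a z) (b z) (c z)) 2 μ := by
  have h : MemLp (fun z => ‖a z‖ + (‖b z‖ + ‖c z‖)) 2 μ := ha.norm.add (hb.norm.add hc.norm)
  refine h.mono (aestronglyMeasurable_jet_mk ha.1 hb.1 hc.1) (Eventually.of_forall fun z => ?_)
  exact (Jet.norm_mk_le _ _ _).trans (le_abs_self _)

lemma H1.memLp_jet {n : ℕ} {Ω : Set (EuclideanSpace ℝ (Fin n))} (u : H1 Ω) :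
    MemLp u.jet 2 (volume.restrict (cyl Ω)) :=
  memLp_jet_mk u.memLp_val u.memLp_dx u.memLp_dy

lemma IsTestFunction.memLp {n : ℕ} {U : Set (Space n)} {μ : Measure (Space n)}
    [IsFiniteMeasureOnCompacts μ] {ψ : Space n → ℝ} (hψ : IsTestFunction U ψ) : MemLp ψ 2 μ :=
  hψ.smooth.continuous.memLp_of_hasCompactSupport hψ.compactSupport

lemma IsTestFunction.memLp_gradX {n : ℕ} {U : Set (Space n)} {ψ : Space n → ℝ}
    (hψ : IsTestFunction U ψ) (T : Set (Space n)) (i : Fin n) :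
    MemLp (fun z => gradX ψ z i) 2 (volume.restrict T) :=
  ((continuous_gradX_apply (hψ.smooth.of_le (by norm_cast)) i).memLp_of_hasCompactSupport
    (hasCompactSupport_gradX_apply hψ.compactSupport i)).restrict T

lemma IsTestFunction.memLp_derivY {n : ℕ} {U : Set (Space n)} {ψ : Space n → ℝ}
    (hψ : IsTestFunction U ψ) (T : Set (Space n)) :
    MemLp (derivY ψ) 2 (volume.restrict T) :=
  ((continuous_derivY (hψ.smooth.of_le (by norm_cast))).memLp_of_hasCompactSupport
    (hasCompactSupport_derivY hψ.compactSupport)).restrict T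

/-- The identity says that the jet is orthogonal to the fixed `L²` jet `(∂_i ψ, ψ e_i, 0)`, which is
a closed condition. For a `C¹` function `φ` the inner product is the integral of `∂_i(φψ)`, which
vanishes. -/
lemma energyDomain_weak_dx {n : ℕ} {Ω : Set (EuclideanSpace ℝ (Fin n))}
    {x : EnergySpace Ω} (hx : x ∈ energyDomain Ω) {ψ : Space n → ℝ}
    (hψ : IsTestFunction (cyl Ω) ψ) (i : Fin n) :
    ∫ z in cyl Ω, (x.fst z).fst * gradX ψ z i = -∫ z in cyl Ω, (x.fst z).snd.fst i * ψ z := by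
  have hψ1 : ContDiff ℝ 1 ψ := hψ.smooth.of_le (by norm_cast)
  have hr : MemLp (fun z => Jet.mk (gradX ψ z i) (ψ z • EuclideanSpace.single i (1 : ℝ)) 0) 2
      (volume.restrict (cyl Ω)) := by
    refine memLp_jet_mk (hψ.memLp_gradX _ i) ?_ MemLp.zero
    exact (Continuous.memLp_of_hasCompactSupport (by have := hψ1.continuous; fun_prop)
      hψ.compactSupport.smul_right).restrict _
  have hin : ∀ (j : Jet n) (z : Space n), inner ℝ (Jet.mk (gradX ψ z i)
      (ψ z • EuclideanSpace.single i (1 : ℝ)) 0) j = j.fst * gradX ψ z i + j.snd.fst i * ψ z := by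
    intro j z
    rw [Jet.inner_mk, real_inner_smul_left, EuclideanSpace.inner_single_left]
    simp; ring
  have key : ∀ x ∈ energyDomain Ω, inner ℝ (hr.toLp _) x.fst = 0 := by
    refine energyDomain_induction ?_ ?_
    · exact isClosed_eq (continuous_const.inner (WithLp.continuous_fst 2 _ _)) continuous_const
    · intro φ hφ
      have hs := hφ.compactSupport
      have h0 := setIntegral_gradX (hφ.contDiff.mul hψ1) (hs.mul_right (f' := ψ)) i
      rw [setIntegral_cyl_eq MeasurableSet.univ (subset_univ Ω)] at h0
      · refine (inner_toLp_eq_integral hr _).trans (Eq.trans ?_ h0)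
        refine integral_congr_ae ?_
        filter_upwards [hφ.toEnergy_fst] with z hz
        rw [hz, hin, gradX_mul (hφ.contDiff.differentiable one_ne_zero z)
          (hψ1.differentiable one_ne_zero z)]
        simp [jet]; ring
      · intro z hz
        rw [gradX_mul (hφ.contDiff.differentiable one_ne_zero z)
          (hψ1.differentiable one_ne_zero z)]
        simp [hφ.eq_zero hz, hφ.gradX_eq_zero hz]
  have h := key x hx
  rw [inner_toLp_eq_integral] at h
  simp_rw [hin] at h
  rw [integral_add] at h
  · linarith
  · exact MemLp.integrable_mul (p := 2) (q := 2) (memLp_fst (Lp.memLp _)) (hψ.memLp_gradX _ i)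
  · exact MemLp.integrable_mul (p := 2) (q := 2) (memLp_snd_fst_apply (Lp.memLp _) i) hψ.memLp

/-- Same argument as for the horizontal derivatives, with the jet `(∂_y ψ, 0, ψ)`. The boundary term
at `y = 0` vanishes because `ψ` is supported in the open half cylinder. -/
lemma energyDomain_weak_dy {n : ℕ} {Ω : Set (EuclideanSpace ℝ (Fin n))}
    {x : EnergySpace Ω} (hx : x ∈ energyDomain Ω) {ψ : Space n → ℝ}
    (hψ : IsTestFunction (cyl Ω) ψ) :
    ∫ z in cyl Ω, (x.fst z).fst * derivY ψ z = -∫ z in cyl Ω, (x.fst z).snd.snd * ψ z := by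
  have hψ1 : ContDiff ℝ 1 ψ := hψ.smooth.of_le (by norm_cast)
  have hr : MemLp (fun z => Jet.mk (derivY ψ z) 0 (ψ z)) 2 (volume.restrict (cyl Ω)) :=
    memLp_jet_mk (hψ.memLp_derivY _) MemLp.zero hψ.memLp
  have hin : ∀ (j : Jet n) (z : Space n), inner ℝ (Jet.mk (derivY ψ z)
      0 (ψ z)) j = j.fst * derivY ψ z + j.snd.snd * ψ z := by
    intro j z
    rw [Jet.inner_mk]; simp; ring
  have key : ∀ x ∈ energyDomain Ω, inner ℝ (hr.toLp _) x.fst = 0 := by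
    refine energyDomain_induction ?_ ?_
    · exact isClosed_eq (continuous_const.inner (WithLp.continuous_fst 2 _ _)) continuous_const
    · intro φ hφ
      have hs := hφ.compactSupport
      have h0 := setIntegral_derivY (hφ.contDiff.mul hψ1) (hs.mul_right (f' := ψ)) Ω
      have hb : ∀ x, ψ (x, 0) = 0 := by
        intro x
        by_contra h
        exact lt_irrefl (0 : ℝ) (hψ.tsupport_subset (subset_tsupport _ h)).2
      simp only [hb, mul_zero, integral_zero, neg_zero] at h0
      refine (inner_toLp_eq_integral hr _).trans (Eq.trans ?_ h0)
      refine integral_congr_ae ?_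
      filter_upwards [hφ.toEnergy_fst] with z hz
      rw [hz, hin, derivY_mul (hφ.contDiff.differentiable one_ne_zero z)
        (hψ1.differentiable one_ne_zero z)]
      simp [jet]; ring
  have h := key x hx
  rw [inner_toLp_eq_integral] at h
  simp_rw [hin] at h
  rw [integral_add] at h
  · linarith
  · exact MemLp.integrable_mul (p := 2) (q := 2) (memLp_fst (Lp.memLp _)) (hψ.memLp_derivY _)
  · exact MemLp.integrable_mul (p := 2) (q := 2) (memLp_snd_snd (Lp.memLp _)) hψ.memLp

/-- The element of `H¹` underlying an element of the energy domain. -/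
noncomputable def toH1 {n : ℕ} {Ω : Set (EuclideanSpace ℝ (Fin n))}
    {x : EnergySpace Ω} (hx : x ∈ energyDomain Ω) : H1 Ω where
  val z := (x.fst z).fst
  dx z := (x.fst z).snd.fst
  dy z := (x.fst z).snd.snd
  memLp_val := memLp_fst (Lp.memLp _)
  memLp_dx := memLp_snd_fst (Lp.memLp _)
  memLp_dy := memLp_snd_snd (Lp.memLp _)
  weak_dx _ hψ i := energyDomain_weak_dx hx hψ i
  weak_dy _ hψ := energyDomain_weak_dy hx hψ

/-- The norm of a jet dominates each component and is dominated by their sum, so three `L²` limits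
amount to one. -/
lemma tendstoH1_iff {n : ℕ} {Ω : Set (EuclideanSpace ℝ (Fin n))} {φ : ℕ → Space n → ℝ}
    (hφ : ∀ k, IsC1Bottom Ω (φ k)) (u : H1 Ω) :
    TendstoH1 φ u ↔ Tendsto (fun k => eLpNorm (fun z => jet (φ k) z - u.jet z) 2
      (volume.restrict (cyl Ω))) atTop (𝓝 0) := by
  constructor
  · rintro ⟨h1, h2, h3⟩
    refine tendsto_of_tendsto_of_tendsto_of_le_of_le tendsto_const_nhds
      (by simpa using h1.add (h2.add h3)) (fun _ => zero_le) fun k => ?_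
    have m0 := memLp_fst ((hφ k).memLp_jet.sub u.memLp_jet)
    have m1 := memLp_snd_fst ((hφ k).memLp_jet.sub u.memLp_jet)
    have m2 := memLp_snd_snd ((hφ k).memLp_jet.sub u.memLp_jet)
    have hle : eLpNorm (fun z => jet (φ k) z - u.jet z) 2 (volume.restrict (cyl Ω)) ≤
        eLpNorm ((fun z => ‖φ k z - u.val z‖) + ((fun z => ‖gradX (φ k) z - u.dx z‖)
          + fun z => ‖derivY (φ k) z - u.dy z‖)) 2 (volume.restrict (cyl Ω)) := by
      refine eLpNorm_mono fun z => ?_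
      exact (Jet.norm_mk_le _ _ _).trans (le_abs_self _)
    refine hle.trans ((eLpNorm_add_le m0.norm.1 (m1.norm.1.add m2.norm.1) (by norm_num)).trans ?_)
    gcongr
    · rw [eLpNorm_norm]; exact le_rfl
    · refine (eLpNorm_add_le m1.norm.1 m2.norm.1 (by norm_num)).trans ?_
      rw [eLpNorm_norm, eLpNorm_norm]; exact le_rfl
  · intro h
    refine ⟨?_, ?_, ?_⟩
    · exact tendsto_of_tendsto_of_tendsto_of_le_of_le tendsto_const_nhds h (fun _ => zero_le)
        fun k => eLpNorm_mono fun z => Jet.abs_fst_le (jet (φ k) z - u.jet z)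
    · exact tendsto_of_tendsto_of_tendsto_of_le_of_le tendsto_const_nhds h (fun _ => zero_le)
        fun k => eLpNorm_mono fun z => Jet.norm_snd_fst_le (jet (φ k) z - u.jet z)
    · exact tendsto_of_tendsto_of_tendsto_of_le_of_le tendsto_const_nhds h (fun _ => zero_le)
        fun k => eLpNorm_mono fun z => Jet.abs_snd_snd_le (jet (φ k) z - u.jet z)

lemma tendsto_energySpace_iff {n : ℕ} {Ω : Set (EuclideanSpace ℝ (Fin n))} {X : ℕ → EnergySpace Ω}
    {x : EnergySpace Ω} : Tendsto X atTop (𝓝 x) ↔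
      Tendsto (fun k => (X k).fst) atTop (𝓝 x.fst) ∧ Tendsto (fun k => (X k).snd) atTop (𝓝 x.snd) := by
  constructor
  · intro h
    exact ⟨((WithLp.continuous_fst 2 _ _).tendsto x).comp h,
      ((WithLp.continuous_snd 2 _ _).tendsto x).comp h⟩
  · rintro ⟨h1, h2⟩
    exact ((WithLp.prod_continuous_toLp 2 _ _).tendsto (x.fst, x.snd)).comp (h1.prodMk_nhds h2)

/-- The dictionary between sequential closures in `H¹` with convergent traces and the topological
closure in the Hilbert space `EnergySpace Ω`. -/
lemma tendsto_toEnergy_iff {n : ℕ} {Ω : Set (EuclideanSpace ℝ (Fin n))} {φ : ℕ → Space n → ℝ}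
    (hφ : ∀ k, IsC1Bottom Ω (φ k)) {u : H1 Ω} {w : EuclideanSpace ℝ (Fin n) → ℝ}
    {x : EnergySpace Ω} (h1 : (x.fst : Space n → Jet n) =ᵐ[volume.restrict (cyl Ω)] u.jet)
    (h2 : (x.snd : EuclideanSpace ℝ (Fin n) → ℝ) =ᵐ[volume.restrict Ω] w) :
    Tendsto (fun k => (hφ k).toEnergy) atTop (𝓝 x) ↔ TendstoH1 φ u ∧
      Tendsto (fun k => eLpNorm (fun x => φ k (x, 0) - w x) 2 (volume.restrict Ω)) atTop (𝓝 0) := by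
  rw [tendsto_energySpace_iff, tendstoH1_iff hφ, Lp.tendsto_Lp_iff_tendsto_eLpNorm',
    Lp.tendsto_Lp_iff_tendsto_eLpNorm']
  have e1 : ∀ k, eLpNorm ((hφ k).toEnergy.fst - x.fst : Space n → Jet n) 2
      (volume.restrict (cyl Ω)) = eLpNorm (fun z => jet (φ k) z - u.jet z) 2
      (volume.restrict (cyl Ω)) := fun k => by
    refine eLpNorm_congr_ae ?_
    filter_upwards [(hφ k).toEnergy_fst, h1] with z a b
    simp [a, b]
  have e2 : ∀ k, eLpNorm ((hφ k).toEnergy.snd - x.snd : EuclideanSpace ℝ (Fin n) → ℝ) 2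
      (volume.restrict Ω) = eLpNorm (fun x => φ k (x, 0) - w x) 2
      (volume.restrict Ω) := fun k => by
    refine eLpNorm_congr_ae ?_
    filter_upwards [(hφ k).toEnergy_snd, h2] with z a b
    simp [a, b]
  simp_rw [e1, e2]

lemma exists_seq_of_mem_energyDomain {n : ℕ} {Ω : Set (EuclideanSpace ℝ (Fin n))}
    {x : EnergySpace Ω} (hx : x ∈ energyDomain Ω) :
    ∃ φ : ℕ → Space n → ℝ, ∃ hφ : ∀ k, IsC1Bottom Ω (φ k),
      Tendsto (fun k => (hφ k).toEnergy) atTop (𝓝 x) := by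
  obtain ⟨X, hX, hXx⟩ := mem_closure_iff_seq_limit.1 hx
  choose φ hφ hXφ using hX
  refine ⟨φ, hφ, ?_⟩
  simpa only [← hXφ] using hXx

lemma isTrace_toH1 {n : ℕ} {Ω : Set (EuclideanSpace ℝ (Fin n))}
    {x : EnergySpace Ω} (hx : x ∈ energyDomain Ω) : IsTrace (toH1 hx) x.snd := by
  obtain ⟨φ, hφ, h⟩ := exists_seq_of_mem_energyDomain hx
  exact ⟨Lp.memLp _, φ, hφ, (tendsto_toEnergy_iff hφ (u := toH1 hx) (w := x.snd)
    (Eventually.of_forall fun z => rfl) (Eventually.of_forall fun z => rfl)).1 h⟩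

lemma memH10_toH1 {n : ℕ} {Ω : Set (EuclideanSpace ℝ (Fin n))}
    {x : EnergySpace Ω} (hx : x ∈ energyDomain Ω) : MemH10 (toH1 hx) := by
  obtain ⟨-, φ, hφ, h, -⟩ := isTrace_toH1 hx
  exact ⟨φ, hφ, h⟩

/-- Converse of `isTrace_toH1`. Up to equality almost everywhere, the energy domain consists exactly
of the pairs of a function and its trace, so the weak formulation can be tested there. -/
lemma IsTrace.exists_mem_energyDomain {n : ℕ} {Ω : Set (EuclideanSpace ℝ (Fin n))} {v : H1 Ω}
    {w : EuclideanSpace ℝ (Fin n) → ℝ} (h : IsTrace v w) : ∃ x ∈ energyDomain Ω,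
      (x.fst : Space n → Jet n) =ᵐ[volume.restrict (cyl Ω)] v.jet ∧
      (x.snd : EuclideanSpace ℝ (Fin n) → ℝ) =ᵐ[volume.restrict Ω] w := by
  obtain ⟨hw, φ, hφ, h⟩ := h
  have h1 := v.memLp_jet.coeFn_toLp
  have h2 := hw.coeFn_toLp
  refine ⟨WithLp.toLp 2 (v.memLp_jet.toLp _, hw.toLp _), ?_, h1, h2⟩
  exact mem_closure_of_tendsto ((tendsto_toEnergy_iff hφ (x := WithLp.toLp 2
    (v.memLp_jet.toLp _, hw.toLp _)) h1 h2).2 h)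
    (Eventually.of_forall fun k => ⟨_, hφ k, rfl⟩)


/-! ### Elliptic matrices and the energy form -/

/-- Two-sided ellipticity of a symmetric matrix. -/
structure IsEllipticMatrix {n : ℕ} (l : ℝ) (A : Matrix (Fin n) (Fin n) ℝ) : Prop where
  pos : 0 < l
  symm : A.IsSymm
  lower : ∀ ξ : Fin n → ℝ, l * (ξ ⬝ᵥ ξ) ≤ ξ ⬝ᵥ (A *ᵥ ξ)
  upper : ∀ ξ : Fin n → ℝ, ξ ⬝ᵥ (A *ᵥ ξ) ≤ l⁻¹ * (ξ ⬝ᵥ ξ)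

lemma IsEllipticMatrix.posDef {n : ℕ} {l : ℝ} {A : Matrix (Fin n) (Fin n) ℝ}
    (h : IsEllipticMatrix l A) : A.PosDef := by
  refine Matrix.PosDef.of_dotProduct_mulVec_pos ?_ fun ξ hξ => ?_
  · rw [Matrix.IsHermitian, Matrix.conjTranspose_eq_transpose_of_trivial]; exact h.symm
  · have h1 : 0 < ξ ⬝ᵥ ξ := by
      have h2 : 0 ≤ ξ ⬝ᵥ ξ := by
        simp only [dotProduct]; exact Finset.sum_nonneg fun i _ => mul_self_nonneg _
      exact lt_of_le_of_ne h2 fun h3 => hξ (dotProduct_self_eq_zero.1 h3.symm)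
    simpa using (mul_pos h.pos h1).trans_le (h.lower ξ)

lemma IsEllipticMatrix.det_pos {n : ℕ} {l : ℝ} {A : Matrix (Fin n) (Fin n) ℝ}
    (h : IsEllipticMatrix l A) : 0 < A.det := h.posDef.det_pos

lemma IsEllipticMatrix.inv_symm {n : ℕ} {l : ℝ} {A : Matrix (Fin n) (Fin n) ℝ}
    (h : IsEllipticMatrix l A) : (A⁻¹).IsSymm := by
  rw [Matrix.IsSymm, Matrix.transpose_nonsing_inv, h.symm]

lemma dotProduct_mulVec_comm_of_isSymm {n : ℕ} {A : Matrix (Fin n) (Fin n) ℝ} (h : A.IsSymm)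
    (ξ ζ : Fin n → ℝ) : ξ ⬝ᵥ (A *ᵥ ζ) = ζ ⬝ᵥ (A *ᵥ ξ) := by
  rw [Matrix.dotProduct_mulVec, ← Matrix.mulVec_transpose, h, dotProduct_comm]

/-- The upper bound on `A` becomes a lower bound on `A⁻¹`: evaluate the nonnegative form of `A` at
`A⁻¹ξ - lξ`, expand, and use `l² ξ·Aξ ≤ l |ξ|²`. This avoids diagonalization. -/
lemma IsEllipticMatrix.inv_lower {n : ℕ} {l : ℝ} {A : Matrix (Fin n) (Fin n) ℝ}
    (h : IsEllipticMatrix l A) (ξ : Fin n → ℝ) : l * (ξ ⬝ᵥ ξ) ≤ ξ ⬝ᵥ (A⁻¹ *ᵥ ξ) := by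
  set ζ := A⁻¹ *ᵥ ξ with hζ
  have hA : A *ᵥ ζ = ξ := by
    rw [hζ, Matrix.mulVec_mulVec, Matrix.mul_nonsing_inv _ (isUnit_iff_ne_zero.2 h.det_pos.ne'),
      Matrix.one_mulVec]
  have h1 : 0 ≤ (ζ - l • ξ) ⬝ᵥ (A *ᵥ (ζ - l • ξ)) := by
    refine le_trans ?_ (h.lower _)
    refine mul_nonneg h.pos.le ?_
    simp only [dotProduct]; exact Finset.sum_nonneg fun i _ => mul_self_nonneg _
  have h2 : ζ ⬝ᵥ (A *ᵥ ξ) = ξ ⬝ᵥ ξ := by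
    rw [dotProduct_mulVec_comm_of_isSymm h.symm, hA]
  rw [Matrix.mulVec_sub, Matrix.mulVec_smul, hA] at h1
  simp only [dotProduct_sub, sub_dotProduct, dotProduct_smul, smul_dotProduct, smul_eq_mul, h2,
    dotProduct_comm ζ ξ] at h1
  have h3 := mul_le_mul_of_nonneg_left (h.upper ξ) (mul_pos h.pos h.pos).le
  have h4 : l * l * (l⁻¹ * (ξ ⬝ᵥ ξ)) = l * (ξ ⬝ᵥ ξ) := by have := h.pos; field_simp
  nlinarith

lemma contDiffOn_det {E : Type*} [NormedAddCommGroup E] [NormedSpace ℝ E] {n : ℕ} {s : Set E}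
    {A : E → Matrix (Fin n) (Fin n) ℝ} (h : ∀ i j, ContDiffOn ℝ ∞ (fun x => A x i j) s) :
    ContDiffOn ℝ ∞ (fun x => (A x).det) s := by
  simp only [Matrix.det_apply]
  refine ContDiffOn.sum fun σ _ => ContDiffOn.const_smul _ ?_
  exact contDiffOn_prod fun i _ => h _ _

/-- By Cramer's rule the entries of the inverse are quotients of determinants. -/
lemma contDiffOn_inv_apply {E : Type*} [NormedAddCommGroup E] [NormedSpace ℝ E] {n : ℕ} {s : Set E}
    {A : E → Matrix (Fin n) (Fin n) ℝ} (h : ∀ i j, ContDiffOn ℝ ∞ (fun x => A x i j) s)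
    (h0 : ∀ x ∈ s, (A x).det ≠ 0) (i j : Fin n) :
    ContDiffOn ℝ ∞ (fun x => (A x)⁻¹ i j) s := by
  have h1 : ∀ x, (A x)⁻¹ i j = ((A x).det)⁻¹ * ((A x).updateRow j (Pi.single i 1)).det := by
    intro x
    rw [Matrix.inv_def, Matrix.smul_apply, Matrix.adjugate_apply, Ring.inverse_eq_inv', smul_eq_mul]
  simp only [h1]
  refine ((contDiffOn_det h).inv h0).mul (contDiffOn_det fun k m => ?_)
  by_cases hk : k = j
  · subst hk; simpa using contDiffOn_const
  · simpa [Matrix.updateRow_ne hk] using h k m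

/-- Closed conditions pass from `Ω` to its closure by continuity. On the compact closure, the
coefficients are then bounded and the density is bounded away from zero. -/
lemma IsEllipticMetric.exists_closure {n : ℕ} {Ω : Set (EuclideanSpace ℝ (Fin n))}
    {g : EuclideanSpace ℝ (Fin n) → Matrix (Fin n) (Fin n) ℝ} (hg : IsEllipticMetric Ω g) :
    ∃ l, l < 1 ∧ 0 < l ∧ ∀ x ∈ closure Ω, IsEllipticMatrix l (g x) := by
  obtain ⟨l, hl0, hl1, hl⟩ := hg.elliptic
  have hc : ∀ i j, ContinuousOn (fun x => g x i j) (closure Ω) := fun i j => (hg.smooth i j).continuousOn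
  have hq : ∀ ξ : Fin n → ℝ, ContinuousOn (fun x => ξ ⬝ᵥ (g x *ᵥ ξ)) (closure Ω) := by
    intro ξ
    simp only [dotProduct, Matrix.mulVec]
    exact continuousOn_finsetSum _ fun i _ => continuousOn_const.mul
      (continuousOn_finsetSum _ fun j _ => (hc i j).mul continuousOn_const)
  refine ⟨l, hl1, hl0, fun x hx => ⟨hl0, ?_, fun ξ => ?_, fun ξ => ?_⟩⟩
  · ext i j
    exact (show EqOn (fun x => g x j i) (fun x => g x i j) (closure Ω) from
      EqOn.of_subset_closure (s := Ω) (fun y hy => (hg.symm y hy).apply i j) (hc j i) (hc i j)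
        subset_closure subset_rfl) hx
  · exact ContinuousWithinAt.closure_le hx continuousWithinAt_const
      ((hq ξ x hx).mono subset_closure) fun y hy => (hl y hy ξ).1
  · exact ContinuousWithinAt.closure_le hx ((hq ξ x hx).mono subset_closure)
      continuousWithinAt_const fun y hy => (hl y hy ξ).2

/-- The integrand of the energy form, as a bilinear form on jets. -/
noncomputable def metricForm {n : ℕ} (g : EuclideanSpace ℝ (Fin n) → Matrix (Fin n) (Fin n) ℝ)
    (V : EuclideanSpace ℝ (Fin n) → ℝ) (z : Space n) : Jet n →ₗ[ℝ] Jet n →ₗ[ℝ] ℝ :=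
  LinearMap.mk₂ ℝ (fun u v => (u.snd.fst.ofLp ⬝ᵥ ((g z.1)⁻¹ *ᵥ v.snd.fst.ofLp)
      + u.snd.snd * v.snd.snd + V z.1 * u.fst * v.fst) * √((g z.1).det))
    (fun u u' v => by simp [add_dotProduct]; ring)
    (fun c u v => by simp [smul_dotProduct]; ring)
    (fun u v v' => by simp [Matrix.mulVec_add, dotProduct_add]; ring)
    (fun c u v => by simp [Matrix.mulVec_smul, dotProduct_smul]; ring)

lemma metricForm_apply {n : ℕ} (g : EuclideanSpace ℝ (Fin n) → Matrix (Fin n) (Fin n) ℝ)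
    (V : EuclideanSpace ℝ (Fin n) → ℝ) (z : Space n) (u v : Jet n) :
    metricForm g V z u v = (u.snd.fst.ofLp ⬝ᵥ ((g z.1)⁻¹ *ᵥ v.snd.fst.ofLp)
      + u.snd.snd * v.snd.snd + V z.1 * u.fst * v.fst) * √((g z.1).det) := rfl

/-- Each term is a coefficient depending on `x` alone times a product of two scalar components, so
that boundedness and measurability can be checked term by term. -/
lemma metricForm_expand {n : ℕ} (g : EuclideanSpace ℝ (Fin n) → Matrix (Fin n) (Fin n) ℝ)
    (V : EuclideanSpace ℝ (Fin n) → ℝ) (z : Space n) (u v : Jet n) :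
    metricForm g V z u v =
      (∑ i, ∑ j, ((g z.1)⁻¹ i j * √((g z.1).det)) * (u.snd.fst i * v.snd.fst j))
      + √((g z.1).det) * (u.snd.snd * v.snd.snd)
      + (V z.1 * √((g z.1).det)) * (u.fst * v.fst) := by
  rw [metricForm_apply]
  simp only [dotProduct, Matrix.mulVec, Finset.mul_sum, add_mul, Finset.sum_mul]
  congr 1
  · congr 1
    · exact Finset.sum_congr rfl fun i _ => Finset.sum_congr rfl fun j _ => by ring
    · ring
  · ring

lemma exists_bound_of_continuousOn_closure {n : ℕ} {Ω : Set (EuclideanSpace ℝ (Fin n))}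
    (hΩ : Bornology.IsBounded Ω) {f : EuclideanSpace ℝ (Fin n) → ℝ}
    (hf : ContinuousOn f (closure Ω)) : ∃ M, 0 ≤ M ∧ ∀ x ∈ closure Ω, |f x| ≤ M := by
  obtain ⟨M, hM⟩ := hΩ.isCompact_closure.exists_bound_of_continuousOn hf
  exact ⟨max M 0, le_max_right _ _, fun x hx => (hM x hx).trans (le_max_left _ _)⟩

lemma aestronglyMeasurable_comp_fst {n : ℕ} {Ω : Set (EuclideanSpace ℝ (Fin n))}
    (hΩ : IsOpen Ω) {f : EuclideanSpace ℝ (Fin n) → ℝ} (hf : ContinuousOn f (closure Ω)) :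
    AEStronglyMeasurable (fun z : Space n => f z.1) (volume.restrict (cyl Ω)) :=
  (hf.comp continuous_fst.continuousOn (fun _ hz => subset_closure hz.1)).aestronglyMeasurable
    (measurableSet_cyl hΩ.measurableSet)

lemma isBddForm_metricForm {n : ℕ} {Ω : Set (EuclideanSpace ℝ (Fin n))} (hΩ : IsOpen Ω)
    (hb : Bornology.IsBounded Ω) {g : EuclideanSpace ℝ (Fin n) → Matrix (Fin n) (Fin n) ℝ}
    {V : EuclideanSpace ℝ (Fin n) → ℝ}
    (ha : ∀ i j, ContinuousOn (fun x => (g x)⁻¹ i j * √((g x).det)) (closure Ω))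
    (hs : ContinuousOn (fun x => √((g x).det)) (closure Ω))
    (hV : ContinuousOn (fun x => V x * √((g x).det)) (closure Ω)) :
    IsBddForm (volume.restrict (cyl Ω)) (metricForm g V) := by
  constructor
  · choose M hM0 hM using fun i j => exists_bound_of_continuousOn_closure hb (ha i j)
    obtain ⟨Ms, hMs0, hMs⟩ := exists_bound_of_continuousOn_closure hb hs
    obtain ⟨Mv, hMv0, hMv⟩ := exists_bound_of_continuousOn_closure hb hV
    refine ⟨(∑ i, ∑ j, M i j) + Ms + Mv, add_nonneg (add_nonneg (Finset.sum_nonneg fun i _ =>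
      Finset.sum_nonneg fun j _ => hM0 i j) hMs0) hMv0, ?_⟩
    refine (ae_restrict_iff' (measurableSet_cyl hΩ.measurableSet)).2 (Eventually.of_forall ?_)
    rintro ⟨x, y⟩ ⟨hx, -⟩ u v
    have hx := subset_closure hx
    rw [metricForm_expand]
    have hp : ∀ a b A B c m : ℝ, |a| ≤ A → |b| ≤ B → |c| ≤ m → |c * (a * b)| ≤ m * (A * B) := by
      intro a b A B c m h1 h2 h3
      rw [abs_mul, abs_mul]
      exact mul_le_mul h3 (mul_le_mul h1 h2 (abs_nonneg _) ((abs_nonneg _).trans h1))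
        (by positivity) ((abs_nonneg _).trans h3)
    have hc : ∀ (w : Jet n) (i : Fin n), |w.snd.fst i| ≤ ‖w‖ := fun w i =>
      (PiLp.norm_apply_le w.snd.fst i).trans (Jet.norm_snd_fst_le w)
    rw [add_mul, add_mul]
    refine (abs_add_le _ _).trans (add_le_add ((abs_add_le _ _).trans (add_le_add ?_ ?_)) ?_)
    · rw [Finset.sum_mul]
      refine (Finset.abs_sum_le_sum_abs _ _).trans (Finset.sum_le_sum fun i _ => ?_)
      rw [Finset.sum_mul]
      exact (Finset.abs_sum_le_sum_abs _ _).trans (Finset.sum_le_sum fun j _ =>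
        hp _ _ _ _ _ _ (hc u i) (hc v j) (hM i j x hx))
    · exact hp _ _ _ _ _ _ (Jet.abs_snd_snd_le u) (Jet.abs_snd_snd_le v) (hMs x hx)
    · exact hp _ _ _ _ _ _ (Jet.abs_fst_le u) (Jet.abs_fst_le v) (hMv x hx)
  · intro u v hu hv
    have h1 : ∀ {w : Space n → Jet n}, AEStronglyMeasurable w (volume.restrict (cyl Ω)) →
        ∀ i, AEStronglyMeasurable (fun z => (w z).snd.fst i) (volume.restrict (cyl Ω)) := by
      intro w hw i
      have : Continuous (fun j : Jet n => j.snd.fst i) :=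
        (EuclideanSpace.proj i : EuclideanSpace ℝ (Fin n) →L[ℝ] ℝ).continuous.comp
          Jet.continuous_snd_fst
      exact this.comp_aestronglyMeasurable hw
    have h2 : ∀ {w : Space n → Jet n}, AEStronglyMeasurable w (volume.restrict (cyl Ω)) →
        AEStronglyMeasurable (fun z => (w z).snd.snd) (volume.restrict (cyl Ω)) :=
      fun hw => Jet.continuous_snd_snd.comp_aestronglyMeasurable hw
    have h3 : ∀ {w : Space n → Jet n}, AEStronglyMeasurable w (volume.restrict (cyl Ω)) →
        AEStronglyMeasurable (fun z => (w z).fst) (volume.restrict (cyl Ω)) :=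
      fun hw => Jet.continuous_fst.comp_aestronglyMeasurable hw
    simp only [metricForm_expand]
    refine AEStronglyMeasurable.add (AEStronglyMeasurable.add ?_ ?_) ?_
    · refine Finset.aestronglyMeasurable_fun_sum _ fun i _ =>
        Finset.aestronglyMeasurable_fun_sum _ fun j _ => ?_
      exact (aestronglyMeasurable_comp_fst hΩ (ha i j)).mul ((h1 hu i).mul (h1 hv j))
    · exact (aestronglyMeasurable_comp_fst hΩ hs).mul ((h2 hu).mul (h2 hv))
    · exact (aestronglyMeasurable_comp_fst hΩ hV).mul ((h3 hu).mul (h3 hv))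

lemma IsEllipticMetric.isBddForm {n : ℕ} {Ω : Set (EuclideanSpace ℝ (Fin n))} (hΩ : IsOpen Ω)
    (hb : Bornology.IsBounded Ω) {g : EuclideanSpace ℝ (Fin n) → Matrix (Fin n) (Fin n) ℝ}
    {V : EuclideanSpace ℝ (Fin n) → ℝ} (hg : IsEllipticMetric Ω g) (hV : IsPotential Ω V) :
    IsBddForm (volume.restrict (cyl Ω)) (metricForm g V) := by
  obtain ⟨l, -, -, hl⟩ := hg.exists_closure
  have hs : ContinuousOn (fun x => √((g x).det)) (closure Ω) :=
    (contDiffOn_det hg.smooth).continuousOn.sqrt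
  exact isBddForm_metricForm hΩ hb (fun i j => ((contDiffOn_inv_apply hg.smooth
    (fun x hx => (hl x hx).det_pos.ne') i j).continuousOn).mul hs) hs (hV.smooth.continuousOn.mul hs)

lemma IsEllipticMetric.metricForm_symm {n : ℕ} {Ω : Set (EuclideanSpace ℝ (Fin n))}
    {g : EuclideanSpace ℝ (Fin n) → Matrix (Fin n) (Fin n) ℝ}
    {V : EuclideanSpace ℝ (Fin n) → ℝ} (hg : IsEllipticMetric Ω g) {z : Space n} (hz : z.1 ∈ Ω)
    (u v : Jet n) : metricForm g V z u v = metricForm g V z v u := by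
  have h : ((g z.1)⁻¹).IsSymm := by
    rw [Matrix.IsSymm, Matrix.transpose_nonsing_inv, hg.symm _ hz]
  rw [metricForm_apply, metricForm_apply, dotProduct_mulVec_comm_of_isSymm h]; ring

lemma lpForm_metricForm_symm {n : ℕ} {Ω : Set (EuclideanSpace ℝ (Fin n))} (hΩ : IsOpen Ω)
    {g : EuclideanSpace ℝ (Fin n) → Matrix (Fin n) (Fin n) ℝ}
    {V : EuclideanSpace ℝ (Fin n) → ℝ} (hg : IsEllipticMetric Ω g)
    (h : IsBddForm (volume.restrict (cyl Ω)) (metricForm g V))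
    (u v : Lp (Jet n) 2 (volume.restrict (cyl Ω))) : lpForm h u v = lpForm h v u := by
  rw [lpForm_apply, lpForm_apply]
  exact setIntegral_congr_fun (measurableSet_cyl hΩ.measurableSet) fun z hz =>
    hg.metricForm_symm hz.1 _ _

/-- Only derivatives are controlled here, since `V` is merely nonnegative and may vanish. The value
and the trace are recovered afterwards from the Poincaré and trace inequalities. -/
lemma IsEllipticMetric.exists_metricForm_lower {n : ℕ} {Ω : Set (EuclideanSpace ℝ (Fin n))}
    (hb : Bornology.IsBounded Ω) {g : EuclideanSpace ℝ (Fin n) → Matrix (Fin n) (Fin n) ℝ}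
    {V : EuclideanSpace ℝ (Fin n) → ℝ} (hg : IsEllipticMetric Ω g) (hV : IsPotential Ω V) :
    ∃ c, 0 < c ∧ ∀ z : Space n, z.1 ∈ Ω → ∀ u : Jet n,
      c * (‖u.snd.fst‖ ^ 2 + u.snd.snd ^ 2) ≤ metricForm g V z u u := by
  obtain ⟨l, hl1, hl0, hl⟩ := hg.exists_closure
  have hs : ContinuousOn (fun x => √((g x).det)) (closure Ω) :=
    (contDiffOn_det hg.smooth).continuousOn.sqrt
  obtain ⟨s, hs0, hsl⟩ : ∃ s, 0 < s ∧ ∀ x ∈ closure Ω, s ≤ √((g x).det) :=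
    hb.isCompact_closure.exists_forall_le' hs fun x hx => Real.sqrt_pos.2 (hl x hx).det_pos
  refine ⟨l * s, mul_pos hl0 hs0, fun z hz u => ?_⟩
  rw [metricForm_apply]
  have h1 := (hl _ (subset_closure hz)).inv_lower u.snd.fst.ofLp
  have h2 : u.snd.fst.ofLp ⬝ᵥ u.snd.fst.ofLp = ‖u.snd.fst‖ ^ 2 := by
    rw [EuclideanSpace.norm_sq_eq]; simp [dotProduct, pow_two]
  rw [h2] at h1
  have h3 : 0 ≤ V z.1 * u.fst * u.fst := by
    rw [mul_assoc]; exact mul_nonneg (hV.nonneg _ hz) (mul_self_nonneg _)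
  have h4 : l * (‖u.snd.fst‖ ^ 2 + u.snd.snd ^ 2) ≤ u.snd.fst.ofLp ⬝ᵥ ((g z.1)⁻¹ *ᵥ u.snd.fst.ofLp)
      + u.snd.snd * u.snd.snd + V z.1 * u.fst * u.fst := by
    nlinarith [sq_nonneg u.snd.snd]
  calc l * s * (‖u.snd.fst‖ ^ 2 + u.snd.snd ^ 2)
      = (l * (‖u.snd.fst‖ ^ 2 + u.snd.snd ^ 2)) * s := by ring
    _ ≤ _ := mul_le_mul h4 (hsl _ (subset_closure hz)) hs0.le (le_trans (by positivity) h4)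

/-! ### Coercivity and solvability of the Neumann problem -/

lemma norm_sq_energySpace {n : ℕ} {Ω : Set (EuclideanSpace ℝ (Fin n))} (x : EnergySpace Ω) :
    ‖x‖ ^ 2 = (∫ z in cyl Ω, ‖x.fst z‖ ^ 2) + ∫ y in Ω, x.snd y ^ 2 := by
  rw [WithLp.prod_norm_sq_eq_of_L2, ← integral_norm_sq_eq, ← integral_norm_sq_eq]
  simp

/-- The form controls the gradient, Poincaré bounds the value by the horizontal gradient, and the
trace is bounded by the value and the vertical derivative. The index `i` is the direction used in
Poincaré's inequality. -/
lemma IsEllipticMetric.coercive {n : ℕ} (i : Fin n) {Ω : Set (EuclideanSpace ℝ (Fin n))}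
    (hΩ : IsOpen Ω) (hb : Bornology.IsBounded Ω)
    {g : EuclideanSpace ℝ (Fin n) → Matrix (Fin n) (Fin n) ℝ}
    {V : EuclideanSpace ℝ (Fin n) → ℝ} (hg : IsEllipticMetric Ω g) (hV : IsPotential Ω V) :
    ∃ c, 0 < c ∧ ∀ x ∈ energyDomain Ω,
      c * ‖x‖ ^ 2 ≤ lpForm (hg.isBddForm hΩ hb hV) x.fst x.fst := by
  obtain ⟨c, hc0, hc⟩ := hg.exists_metricForm_lower hb hV
  obtain ⟨R, hR⟩ := hb.exists_norm_le
  -- The value enters twice, once by itself and once through the trace, each time at a cost of `4R²`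
  -- times the horizontal energy. The vertical energy also enters twice, which gives the `2`.
  refine ⟨c / (8 * R ^ 2 + 2), by positivity, energyDomain_induction ?_ ?_⟩
  · have h1 : Continuous (fun x : EnergySpace Ω => x.fst) := WithLp.continuous_fst 2 _ _
    refine isClosed_le (by fun_prop) ?_
    exact ((lpForm (hg.isBddForm hΩ hb hV)).continuous.comp h1).clm_apply h1
  · intro φ hφ
    have hm := hφ.memLp_jet
    have i0 : Integrable (fun z => φ z ^ 2) (volume.restrict (cyl Ω)) := (memLp_fst hm).integrable_sq
    have i1 : Integrable (fun z => ‖gradX φ z‖ ^ 2) (volume.restrict (cyl Ω)) :=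
      (memLp_snd_fst hm).integrable_norm_pow (by norm_num)
    have i2 : Integrable (fun z => derivY φ z ^ 2) (volume.restrict (cyl Ω)) :=
      (memLp_snd_snd hm).integrable_sq
    have h1 := hφ.poincare i hΩ.measurableSet hR
    have h2 := hφ.trace_le
    rw [integral_add i0 i2] at h2
    have e1 : ∫ z in cyl Ω, ‖hφ.toEnergy.fst z‖ ^ 2 = (∫ z in cyl Ω, φ z ^ 2)
        + (∫ z in cyl Ω, ‖gradX φ z‖ ^ 2) + ∫ z in cyl Ω, derivY φ z ^ 2 := by
      have : ∫ z in cyl Ω, ‖hφ.toEnergy.fst z‖ ^ 2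
          = ∫ z in cyl Ω, (φ z ^ 2 + ‖gradX φ z‖ ^ 2 + derivY φ z ^ 2) := by
        refine integral_congr_ae ?_
        filter_upwards [hφ.toEnergy_fst] with z hz
        rw [hz, Jet.norm_sq]; rfl
      have i01 : Integrable (fun z => φ z ^ 2 + ‖gradX φ z‖ ^ 2) (volume.restrict (cyl Ω)) :=
        i0.add i1
      rw [this, integral_add i01 i2, integral_add i0 i1]
    have e2 : ∫ y in Ω, hφ.toEnergy.snd y ^ 2 = ∫ x in Ω, φ (x, 0) ^ 2 := by
      refine integral_congr_ae ?_
      filter_upwards [hφ.toEnergy_snd] with z hz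
      rw [hz]
    have e3 : c * ((∫ z in cyl Ω, ‖gradX φ z‖ ^ 2) + ∫ z in cyl Ω, derivY φ z ^ 2)
        ≤ lpForm (hg.isBddForm hΩ hb hV) hφ.toEnergy.fst hφ.toEnergy.fst := by
      rw [lpForm_apply, ← integral_add i1 i2, ← integral_const_mul]
      refine integral_mono_ae ((i1.add i2).const_mul c) ((hg.isBddForm hΩ hb hV).integrable _ _) ?_
      filter_upwards [hφ.toEnergy_fst, ae_restrict_mem (measurableSet_cyl hΩ.measurableSet)]
        with z hz hz'
      rw [hz]
      exact hc z hz'.1 (jet φ z)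
    rw [norm_sq_energySpace, e1, e2, div_mul_eq_mul_div, div_le_iff₀ (by positivity)]
    have p2 : 0 ≤ ∫ z in cyl Ω, derivY φ z ^ 2 := integral_nonneg fun z => sq_nonneg _
    have p1 : 0 ≤ ∫ z in cyl Ω, ‖gradX φ z‖ ^ 2 := integral_nonneg fun z => sq_nonneg _
    set I0 := ∫ z in cyl Ω, φ z ^ 2
    set I1 := ∫ z in cyl Ω, ‖gradX φ z‖ ^ 2
    set I2 := ∫ z in cyl Ω, derivY φ z ^ 2
    set J := ∫ x in Ω, φ (x, 0) ^ 2
    have h5 : I0 + I1 + I2 + J ≤ (I1 + I2) * (8 * R ^ 2 + 2) := by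
      nlinarith [mul_nonneg p2 (sq_nonneg R)]
    calc c * (I0 + I1 + I2 + J) ≤ c * ((I1 + I2) * (8 * R ^ 2 + 2)) :=
          mul_le_mul_of_nonneg_left h5 hc0.le
      _ = c * (I1 + I2) * (8 * R ^ 2 + 2) := by ring
      _ ≤ _ := mul_le_mul_of_nonneg_right e3 (by positivity)

/-- The Lax–Milgram theorem on a closed subspace. -/
lemma exists_solution_of_coercive {X : Type*} [NormedAddCommGroup X] [InnerProductSpace ℝ X]
    [CompleteSpace X] (K : Submodule ℝ X) (hK : IsClosed (K : Set X)) (b : X →L[ℝ] X →L[ℝ] ℝ)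
    (ℓ : X →L[ℝ] ℝ) {c : ℝ} (hc0 : 0 < c) (hc : ∀ x ∈ K, c * ‖x‖ ^ 2 ≤ b x x) :
    ∃ x ∈ K, ∀ v ∈ K, b x v = ℓ v := by
  have : CompleteSpace K := hK.completeSpace_coe
  let B : K →L[ℝ] K →L[ℝ] ℝ := b.bilinearComp K.subtypeL K.subtypeL
  have hBc : IsCoercive B := ⟨c, hc0, fun x => by
    rw [mul_assoc, ← pow_two]; exact hc x x.2⟩
  let u := hBc.continuousLinearEquivOfBilin.symm
    ((InnerProductSpace.toDual ℝ K).symm (ℓ.comp K.subtypeL))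
  refine ⟨u, u.2, fun v hv => ?_⟩
  have h1 := hBc.continuousLinearEquivOfBilin_apply u ⟨v, hv⟩
  rw [ContinuousLinearEquiv.apply_symm_apply, InnerProductSpace.toDual_symm_apply] at h1
  exact h1.symm

/-- Solvability of the Neumann problem in the energy domain. -/
lemma IsEllipticMetric.exists_solution {n : ℕ} (i : Fin n) {Ω : Set (EuclideanSpace ℝ (Fin n))}
    (hΩ : IsOpen Ω) (hb : Bornology.IsBounded Ω)
    {g : EuclideanSpace ℝ (Fin n) → Matrix (Fin n) (Fin n) ℝ}
    {V : EuclideanSpace ℝ (Fin n) → ℝ} (hg : IsEllipticMetric Ω g) (hV : IsPotential Ω V)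
    {F : EuclideanSpace ℝ (Fin n) → ℝ} (hF : MemLp F 2 (volume.restrict Ω)) :
    ∃ x ∈ energyDomain Ω, ∀ v ∈ energyDomain Ω,
      lpForm (hg.isBddForm hΩ hb hV) x.fst v.fst = ∫ y in Ω, F y * v.snd y := by
  obtain ⟨c, hc0, hc⟩ := hg.coercive i hΩ hb hV
  let L : EnergySpace Ω →L[ℝ] Lp (Jet n) 2 (volume.restrict (cyl Ω)) := WithLp.fstL 2 ℝ _ _
  let ℓ : EnergySpace Ω →L[ℝ] ℝ := (innerSL ℝ (hF.toLp F)).comp (WithLp.sndL 2 ℝ _ _)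
  have hℓ : ∀ v : EnergySpace Ω, ℓ v = ∫ y in Ω, F y * v.snd y := by
    intro v
    refine (inner_toLp_eq_integral hF v.snd).trans ?_
    simp [mul_comm]
  obtain ⟨x, hx, h⟩ := exists_solution_of_coercive (energyDomain Ω)
    (Submodule.isClosed_topologicalClosure _)
    ((lpForm (hg.isBddForm hΩ hb hV)).bilinearComp L L) ℓ hc0 hc
  exact ⟨x, hx, fun v hv => (h v hv).trans (hℓ v)⟩

lemma IsEllipticMetric.memLp_mul_sqrt_det {n : ℕ} {Ω : Set (EuclideanSpace ℝ (Fin n))}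
    (hΩ : IsOpen Ω) (hb : Bornology.IsBounded Ω)
    {g : EuclideanSpace ℝ (Fin n) → Matrix (Fin n) (Fin n) ℝ} (hg : IsEllipticMetric Ω g)
    {f : EuclideanSpace ℝ (Fin n) → ℝ} (hf : Continuous f) (hfs : HasCompactSupport f) :
    MemLp (fun x => f x * √((g x).det)) 2 (volume.restrict Ω) := by
  have hs : ContinuousOn (fun x => √((g x).det)) (closure Ω) :=
    (contDiffOn_det hg.smooth).continuousOn.sqrt
  obtain ⟨M, hM0, hM⟩ := exists_bound_of_continuousOn_closure hb hs
  have h1 : MemLp (fun x => M * f x) 2 (volume.restrict Ω) :=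
    ((hf.memLp_of_hasCompactSupport hfs).const_mul M).restrict Ω
  refine h1.mono (hf.aestronglyMeasurable.mul
    ((hs.mono subset_closure).aestronglyMeasurable hΩ.measurableSet)) ?_
  filter_upwards [ae_restrict_mem hΩ.measurableSet] with x hx
  rw [norm_mul, norm_mul, mul_comm]
  have := hM x (subset_closure hx)
  rw [Real.norm_eq_abs M, abs_of_nonneg hM0]
  exact mul_le_mul_of_nonneg_right this (norm_nonneg _)

/-- The solution operator: existence in the energy domain, and the Neumann-to-Dirichlet image. -/
lemma IsEllipticMetric.exists_isNDImage {n : ℕ} (i : Fin n) {Ω Γ : Set (EuclideanSpace ℝ (Fin n))}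
    (hΩ : IsOpen Ω) (hb : Bornology.IsBounded Ω)
    {g : EuclideanSpace ℝ (Fin n) → Matrix (Fin n) (Fin n) ℝ}
    {V : EuclideanSpace ℝ (Fin n) → ℝ} (hg : IsEllipticMetric Ω g) (hV : IsPotential Ω V)
    {f : EuclideanSpace ℝ (Fin n) → ℝ} (hf : IsTestFunction Γ f) :
    ∃ x ∈ energyDomain Ω, (∀ v ∈ energyDomain Ω,
      lpForm (hg.isBddForm hΩ hb hV) x.fst v.fst = ∫ y in Ω, f y * √((g y).det) * v.snd y) ∧
      IsNDImage Ω g V f x.snd := by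
  obtain ⟨x, hx, h⟩ := hg.exists_solution i hΩ hb hV
    (hg.memLp_mul_sqrt_det hΩ hb hf.smooth.continuous hf.compactSupport)
  refine ⟨x, hx, h, toH1 hx, ⟨memH10_toH1 hx, fun v w _ hw => ?_⟩,
    isTrace_toH1 hx⟩
  obtain ⟨y, hy, hy1, hy2⟩ := hw.exists_mem_energyDomain
  refine Eq.trans ?_ ((h y hy).trans ?_)
  · rw [lpForm_apply]
    refine integral_congr_ae ?_
    filter_upwards [hy1] with z hz
    rw [hz]; rfl
  · refine integral_congr_ae ?_
    filter_upwards [hy2] with z hz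
    rw [hz, mul_assoc]


/-! ### Exponentially weighted estimates on the energy domain -/

section ScalarForm

variable {α F : Type*} [NormedAddCommGroup F]
  [InnerProductSpace ℝ F]

/-- The form `k(z) p(u) p(v)` for a linear functional `p` and a weight `k`. -/
noncomputable def scalarForm (k : α → ℝ) (p : F →L[ℝ] ℝ) (z : α) : F →ₗ[ℝ] F →ₗ[ℝ] ℝ :=
  LinearMap.mk₂ ℝ (fun u v => k z * (p u * p v))
    (fun u u' v => by simp only [map_add]; ring)
    (fun c u v => by simp only [map_smul, smul_eq_mul]; ring)
    (fun u v v' => by simp only [map_add]; ring)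
    (fun c u v => by simp only [map_smul, smul_eq_mul]; ring)

lemma scalarForm_apply (k : α → ℝ) (p : F →L[ℝ] ℝ) (z : α) (u v : F) :
    scalarForm k p z u v = k z * (p u * p v) := rfl

lemma isBddForm_scalarForm [MeasurableSpace α] {μ : Measure α} {k : α → ℝ} {C : ℝ} (hk : AEStronglyMeasurable k μ)
    (hC0 : 0 ≤ C) (hC : ∀ᵐ z ∂μ, |k z| ≤ C) (p : F →L[ℝ] ℝ) : IsBddForm μ (scalarForm k p) := by
  refine ⟨⟨C * (‖p‖ * ‖p‖), by positivity, ?_⟩, fun u v hu hv => ?_⟩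
  · filter_upwards [hC] with z hz u v
    rw [scalarForm_apply, abs_mul, abs_mul]
    have h1 : |p u| ≤ ‖p‖ * ‖u‖ := p.le_opNorm u
    have h2 : |p v| ≤ ‖p‖ * ‖v‖ := p.le_opNorm v
    calc |k z| * (|p u| * |p v|) ≤ C * ((‖p‖ * ‖u‖) * (‖p‖ * ‖v‖)) := by gcongr
      _ = _ := by ring
  · exact hk.mul ((p.continuous.comp_aestronglyMeasurable hu).mul
      (p.continuous.comp_aestronglyMeasurable hv))

end ScalarForm

lemma aestronglyMeasurable_exp_weight {n : ℕ} (m : ℝ) (μ : Measure (Space n)) :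
    AEStronglyMeasurable (fun z : Space n => Real.exp (-(m * z.2))) μ :=
  Continuous.aestronglyMeasurable (by fun_prop)

/-- The weighted Hardy type inequality on the energy domain. -/
lemma energyDomain_weighted_le {n : ℕ} {Ω S : Set (EuclideanSpace ℝ (Fin n))}
    (hS : MeasurableSet S) (hSΩ : S ⊆ Ω) {m : ℝ} (hm : 0 < m) :
    ∀ x ∈ energyDomain Ω, ∫ z in cyl S, Real.exp (-(m * z.2)) * (x.fst z).fst ^ 2
      ≤ 2 / m * (∫ y in S, x.snd y ^ 2) + 4 / m ^ 2 * ‖x‖ ^ 2 := by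
  have hcS : cyl S ⊆ cyl Ω := Set.prod_mono_left hSΩ
  -- Both weighted integrals are written as bounded quadratic forms, with indicator functions in the
  -- weights, so that they depend continuously on the element and the density principle applies.
  have hB1 : IsBddForm (volume.restrict (cyl Ω)) (scalarForm
      ((cyl S).indicator fun z : Space n => Real.exp (-(m * z.2)))
      (WithLp.fstL 2 ℝ ℝ (WithLp 2 (EuclideanSpace ℝ (Fin n) × ℝ)))) := by
    refine isBddForm_scalarForm (C := 1)
      ((aestronglyMeasurable_exp_weight m _).indicator (measurableSet_cyl hS)) zero_le_one ?_ _
    refine Eventually.of_forall fun z => ?_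
    by_cases hz : z ∈ cyl S
    · rw [indicator_of_mem hz, abs_of_pos (Real.exp_pos _)]
      have : 0 < z.2 := hz.2
      exact Real.exp_le_one_iff.2 (by nlinarith)
    · simp [indicator_of_notMem hz]
  have hB2 : IsBddForm (volume.restrict Ω) (scalarForm
      (S.indicator fun _ : EuclideanSpace ℝ (Fin n) => (1 : ℝ)) (ContinuousLinearMap.id ℝ ℝ)) := by
    refine isBddForm_scalarForm (C := 1) ((aestronglyMeasurable_const).indicator hS) zero_le_one ?_ _
    refine Eventually.of_forall fun z => ?_
    by_cases hz : z ∈ S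
    · simp [indicator_of_mem hz]
    · simp [indicator_of_notMem hz]
  have e1 : ∀ x : EnergySpace Ω, ∫ z in cyl S, Real.exp (-(m * z.2)) * (x.fst z).fst ^ 2
      = lpForm hB1 x.fst x.fst := by
    intro x
    rw [lpForm_apply, ← inter_eq_self_of_subset_right hcS, ← setIntegral_indicator
      (measurableSet_cyl hS)]
    refine integral_congr_ae (Eventually.of_forall fun z => ?_)
    simp only [scalarForm_apply, WithLp.fstL_apply]
    rw [inter_eq_self_of_subset_right hcS]
    by_cases hz : z ∈ cyl S
    · simp only [indicator_of_mem hz]; ring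
    · simp [indicator_of_notMem hz]
  have e2 : ∀ x : EnergySpace Ω, ∫ y in S, x.snd y ^ 2 = lpForm hB2 x.snd x.snd := by
    intro x
    rw [lpForm_apply, ← inter_eq_self_of_subset_right hSΩ, ← setIntegral_indicator hS]
    refine integral_congr_ae (Eventually.of_forall fun z => ?_)
    simp only [scalarForm_apply]
    rw [inter_eq_self_of_subset_right hSΩ]
    by_cases hz : z ∈ S
    · simp [indicator_of_mem hz, pow_two]
    · simp [indicator_of_notMem hz]
  simp only [e1, e2]
  refine energyDomain_induction ?_ ?_
  · have h1 : Continuous (fun x : EnergySpace Ω => x.fst) := WithLp.continuous_fst 2 _ _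
    have h2 : Continuous (fun x : EnergySpace Ω => x.snd) := WithLp.continuous_snd 2 _ _
    refine isClosed_le (((lpForm hB1).continuous.comp h1).clm_apply h1) ?_
    exact (continuous_const.mul (((lpForm hB2).continuous.comp h2).clm_apply h2)).add (by fun_prop)
  · intro φ hφ
    rw [← e1, ← e2]
    have h := hφ.weighted_le hS hm
    have f1 : ∫ z in cyl S, Real.exp (-(m * z.2)) * (hφ.toEnergy.fst z).fst ^ 2
        = ∫ z in cyl S, Real.exp (-(m * z.2)) * φ z ^ 2 := by
      refine integral_congr_ae ?_
      filter_upwards [ae_restrict_of_ae_restrict_of_subset hcS hφ.toEnergy_fst] with z hz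
      rw [hz]; rfl
    have f2 : ∫ y in S, hφ.toEnergy.snd y ^ 2 = ∫ y in S, φ (y, 0) ^ 2 := by
      refine integral_congr_ae ?_
      filter_upwards [ae_restrict_of_ae_restrict_of_subset hSΩ hφ.toEnergy_snd] with z hz
      rw [hz]
    have f3 : ∫ z in cyl S, derivY φ z ^ 2 ≤ ‖hφ.toEnergy‖ ^ 2 := by
      have i2 : Integrable (fun z => derivY φ z ^ 2) (volume.restrict (cyl Ω)) :=
        (memLp_snd_snd hφ.memLp_jet).integrable_sq
      have i3 : Integrable (fun z => ‖jet φ z‖ ^ 2) (volume.restrict (cyl Ω)) :=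
        hφ.memLp_jet.integrable_norm_pow (by norm_num)
      have h3 : ∫ z in cyl Ω, derivY φ z ^ 2 ≤ ∫ z in cyl Ω, ‖jet φ z‖ ^ 2 := by
        refine integral_mono i2 i3 fun z => ?_
        rw [← sq_abs]
        exact pow_le_pow_left₀ (abs_nonneg _) (Jet.abs_snd_snd_le (jet φ z)) 2
      have h4 : ∫ z in cyl Ω, ‖jet φ z‖ ^ 2 = ∫ z in cyl Ω, ‖hφ.toEnergy.fst z‖ ^ 2 := by
        refine integral_congr_ae ?_
        filter_upwards [hφ.toEnergy_fst] with z hz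
        rw [hz]
      have h5 : 0 ≤ ∫ y in Ω, hφ.toEnergy.snd y ^ 2 := integral_nonneg fun y => sq_nonneg _
      rw [norm_sq_energySpace, ← h4]
      have h6 := setIntegral_mono_set i2 (Eventually.of_forall fun z => sq_nonneg (derivY φ z))
        hcS.eventuallyLE
      linarith
    rw [f1, f2]
    refine h.trans (add_le_add le_rfl (mul_le_mul_of_nonneg_left f3 (by positivity)))

lemma integrable_exp_weight {n : ℕ} {S : Set (EuclideanSpace ℝ (Fin n))}
    (hS : volume S ≠ ⊤) {m : ℝ} (hm : 0 < m) :
    Integrable (fun z : Space n => Real.exp (-(m * z.2))) (volume.restrict (cyl S)) := by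
  rw [volume_restrict_prod_Ioi]
  have : IsFiniteMeasure (volume.restrict S) := ⟨by simpa using lt_top_iff_ne_top.2 hS⟩
  have h := (integrable_const (μ := volume.restrict S) (1 : ℝ)).mul_prod
    (integrableOn_exp_mul_Ioi (neg_lt_zero.2 hm) 0)
  refine h.congr (Eventually.of_forall fun z => ?_)
  simp

lemma integral_exp_weight {n : ℕ} {S : Set (EuclideanSpace ℝ (Fin n))}
    {m : ℝ} (hm : 0 < m) :
    ∫ z in cyl S, Real.exp (-(m * z.2)) = volume.real S / m := by
  rw [volume_restrict_prod_Ioi]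
  have h := integral_prod_mul (L := ℝ) (μ := volume.restrict S) (ν := volume.restrict (Ioi (0 : ℝ)))
    (fun _ : EuclideanSpace ℝ (Fin n) => (1 : ℝ)) (fun y : ℝ => Real.exp (-m * y))
  rw [integral_exp_mul_Ioi (neg_lt_zero.2 hm)] at h
  simp only [one_mul, neg_mul] at h
  rw [h]; simp; ring

/-- Pairing of an exponentially decaying function with the value part of a jet. -/
lemma abs_integral_mul_fst_le {n : ℕ} {Ω S : Set (EuclideanSpace ℝ (Fin n))}
    (hΩ : MeasurableSet Ω) (hS : MeasurableSet S) (hSΩ : S ⊆ Ω) (hSv : volume S ≠ ⊤)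
    {m C r : ℝ} (hm : 0 < m) (hC : 0 ≤ C) (hr : 0 < r) {R : Space n → ℝ}
    (hR : ∀ z, 0 ≤ z.2 → |R z| ≤ C * Real.exp (-(m * z.2))) (hR0 : ∀ z, z.1 ∉ S → R z = 0)
    (v : Lp (Jet n) 2 (volume.restrict (cyl Ω))) :
    |∫ z in cyl Ω, R z * (v z).fst| ≤
      C * (r * (∫ z in cyl S, Real.exp (-(m * z.2)) * (v z).fst ^ 2) + volume.real S / (r * m)) := by
  have hcS : cyl S ⊆ cyl Ω := Set.prod_mono_left hSΩ
  rw [setIntegral_cyl_eq hΩ hSΩ (fun z hz => by rw [hR0 z hz, zero_mul])]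
  have i1 : Integrable (fun z : Space n => Real.exp (-(m * z.2)) * (v z).fst ^ 2)
      (volume.restrict (cyl S)) := by
    have h := ((memLp_fst (Lp.memLp v)).integrable_sq).mono_measure (Measure.restrict_mono_set _ hcS)
    refine h.mono' ((aestronglyMeasurable_exp_weight m _).mul h.1) ?_
    refine (ae_restrict_iff' (measurableSet_cyl hS)).2 (Eventually.of_forall fun z hz => ?_)
    have hz2 : 0 < z.2 := hz.2
    rw [norm_mul, Real.norm_eq_abs, Real.norm_eq_abs, abs_of_pos (Real.exp_pos _),
      abs_of_nonneg (sq_nonneg _)]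
    exact mul_le_of_le_one_left (sq_nonneg _) (Real.exp_le_one_iff.2 (by nlinarith))
  have i2 := integrable_exp_weight hSv hm
  have h1 : |∫ z in cyl S, R z * (v z).fst| ≤ ∫ z in cyl S,
      C * (r * (Real.exp (-(m * z.2)) * (v z).fst ^ 2) + r⁻¹ * Real.exp (-(m * z.2))) := by
    refine norm_integral_le_of_norm_le (f := fun z : Space n => R z * (v z).fst) (((i1.const_mul r).add (i2.const_mul r⁻¹)).const_mul C) ?_
    refine (ae_restrict_iff' (measurableSet_cyl hS)).2 (Eventually.of_forall fun z hz => ?_)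
    have hz2 : (0 : ℝ) < z.2 := hz.2
    rw [norm_mul, Real.norm_eq_abs, Real.norm_eq_abs]
    -- Young's inequality with a free parameter `r`. It is chosen later according to how much is
    -- known about the weighted norm of `v`.
    have h2 : |(v z).fst| ≤ r * (v z).fst ^ 2 + r⁻¹ := by
      rw [← sq_abs]
      set q := |(v z).fst|
      have h3 : 0 ≤ r⁻¹ * ((r * q - 1) ^ 2 + r * q) := by positivity
      have h4 : r⁻¹ * ((r * q - 1) ^ 2 + r * q) = r * q ^ 2 + r⁻¹ - q := by field_simp; ring
      linarith
    calc |R z| * |(v z).fst| ≤ (C * Real.exp (-(m * z.2))) * (r * (v z).fst ^ 2 + r⁻¹) :=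
          mul_le_mul (hR z hz2.le) h2 (abs_nonneg _) (by positivity)
      _ = _ := by ring
  refine h1.trans (le_of_eq ?_)
  rw [integral_const_mul, integral_add (i1.const_mul r) (i2.const_mul r⁻¹), integral_const_mul r,
    integral_const_mul r⁻¹, integral_exp_weight hm]
  congr 2
  field_simp


/-! ### Oscillating exponentials and the action of the elliptic operator -/

/-- The `k`-th partial derivative. -/
noncomputable def pd {n : ℕ} (k : Fin n) (α : EuclideanSpace ℝ (Fin n) → ℝ)
    (x : EuclideanSpace ℝ (Fin n)) : ℝ :=
  fderiv ℝ α x (EuclideanSpace.single k 1)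

/-- The oscillating and exponentially decaying function
`c ρ(y) α(x) e^{-t p(x) y} cos(t θ(x) + τ)`. -/
noncomputable def osc {n : ℕ} (t : ℝ) (p θ : EuclideanSpace ℝ (Fin n) → ℝ) (τ c : ℝ) (ρ : ℝ → ℝ)
    (α : EuclideanSpace ℝ (Fin n) → ℝ) (z : Space n) : ℝ :=
  c * ρ z.2 * α z.1 * Real.exp (-(t * p z.1 * z.2)) * Real.cos (t * θ z.1 + τ)

lemma contDiff_pd {n : ℕ} {α : EuclideanSpace ℝ (Fin n) → ℝ} (hα : ContDiff ℝ ∞ α) (k : Fin n) :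
    ContDiff ℝ ∞ (pd k α) := by
  unfold pd
  exact (hα.fderiv_right (m := ∞) (by norm_cast)).clm_apply contDiff_const

lemma contDiff_osc {n : ℕ} {t : ℝ} {p θ : EuclideanSpace ℝ (Fin n) → ℝ} {τ c : ℝ} {ρ : ℝ → ℝ}
    {α : EuclideanSpace ℝ (Fin n) → ℝ} (hp : ContDiff ℝ ∞ p) (hθ : ContDiff ℝ ∞ θ)
    (hρ : ContDiff ℝ ∞ ρ) (hα : ContDiff ℝ ∞ α) : ContDiff ℝ ∞ (osc t p θ τ c ρ α) := by
  have h1 : ContDiff ℝ ∞ (fun z : Space n => ρ z.2) := hρ.comp contDiff_snd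
  have h2 : ContDiff ℝ ∞ (fun z : Space n => α z.1) := hα.comp contDiff_fst
  have h3 : ContDiff ℝ ∞ (fun z : Space n => p z.1) := hp.comp contDiff_fst
  have h4 : ContDiff ℝ ∞ (fun z : Space n => θ z.1) := hθ.comp contDiff_fst
  unfold osc
  exact (((contDiff_const.mul h1).mul h2).mul
    ((contDiff_const.mul h3).mul contDiff_snd).neg.exp).mul
    ((contDiff_const.mul h4).add contDiff_const).cos

lemma hasDerivAt_line {n : ℕ} {α : EuclideanSpace ℝ (Fin n) → ℝ} {x : EuclideanSpace ℝ (Fin n)}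
    (hα : DifferentiableAt ℝ α x) (k : Fin n) :
    HasDerivAt (fun r : ℝ => α (x + r • EuclideanSpace.single k (1 : ℝ))) (pd k α x) 0 :=
  hα.hasFDerivAt.hasLineDerivAt (EuclideanSpace.single k (1 : ℝ))

lemma gradX_eq_of_hasDerivAt {n : ℕ} {h : Space n → ℝ} {z : Space n} {d : ℝ} {k : Fin n}
    (hd : DifferentiableAt ℝ h z)
    (h' : HasDerivAt (fun r : ℝ => h (z.1 + r • EuclideanSpace.single k (1 : ℝ), z.2)) d 0) :
    gradX h z k = d := by
  have h1 : HasDerivAt (fun r : ℝ => h (z + r • ((EuclideanSpace.single k (1 : ℝ), (0 : ℝ)) : Space n)))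
      (gradX h z k) 0 := hd.hasFDerivAt.hasLineDerivAt _
  have e : ∀ r : ℝ, z + r • ((EuclideanSpace.single k (1 : ℝ), (0 : ℝ)) : Space n)
      = (z.1 + r • EuclideanSpace.single k (1 : ℝ), z.2) := fun r => by
    simp [Prod.ext_iff]
  simp only [e] at h1
  exact h1.unique h'

/-- Writing `-sin` as `cos` shifted by `π/2` keeps the family `osc` closed under differentiation.
Differentiating the exponential costs a factor `t` but gains a factor `y`, whereas differentiating
the phase costs `t` without any gain. -/
lemma gradX_osc {n : ℕ} {t : ℝ} {p θ : EuclideanSpace ℝ (Fin n) → ℝ} {τ c : ℝ} {ρ : ℝ → ℝ}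
    {α : EuclideanSpace ℝ (Fin n) → ℝ} (hp : ContDiff ℝ ∞ p) (hθ : ContDiff ℝ ∞ θ)
    (hρ : ContDiff ℝ ∞ ρ) (hα : ContDiff ℝ ∞ α) (z : Space n) (k : Fin n) :
    gradX (osc t p θ τ c ρ α) z k = osc t p θ τ c ρ (pd k α) z
      - osc t p θ τ (t * c) (fun y => y * ρ y) (fun x => α x * pd k p x) z
      + osc t p θ (τ + Real.pi / 2) (t * c) ρ (fun x => α x * pd k θ x) z := by
  refine gradX_eq_of_hasDerivAt
    ((contDiff_osc hp hθ hρ hα).differentiable (by simp) z) ?_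
  have h1 := hasDerivAt_line (hα.differentiable (by simp) z.1) k
  have h2 := hasDerivAt_line (hp.differentiable (by simp) z.1) k
  have h3 := hasDerivAt_line (hθ.differentiable (by simp) z.1) k
  have h4 := (((h1.const_mul (c * ρ z.2)).mul (((h2.const_mul t).mul_const z.2).neg.exp)).mul
    ((h3.const_mul t).add_const τ).cos)
  refine h4.congr_deriv ?_
  simp only [osc, Pi.mul_apply, Pi.neg_apply, zero_smul, add_zero, ← add_assoc, Real.cos_add_pi_div_two]
  ring

lemma derivY_osc {n : ℕ} {t : ℝ} {p θ : EuclideanSpace ℝ (Fin n) → ℝ} {τ c : ℝ} {ρ : ℝ → ℝ}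
    {α : EuclideanSpace ℝ (Fin n) → ℝ} (hp : ContDiff ℝ ∞ p) (hθ : ContDiff ℝ ∞ θ)
    (hρ : ContDiff ℝ ∞ ρ) (hα : ContDiff ℝ ∞ α) (z : Space n) :
    derivY (osc t p θ τ c ρ α) z = osc t p θ τ c (deriv ρ) α z
      - osc t p θ τ (t * c) ρ (fun x => p x * α x) z := by
  refine derivY_eq_of_hasDerivAt
    ((contDiff_osc hp hθ hρ hα).differentiable (by simp) z) ?_
  have h1 := (hρ.differentiable (by simp) z.2).hasDerivAt
  have h2 := (((((h1.const_mul c).mul_const (α z.1)).mul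
    (((hasDerivAt_id z.2).const_mul (t * p z.1)).neg.exp)).mul_const (Real.cos (t * θ z.1 + τ))))
  refine h2.congr_deriv ?_
  simp only [osc, Pi.neg_apply, id]
  ring

lemma gradX_add {n : ℕ} {f h : Space n → ℝ} {z : Space n} (hf : DifferentiableAt ℝ f z)
    (hh : DifferentiableAt ℝ h z) (k : Fin n) :
    gradX (fun z => f z + h z) z k = gradX f z k + gradX h z k := by
  simp only [gradX, fderiv_fun_add hf hh]; simp

lemma gradX_sub {n : ℕ} {f h : Space n → ℝ} {z : Space n} (hf : DifferentiableAt ℝ f z)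
    (hh : DifferentiableAt ℝ h z) (k : Fin n) :
    gradX (fun z => f z - h z) z k = gradX f z k - gradX h z k := by
  simp only [gradX, fderiv_fun_sub hf hh]; simp

lemma derivY_add {n : ℕ} {f h : Space n → ℝ} {z : Space n} (hf : DifferentiableAt ℝ f z)
    (hh : DifferentiableAt ℝ h z) :
    derivY (fun z => f z + h z) z = derivY f z + derivY h z := by
  simp only [derivY, fderiv_fun_add hf hh]; simp

lemma derivY_sub {n : ℕ} {f h : Space n → ℝ} {z : Space n} (hf : DifferentiableAt ℝ f z)
    (hh : DifferentiableAt ℝ h z) :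
    derivY (fun z => f z - h z) z = derivY f z - derivY h z := by
  simp only [derivY, fderiv_fun_sub hf hh]; simp

/-- The vector field `a ∇α`. -/
noncomputable def aGrad {n : ℕ} (a : EuclideanSpace ℝ (Fin n) → Matrix (Fin n) (Fin n) ℝ)
    (α : EuclideanSpace ℝ (Fin n) → ℝ) (k : Fin n) (x : EuclideanSpace ℝ (Fin n)) : ℝ :=
  ∑ l, a x k l * pd l α x

/-- The divergence of a vector field. -/
noncomputable def diverg {n : ℕ} (β : Fin n → EuclideanSpace ℝ (Fin n) → ℝ)
    (x : EuclideanSpace ℝ (Fin n)) : ℝ := ∑ k, pd k (β k) x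

/-- The pointwise product of a vector field with a gradient. -/
noncomputable def pairGrad {n : ℕ} (β : Fin n → EuclideanSpace ℝ (Fin n) → ℝ)
    (α : EuclideanSpace ℝ (Fin n) → ℝ) (x : EuclideanSpace ℝ (Fin n)) : ℝ := ∑ k, β k x * pd k α x

/-- The flux `a ∇ₓ U` on the cylinder. -/
noncomputable def flux {n : ℕ} (a : EuclideanSpace ℝ (Fin n) → Matrix (Fin n) (Fin n) ℝ)
    (U : Space n → ℝ) (k : Fin n) (z : Space n) : ℝ :=
  ∑ l, a z.1 k l * gradX U z l

/-- The operator `-div(a ∇ₓ U) - s ∂_y² U`. -/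
noncomputable def ellOp {n : ℕ} (a : EuclideanSpace ℝ (Fin n) → Matrix (Fin n) (Fin n) ℝ)
    (s : EuclideanSpace ℝ (Fin n) → ℝ) (U : Space n → ℝ) (z : Space n) : ℝ :=
  -(∑ k, gradX (flux a U k) z k) - s z.1 * derivY (derivY U) z

lemma contDiff_gradX_apply {n : ℕ} {U : Space n → ℝ} (hU : ContDiff ℝ ∞ U) (k : Fin n) :
    ContDiff ℝ ∞ (fun z => gradX U z k) := by
  simp only [gradX]
  exact (hU.fderiv_right (m := ∞) (by norm_cast)).clm_apply contDiff_const

lemma contDiff_derivY {n : ℕ} {U : Space n → ℝ} (hU : ContDiff ℝ ∞ U) :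
    ContDiff ℝ ∞ (derivY U) := by
  unfold derivY
  exact (hU.fderiv_right (m := ∞) (by norm_cast)).clm_apply contDiff_const

lemma contDiff_flux {n : ℕ} {a : EuclideanSpace ℝ (Fin n) → Matrix (Fin n) (Fin n) ℝ}
    (ha : ∀ i j, ContDiff ℝ ∞ (fun x => a x i j)) {U : Space n → ℝ} (hU : ContDiff ℝ ∞ U)
    (k : Fin n) : ContDiff ℝ ∞ (flux a U k) := by
  unfold flux
  exact ContDiff.sum fun l _ => ((ha k l).comp contDiff_fst).mul (contDiff_gradX_apply hU l)

lemma contDiff_aGrad {n : ℕ} {a : EuclideanSpace ℝ (Fin n) → Matrix (Fin n) (Fin n) ℝ}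
    (ha : ∀ i j, ContDiff ℝ ∞ (fun x => a x i j)) {α : EuclideanSpace ℝ (Fin n) → ℝ}
    (hα : ContDiff ℝ ∞ α) (k : Fin n) : ContDiff ℝ ∞ (aGrad a α k) := by
  unfold aGrad
  exact ContDiff.sum fun l _ => (ha k l).mul (contDiff_pd hα l)

lemma contDiff_pairGrad {n : ℕ} {β : Fin n → EuclideanSpace ℝ (Fin n) → ℝ}
    (hβ : ∀ k, ContDiff ℝ ∞ (β k)) {α : EuclideanSpace ℝ (Fin n) → ℝ} (hα : ContDiff ℝ ∞ α) :
    ContDiff ℝ ∞ (pairGrad β α) := by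
  unfold pairGrad
  exact ContDiff.sum fun k _ => (hβ k).mul (contDiff_pd hα k)

lemma ellOp_add {n : ℕ} {a : EuclideanSpace ℝ (Fin n) → Matrix (Fin n) (Fin n) ℝ}
    {s : EuclideanSpace ℝ (Fin n) → ℝ}
    (ha : ∀ i j, ContDiff ℝ ∞ (fun x => a x i j)) {U W : Space n → ℝ} (hU : ContDiff ℝ ∞ U)
    (hW : ContDiff ℝ ∞ W) (z : Space n) :
    ellOp a s (fun z => U z + W z) z = ellOp a s U z + ellOp a s W z := by
  have h1 : ∀ k, flux a (fun z => U z + W z) k = fun z => flux a U k z + flux a W k z := by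
    intro k; funext z
    simp only [flux, ← Finset.sum_add_distrib]
    refine Finset.sum_congr rfl fun l _ => ?_
    rw [gradX_add (hU.differentiable (by simp) z) (hW.differentiable (by simp) z)]; ring
  have h2 : derivY (fun z => U z + W z) = fun z => derivY U z + derivY W z :=
    funext fun z => derivY_add (hU.differentiable (by simp) z) (hW.differentiable (by simp) z)
  simp only [ellOp, h1, h2]
  rw [derivY_add ((contDiff_derivY hU).differentiable (by simp) z)
    ((contDiff_derivY hW).differentiable (by simp) z)]
  simp only [gradX_add ((contDiff_flux ha hU _).differentiable (by simp) z)
    ((contDiff_flux ha hW _).differentiable (by simp) z), Finset.sum_add_distrib]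
  ring

lemma sum_osc {n : ℕ} {ι : Type*} (I : Finset ι) (t : ℝ) (p θ : EuclideanSpace ℝ (Fin n) → ℝ)
    (τ c : ℝ) (ρ : ℝ → ℝ) (β : ι → EuclideanSpace ℝ (Fin n) → ℝ) (z : Space n) :
    ∑ k ∈ I, osc t p θ τ c ρ (β k) z = osc t p θ τ c ρ (fun x => ∑ k ∈ I, β k x) z := by
  simp only [osc, Finset.mul_sum, Finset.sum_mul]

/-- The action of the operator on an oscillating function. -/
lemma ellOp_osc {n : ℕ} {a : EuclideanSpace ℝ (Fin n) → Matrix (Fin n) (Fin n) ℝ}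
    {s : EuclideanSpace ℝ (Fin n) → ℝ}
    (ha : ∀ i j, ContDiff ℝ ∞ (fun x => a x i j)) (hsymm : ∀ x, (a x).IsSymm)
    {t : ℝ} {p θ : EuclideanSpace ℝ (Fin n) → ℝ} {τ c : ℝ} {ρ : ℝ → ℝ}
    {α : EuclideanSpace ℝ (Fin n) → ℝ} (hp : ContDiff ℝ ∞ p) (hθ : ContDiff ℝ ∞ θ)
    (hρ : ContDiff ℝ ∞ ρ) (hα : ContDiff ℝ ∞ α)
    (heik : ∀ x, pairGrad (aGrad a θ) θ x = s x * p x ^ 2) (z : Space n) :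
    ellOp a s (osc t p θ τ c ρ α) z =
      - osc t p θ (τ + Real.pi / 2) (t * c) ρ
          (fun x => pairGrad (aGrad a α) θ x + diverg (fun k x => α x * aGrad a θ k x) x) z
      + osc t p θ (τ + Real.pi / 2) (2 * t ^ 2 * c) (fun y => y * ρ y)
          (fun x => α x * pairGrad (aGrad a θ) p x) z
      + osc t p θ τ (2 * t * c) (deriv ρ) (fun x => s x * p x * α x) z
      - osc t p θ τ c (deriv (deriv ρ)) (fun x => s x * α x) z
      - osc t p θ τ c ρ (diverg (aGrad a α)) z
      + osc t p θ τ (t * c) (fun y => y * ρ y)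
          (fun x => pairGrad (aGrad a α) p x + diverg (fun k x => α x * aGrad a p k x) x) z
      - osc t p θ τ (t ^ 2 * c) (fun y => y ^ 2 * ρ y)
          (fun x => α x * pairGrad (aGrad a p) p x) z := by
  have hyρ : ContDiff ℝ ∞ (fun y => y * ρ y) := contDiff_id.mul hρ
  have hdρ : ContDiff ℝ ∞ (deriv ρ) := ((contDiff_infty_iff_deriv (𝕜 := ℝ)).1 hρ).2
  have c1 : ∀ k, ContDiff ℝ ∞ (aGrad a α k) := contDiff_aGrad ha hα
  have c2 : ∀ k, ContDiff ℝ ∞ (fun x => α x * aGrad a p k x) := fun k =>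
    hα.mul (contDiff_aGrad ha hp k)
  have c3 : ∀ k, ContDiff ℝ ∞ (fun x => α x * aGrad a θ k x) := fun k =>
    hα.mul (contDiff_aGrad ha hθ k)
  have hf : ∀ k, flux a (osc t p θ τ c ρ α) k = fun z =>
      (osc t p θ τ c ρ (aGrad a α k) z
        - osc t p θ τ (t * c) (fun y => y * ρ y) (fun x => α x * aGrad a p k x) z)
      + osc t p θ (τ + Real.pi / 2) (t * c) ρ (fun x => α x * aGrad a θ k x) z := by
    intro k; funext z
    simp only [flux, gradX_osc hp hθ hρ hα, osc, aGrad, Finset.mul_sum, Finset.sum_mul,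
      ← Finset.sum_add_distrib, ← Finset.sum_sub_distrib]
    exact Finset.sum_congr rfl fun l _ => by ring
  have hg : ∀ k, gradX (flux a (osc t p θ τ c ρ α) k) z k = _ := fun k => by
    rw [hf k, gradX_add (((contDiff_osc hp hθ hρ (c1 k)).sub
      (contDiff_osc hp hθ hyρ (c2 k))).differentiable (by simp) z)
      ((contDiff_osc hp hθ hρ (c3 k)).differentiable (by simp) z),
      gradX_sub ((contDiff_osc hp hθ hρ (c1 k)).differentiable (by simp) z)
      ((contDiff_osc hp hθ hyρ (c2 k)).differentiable (by simp) z),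
      gradX_osc hp hθ hρ (c1 k), gradX_osc hp hθ hyρ (c2 k), gradX_osc hp hθ hρ (c3 k)]
  have hy : derivY (osc t p θ τ c ρ α) = fun z => osc t p θ τ c (deriv ρ) α z
      - osc t p θ τ (t * c) ρ (fun x => p x * α x) z := funext fun z => derivY_osc hp hθ hρ hα z
  -- By symmetry of `a` the two mixed terms in `∇p` and `∇θ` coincide, whence the factor `2` in the
  -- result.
  have e1 : ∀ x, ∑ k, aGrad a p k x * pd k θ x = pairGrad (aGrad a θ) p x := by
    intro x
    simp only [pairGrad, aGrad, Finset.sum_mul]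
    rw [Finset.sum_comm]
    refine Finset.sum_congr rfl fun k _ => Finset.sum_congr rfl fun l _ => ?_
    rw [(hsymm x).apply]; ring
  have e2 : ∀ (γ β : EuclideanSpace ℝ (Fin n) → ℝ) (x : EuclideanSpace ℝ (Fin n)),
      ∑ k, α x * aGrad a γ k x * pd k β x = α x * ∑ k, aGrad a γ k x * pd k β x := by
    intro γ β x
    rw [Finset.mul_sum]; exact Finset.sum_congr rfl fun k _ => by ring
  rw [ellOp, Finset.sum_congr rfl fun k _ => hg k, hy,
    derivY_sub ((contDiff_osc hp hθ hdρ hα).differentiable (by simp) z)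
      ((contDiff_osc hp hθ hρ (hp.mul hα)).differentiable (by simp) z),
    derivY_osc hp hθ hdρ hα, derivY_osc hp hθ hρ (hp.mul hα)]
  simp only [Finset.sum_add_distrib, Finset.sum_sub_distrib, sum_osc, e2, e1]
  have hk := heik z.1
  simp only [pairGrad, diverg, osc, ← add_assoc, Real.cos_add_pi_div_two,
    Real.sin_add_pi_div_two] at hk ⊢
  -- The phase differentiated twice contributes `t² ⟨∇θ, a∇θ⟩` and the vertical second derivative
  -- contributes `-t² s p²`. The eikonal equation cancels the two.
  linear_combination (c * ρ z.2 * t ^ 2 * Real.exp (-(t * p z.1 * z.2)) * Real.cos (t * θ z.1 + τ)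
    * α z.1) * hk


/-! ### Amplitudes, orders of vanishing and exponentially decaying families -/

/-- A smooth amplitude vanishing outside `K`. -/
structure IsAmplitude {n : ℕ} (K : Set (EuclideanSpace ℝ (Fin n)))
    (α : EuclideanSpace ℝ (Fin n) → ℝ) : Prop where
  contDiff : ContDiff ℝ ∞ α
  eq_zero : ∀ x, x ∉ K → α x = 0

namespace IsAmplitude

variable {n : ℕ} {K : Set (EuclideanSpace ℝ (Fin n))} {α β : EuclideanSpace ℝ (Fin n) → ℝ}

lemma add (hα : IsAmplitude K α) (hβ : IsAmplitude K β) : IsAmplitude K (fun x => α x + β x) :=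
  ⟨hα.contDiff.add hβ.contDiff, fun x hx => by rw [hα.eq_zero x hx, hβ.eq_zero x hx, add_zero]⟩

lemma mul_right (hα : IsAmplitude K α) (hβ : ContDiff ℝ ∞ β) : IsAmplitude K (fun x => α x * β x) :=
  ⟨hα.contDiff.mul hβ, fun x hx => by rw [hα.eq_zero x hx, zero_mul]⟩

lemma mul_left (hα : IsAmplitude K α) (hβ : ContDiff ℝ ∞ β) : IsAmplitude K (fun x => β x * α x) :=
  ⟨hβ.mul hα.contDiff, fun x hx => by rw [hα.eq_zero x hx, mul_zero]⟩

lemma sum {ι : Type*} {I : Finset ι} {α : ι → EuclideanSpace ℝ (Fin n) → ℝ}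
    (h : ∀ i ∈ I, IsAmplitude K (α i)) : IsAmplitude K (fun x => ∑ i ∈ I, α i x) :=
  ⟨ContDiff.sum fun i hi => (h i hi).contDiff,
    fun x hx => Finset.sum_eq_zero fun i hi => (h i hi).eq_zero x hx⟩

/-- Off the closed set `K` the amplitude vanishes on a whole neighbourhood, so its derivative
vanishes too. -/
lemma pd (hα : IsAmplitude K α) (hK : IsClosed K) (k : Fin n) : IsAmplitude K (pd k α) := by
  refine ⟨contDiff_pd hα.contDiff k, fun x hx => ?_⟩
  have h : α =ᶠ[𝓝 x] fun _ => 0 := by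
    filter_upwards [hK.isOpen_compl.mem_nhds hx] with y hy using hα.eq_zero y hy
  rw [NDMap.pd, h.fderiv_eq]; simp

lemma aGrad (hα : IsAmplitude K α) (hK : IsClosed K)
    {a : EuclideanSpace ℝ (Fin n) → Matrix (Fin n) (Fin n) ℝ}
    (ha : ∀ i j, ContDiff ℝ ∞ (fun x => a x i j)) (k : Fin n) : IsAmplitude K (aGrad a α k) :=
  IsAmplitude.sum fun l _ => (hα.pd hK l).mul_left (ha k l)

lemma diverg {β : Fin n → EuclideanSpace ℝ (Fin n) → ℝ} (hβ : ∀ k, IsAmplitude K (β k))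
    (hK : IsClosed K) : IsAmplitude K (diverg β) :=
  IsAmplitude.sum fun k _ => (hβ k).pd hK k

lemma pairGrad {β : Fin n → EuclideanSpace ℝ (Fin n) → ℝ} (hβ : ∀ k, IsAmplitude K (β k))
    {γ : EuclideanSpace ℝ (Fin n) → ℝ} (hγ : ContDiff ℝ ∞ γ) : IsAmplitude K (pairGrad β γ) :=
  IsAmplitude.sum fun k _ => (hβ k).mul_right (contDiff_pd hγ k)

lemma exists_bound (hα : IsAmplitude K α) (hK : IsCompact K) :
    ∃ C, 0 ≤ C ∧ ∀ x, |α x| ≤ C := by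
  obtain ⟨C, hC⟩ := hK.exists_bound_of_continuousOn hα.contDiff.continuous.continuousOn
  refine ⟨max C 0, le_max_right _ _, fun x => ?_⟩
  by_cases hx : x ∈ K
  · exact (hC x hx).trans (le_max_left _ _)
  · rw [hα.eq_zero x hx, abs_zero]; exact le_max_right _ _

end IsAmplitude

/-- `ρ` vanishes to order `j` at `0`, with a global bound on `[0, ∞)`. -/
def VanishesToOrder (j : ℕ) (ρ : ℝ → ℝ) : Prop := ∃ C, 0 ≤ C ∧ ∀ y, 0 ≤ y → |ρ y| ≤ C * y ^ j

lemma VanishesToOrder.id_mul {j : ℕ} {ρ : ℝ → ℝ} (h : VanishesToOrder j ρ) :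
    VanishesToOrder (j + 1) (fun y => y * ρ y) := by
  obtain ⟨C, hC, h⟩ := h
  refine ⟨C, hC, fun y hy => ?_⟩
  rw [abs_mul, abs_of_nonneg hy, pow_succ]
  nlinarith [h y hy]

lemma VanishesToOrder.sq_mul {j : ℕ} {ρ : ℝ → ℝ} (h : VanishesToOrder j ρ) :
    VanishesToOrder (j + 2) (fun y => y ^ 2 * ρ y) := by
  have h2 := h.id_mul.id_mul
  convert h2 using 2 with y
  ring

lemma VanishesToOrder.add {j : ℕ} {ρ σ : ℝ → ℝ} (h : VanishesToOrder j ρ)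
    (h' : VanishesToOrder j σ) : VanishesToOrder j (fun y => ρ y + σ y) := by
  obtain ⟨C, hC, h⟩ := h
  obtain ⟨C', hC', h'⟩ := h'
  refine ⟨C + C', add_nonneg hC hC', fun y hy => ?_⟩
  rw [add_mul]
  exact (abs_add_le _ _).trans (add_le_add (h y hy) (h' y hy))

lemma VanishesToOrder.const_mul {j : ℕ} {ρ : ℝ → ℝ} (h : VanishesToOrder j ρ) (c : ℝ) :
    VanishesToOrder j (fun y => c * ρ y) := by
  obtain ⟨C, hC, h⟩ := h
  refine ⟨|c| * C, by positivity, fun y hy => ?_⟩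
  rw [abs_mul, mul_assoc]
  exact mul_le_mul_of_nonneg_left (h y hy) (abs_nonneg c)

/-- A family of functions of `(x, y)`, depending on `t` and a phase, that is supported over `K` and
is bounded by a multiple of `e^{-mty}`, uniformly in `t ≥ 1`. -/
structure IsDecaying {n : ℕ} (K : Set (EuclideanSpace ℝ (Fin n))) (m : ℝ)
    (R : ℝ → ℝ → Space n → ℝ) : Prop where
  bound : ∃ C, 0 ≤ C ∧ ∀ t τ z, 1 ≤ t → 0 ≤ z.2 → |R t τ z| ≤ C * Real.exp (-(m * t * z.2))
  eq_zero : ∀ t τ z, z.1 ∉ K → R t τ z = 0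

namespace IsDecaying

variable {n : ℕ} {K : Set (EuclideanSpace ℝ (Fin n))} {m : ℝ} {R Q : ℝ → ℝ → Space n → ℝ}

lemma add (hR : IsDecaying K m R) (hQ : IsDecaying K m Q) :
    IsDecaying K m (fun t τ z => R t τ z + Q t τ z) := by
  obtain ⟨C, hC, h⟩ := hR.bound
  obtain ⟨C', hC', h'⟩ := hQ.bound
  refine ⟨⟨C + C', add_nonneg hC hC', fun t τ z ht hz => ?_⟩, fun t τ z hz => ?_⟩
  · rw [add_mul]
    exact (abs_add_le _ _).trans (add_le_add (h t τ z ht hz) (h' t τ z ht hz))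
  · rw [hR.eq_zero t τ z hz, hQ.eq_zero t τ z hz, add_zero]

lemma neg (hR : IsDecaying K m R) : IsDecaying K m (fun t τ z => -R t τ z) := by
  obtain ⟨C, hC, h⟩ := hR.bound
  refine ⟨⟨C, hC, fun t τ z ht hz => ?_⟩, fun t τ z hz => ?_⟩
  · rw [abs_neg]; exact h t τ z ht hz
  · rw [hR.eq_zero t τ z hz, neg_zero]

lemma sub (hR : IsDecaying K m R) (hQ : IsDecaying K m Q) :
    IsDecaying K m (fun t τ z => R t τ z - Q t τ z) := by
  simp only [sub_eq_add_neg]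
  exact hR.add hQ.neg

/-- The factor `q` need only be bounded over `K`. This is what is available for a potential, which
is controlled only on `Ω`. -/
lemma bounded_mul (hR : IsDecaying K m R) {q : EuclideanSpace ℝ (Fin n) → ℝ} {M : ℝ}
    (hM : ∀ x ∈ K, |q x| ≤ M) : IsDecaying K m (fun t τ z => q z.1 * R t τ z) := by
  obtain ⟨C, hC, h⟩ := hR.bound
  refine ⟨⟨max M 0 * C, by positivity, fun t τ z ht hz => ?_⟩, fun t τ z hz => ?_⟩
  · by_cases hzK : z.1 ∈ K
    · rw [abs_mul, mul_assoc]
      exact mul_le_mul ((hM _ hzK).trans (le_max_left _ _)) (h t τ z ht hz) (abs_nonneg _)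
        (le_max_right _ _)
    · rw [hR.eq_zero t τ z hzK, mul_zero, abs_zero]; positivity
  · rw [hR.eq_zero t τ z hz, mul_zero]

end IsDecaying

/-- The counting rule of the construction: a power `t^j` is harmless when the profile vanishes like
`y^j`. Because `p ≥ 2m`, one factor `e^{-mty}` absorbs `(ty)^j`, by `u^j / j! ≤ e^u`, and another is
left over. -/
lemma isDecaying_osc {n : ℕ} {K : Set (EuclideanSpace ℝ (Fin n))} (hK : IsCompact K) {m : ℝ}
    (hm : 0 < m) {p θ : EuclideanSpace ℝ (Fin n) → ℝ} (hp : ∀ x, 2 * m ≤ p x)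
    {α : EuclideanSpace ℝ (Fin n) → ℝ} (hα : IsAmplitude K α) {σ c : ℝ → ℝ} {j : ℕ} {c₀ : ℝ}
    (hc : ∀ t, 1 ≤ t → |c t| ≤ c₀ * t ^ j) {ρ : ℝ → ℝ} (hρ : VanishesToOrder j ρ) :
    IsDecaying K m (fun t τ => osc t p θ (σ τ) (c t) ρ α) := by
  obtain ⟨A, hA0, hA⟩ := hα.exists_bound hK
  obtain ⟨C, hC0, hC⟩ := hρ
  have hc0 : 0 ≤ c₀ := by have := (abs_nonneg _).trans (hc 1 le_rfl); simpa using this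
  refine ⟨⟨c₀ * C * A * (j.factorial / m ^ j), by positivity, fun t τ z ht hz => ?_⟩,
    fun t τ z hz => by simp [osc, hα.eq_zero _ hz]⟩
  have ht0 : 0 ≤ t := zero_le_one.trans ht
  have h1 : Real.exp (-(t * p z.1 * z.2)) ≤
      Real.exp (-(m * t * z.2)) * Real.exp (-(m * t * z.2)) := by
    rw [← Real.exp_add]
    refine Real.exp_le_exp.2 ?_
    nlinarith [mul_nonneg (mul_nonneg ht0 hz) (sub_nonneg.2 (hp z.1))]
  have h2 : (t * z.2) ^ j * Real.exp (-(m * t * z.2)) ≤ j.factorial / m ^ j := by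
    have h3 := Real.pow_div_factorial_le_exp (m * t * z.2) (by positivity) j
    rw [div_le_iff₀ (by positivity), mul_assoc, mul_pow] at h3
    rw [Real.exp_neg, ← div_eq_mul_inv, div_le_div_iff₀ (Real.exp_pos _) (by positivity)]
    calc _ = m ^ j * (t * z.2) ^ j := by ring
      _ ≤ _ := h3
      _ = _ := by rw [← mul_assoc]; ring
  have h4 : |osc t p θ (σ τ) (c t) ρ α z| ≤
      (c₀ * t ^ j) * (C * z.2 ^ j) * A * Real.exp (-(t * p z.1 * z.2)) := by
    rw [osc, abs_mul, abs_mul, abs_mul, abs_mul, abs_of_pos (Real.exp_pos _)]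
    refine (mul_le_of_le_one_right (by positivity) (Real.abs_cos_le_one _)).trans ?_
    have := hc t ht
    have := hC z.2 hz
    have := hA z.1
    gcongr
  calc _ ≤ _ := h4
    _ ≤ (c₀ * t ^ j) * (C * z.2 ^ j) * A *
        (Real.exp (-(m * t * z.2)) * Real.exp (-(m * t * z.2))) :=
        mul_le_mul_of_nonneg_left h1 (by positivity)
    _ = c₀ * C * A * ((t * z.2) ^ j * Real.exp (-(m * t * z.2))) * Real.exp (-(m * t * z.2)) := by
        rw [mul_pow]; ring
    _ ≤ _ := by gcongr

/-! ### Cutoffs in the vertical variable -/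

/-- A cutoff function in the `y` variable. -/
structure IsCutoff (χ : ℝ → ℝ) : Prop where
  contDiff : ContDiff ℝ ∞ χ
  eq_one : ∀ y, |y| ≤ 1 → χ y = 1
  eq_zero : ∀ y, 2 ≤ |y| → χ y = 0

lemma exists_isCutoff : ∃ χ : ℝ → ℝ, IsCutoff χ := by
  let f : ContDiffBump (0 : ℝ) := ⟨1, 2, one_pos, one_lt_two⟩
  refine ⟨f, f.contDiff, fun y hy => f.one_of_mem_closedBall (by simpa using hy), fun y hy => ?_⟩
  exact f.zero_of_le_dist (by simpa using hy)

namespace IsCutoff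

variable {χ : ℝ → ℝ}

lemma hasCompactSupport (h : IsCutoff χ) : HasCompactSupport χ :=
  HasCompactSupport.intro (isCompact_closedBall (0 : ℝ) 2) fun y hy => h.eq_zero y (by
    simp only [Metric.mem_closedBall, dist_zero_right, Real.norm_eq_abs, not_le] at hy
    exact hy.le)

lemma contDiff_deriv (h : IsCutoff χ) : ContDiff ℝ ∞ (deriv χ) :=
  ((contDiff_infty_iff_deriv (𝕜 := ℝ)).1 h.contDiff).2

lemma contDiff_deriv_deriv (h : IsCutoff χ) : ContDiff ℝ ∞ (deriv (deriv χ)) :=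
  ((contDiff_infty_iff_deriv (𝕜 := ℝ)).1 h.contDiff_deriv).2

lemma vanishesToOrder_zero_of_compact {f : ℝ → ℝ} (hf : Continuous f) (hs : HasCompactSupport f) :
    VanishesToOrder 0 f := by
  obtain ⟨C, hC⟩ := hf.bounded_above_of_compact_support hs
  refine ⟨max C 0, le_max_right _ _, fun y _ => ?_⟩
  rw [pow_zero, mul_one]
  exact (hC y).trans (le_max_left _ _)

lemma order_zero (h : IsCutoff χ) : VanishesToOrder 0 χ :=
  vanishesToOrder_zero_of_compact h.contDiff.continuous h.hasCompactSupport

lemma deriv_order_zero (h : IsCutoff χ) : VanishesToOrder 0 (deriv χ) :=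
  vanishesToOrder_zero_of_compact h.contDiff_deriv.continuous h.hasCompactSupport.deriv

lemma deriv_deriv_order_zero (h : IsCutoff χ) : VanishesToOrder 0 (deriv (deriv χ)) :=
  vanishesToOrder_zero_of_compact h.contDiff_deriv_deriv.continuous h.hasCompactSupport.deriv.deriv

lemma deriv_eq_zero (h : IsCutoff χ) {y : ℝ} (hy : |y| < 1) : deriv χ y = 0 := by
  have h1 : χ =ᶠ[𝓝 y] fun _ => 1 := by
    filter_upwards [(isOpen_lt continuous_abs continuous_const).mem_nhds hy] with x hx
    exact h.eq_one x (le_of_lt hx)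
  rw [h1.deriv_eq]; simp

/-- The derivative of the cutoff vanishes near `y = 0`, so a factor `y` comes for free. It pays for
the factor `t` multiplying this derivative in the leading term. -/
lemma deriv_order_one (h : IsCutoff χ) : VanishesToOrder 1 (deriv χ) := by
  obtain ⟨C, hC0, hC⟩ := h.deriv_order_zero
  refine ⟨C, hC0, fun y hy => ?_⟩
  by_cases hy1 : y < 1
  · rw [h.deriv_eq_zero (by rwa [abs_of_nonneg hy]), abs_zero]; positivity
  · refine (hC y hy).trans ?_
    rw [pow_zero, pow_one]
    exact mul_le_mul_of_nonneg_left (not_lt.1 hy1) hC0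

lemma deriv_id_mul (h : IsCutoff χ) : deriv (fun y => y * χ y) = fun y => χ y + y * deriv χ y := by
  funext y
  have h1 := (h.contDiff.differentiable (by simp) y).hasDerivAt
  exact (((hasDerivAt_id y).mul h1).congr_deriv (by simp)).deriv

lemma deriv_sq_mul (h : IsCutoff χ) :
    deriv (fun y => y * (y * χ y)) = fun y => 2 * (y * χ y) + y * (y * deriv χ y) := by
  funext y
  have h1 := (h.contDiff.differentiable (by simp) y).hasDerivAt
  exact (((hasDerivAt_id y).mul ((hasDerivAt_id y).mul h1)).congr_deriv (by simp; ring)).deriv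

lemma deriv_deriv_id_mul (h : IsCutoff χ) :
    deriv (deriv (fun y => y * χ y)) = fun y => 2 * deriv χ y + y * deriv (deriv χ) y := by
  rw [h.deriv_id_mul]
  funext y
  have h1 := (h.contDiff.differentiable (by simp) y).hasDerivAt
  have h2 := (h.contDiff_deriv.differentiable (by simp) y).hasDerivAt
  exact ((h1.add ((hasDerivAt_id y).mul h2)).congr_deriv (by simp; ring)).deriv

lemma deriv_deriv_sq_mul (h : IsCutoff χ) :
    deriv (deriv (fun y => y * (y * χ y))) =
      fun y => 2 * χ y + (4 * (y * deriv χ y) + y * (y * deriv (deriv χ) y)) := by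
  rw [h.deriv_sq_mul]
  funext y
  have h1 := (h.contDiff.differentiable (by simp) y).hasDerivAt
  have h2 := (h.contDiff_deriv.differentiable (by simp) y).hasDerivAt
  exact (((((hasDerivAt_id y).mul h1).const_mul 2).add
    ((hasDerivAt_id y).mul ((hasDerivAt_id y).mul h2))).congr_deriv (by simp; ring)).deriv

end IsCutoff


/-! ### The asymptotic solution and its residual -/

/-- Smooth global coefficients `a`, `s` together with a phase `θ` and a decay rate `p ≥ 2m` solving
the eikonal equation `⟨∇θ, a ∇θ⟩ = s p²`. -/
structure IsEikonal {n : ℕ} (a : EuclideanSpace ℝ (Fin n) → Matrix (Fin n) (Fin n) ℝ)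
    (s p θ : EuclideanSpace ℝ (Fin n) → ℝ) (m : ℝ) : Prop where
  contDiff_a : ∀ i j, ContDiff ℝ ∞ (fun x => a x i j)
  symm : ∀ x, (a x).IsSymm
  contDiff_s : ContDiff ℝ ∞ s
  s_pos : ∀ x, 0 < s x
  contDiff_p : ContDiff ℝ ∞ p
  m_pos : 0 < m
  le_p : ∀ x, 2 * m ≤ p x
  contDiff_θ : ContDiff ℝ ∞ θ
  eikonal : ∀ x, pairGrad (aGrad a θ) θ x = s x * p x ^ 2

section

variable {n : ℕ} {a : EuclideanSpace ℝ (Fin n) → Matrix (Fin n) (Fin n) ℝ}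
  {s p θ : EuclideanSpace ℝ (Fin n) → ℝ} {m : ℝ} {K : Set (EuclideanSpace ℝ (Fin n))}
  {α : EuclideanSpace ℝ (Fin n) → ℝ}

lemma IsEikonal.p_pos (h : IsEikonal a s p θ m) (x : EuclideanSpace ℝ (Fin n)) : 0 < p x := by
  have := h.m_pos
  exact lt_of_lt_of_le (by positivity) (h.le_p x)

/-- The first order operator appearing in the transport equation. -/
noncomputable def transport (a : EuclideanSpace ℝ (Fin n) → Matrix (Fin n) (Fin n) ℝ)
    (θ α : EuclideanSpace ℝ (Fin n) → ℝ) (x : EuclideanSpace ℝ (Fin n)) : ℝ :=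
  pairGrad (aGrad a α) θ x + diverg (fun k x => α x * aGrad a θ k x) x

lemma IsAmplitude.transport (hα : IsAmplitude K α) (hK : IsClosed K)
    (h : IsEikonal a s p θ m) : IsAmplitude K (transport a θ α) :=
  (IsAmplitude.pairGrad (fun k => hα.aGrad hK h.contDiff_a k) h.contDiff_θ).add
    (IsAmplitude.diverg (fun k => hα.mul_right (contDiff_aGrad h.contDiff_a h.contDiff_θ k)) hK)

/-- The terms of lowest order in the action of the operator on an oscillating function decay. -/
lemma IsEikonal.isDecaying_lower (h : IsEikonal a s p θ m) (hK : IsCompact K)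
    (hα : IsAmplitude K α) {c σ : ℝ → ℝ} {j : ℕ} {c₀ : ℝ}
    (hc : ∀ t, 1 ≤ t → |c t| ≤ c₀ * t ^ j) {ρ : ℝ → ℝ} (hρ : VanishesToOrder j ρ) :
    IsDecaying K m (fun t τ z => - osc t p θ (σ τ) (c t) ρ (diverg (aGrad a α)) z
      + osc t p θ (σ τ) (t * c t) (fun y => y * ρ y)
          (fun x => pairGrad (aGrad a α) p x + diverg (fun k x => α x * aGrad a p k x) x) z
      - osc t p θ (σ τ) (t ^ 2 * c t) (fun y => y ^ 2 * ρ y)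
          (fun x => α x * pairGrad (aGrad a p) p x) z) := by
  have hKc := hK.isClosed
  refine ((isDecaying_osc hK h.m_pos h.le_p ?_ hc hρ).neg.add
    (isDecaying_osc hK h.m_pos h.le_p ?_ (c₀ := c₀) ?_ hρ.id_mul)).sub
    (isDecaying_osc hK h.m_pos h.le_p ?_ (c₀ := c₀) ?_ hρ.sq_mul)
  · exact IsAmplitude.diverg (fun k => hα.aGrad hKc h.contDiff_a k) hKc
  · exact (IsAmplitude.pairGrad (fun k => hα.aGrad hKc h.contDiff_a k) h.contDiff_p).add
      (IsAmplitude.diverg (fun k => hα.mul_right (contDiff_aGrad h.contDiff_a h.contDiff_p k)) hKc)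
  · intro t ht
    rw [abs_mul, abs_of_nonneg (by linarith)]
    calc t * |c t| ≤ t * (c₀ * t ^ j) := mul_le_mul_of_nonneg_left (hc t ht) (by linarith)
      _ = _ := by ring
  · exact hα.mul_right (contDiff_pairGrad (contDiff_aGrad h.contDiff_a h.contDiff_p) h.contDiff_p)
  · intro t ht
    rw [abs_mul, abs_of_nonneg (by positivity)]
    calc t ^ 2 * |c t| ≤ t ^ 2 * (c₀ * t ^ j) := mul_le_mul_of_nonneg_left (hc t ht) (by positivity)
      _ = _ := by ring

/-- The terms with shifted phase in the action of the operator on an oscillating function decay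
when the amplitude is one order better. -/
lemma IsEikonal.isDecaying_upper (h : IsEikonal a s p θ m) (hK : IsCompact K)
    (hα : IsAmplitude K α) {c σ : ℝ → ℝ} {j : ℕ} {c₀ : ℝ}
    (hc : ∀ t, 1 ≤ t → |t * c t| ≤ c₀ * t ^ j) {ρ : ℝ → ℝ} (hρ : VanishesToOrder j ρ) :
    IsDecaying K m (fun t τ z => - osc t p θ (σ τ) (t * c t) ρ
          (fun x => pairGrad (aGrad a α) θ x + diverg (fun k x => α x * aGrad a θ k x) x) z
      + osc t p θ (σ τ) (2 * t ^ 2 * c t) (fun y => y * ρ y)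
          (fun x => α x * pairGrad (aGrad a θ) p x) z) := by
  have hKc := hK.isClosed
  refine (isDecaying_osc hK h.m_pos h.le_p (hα.transport hKc h) hc hρ).neg.add
    (isDecaying_osc hK h.m_pos h.le_p ?_ (c₀ := 2 * c₀) ?_ hρ.id_mul)
  · exact hα.mul_right (contDiff_pairGrad (contDiff_aGrad h.contDiff_a h.contDiff_θ) h.contDiff_p)
  · intro t ht
    have e : 2 * t ^ 2 * c t = 2 * t * (t * c t) := by ring
    rw [e, abs_mul, abs_of_nonneg (by linarith)]
    calc 2 * t * |t * c t| ≤ 2 * t * (c₀ * t ^ j) :=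
          mul_le_mul_of_nonneg_left (hc t ht) (by linarith)
      _ = _ := by ring

/-- The coefficient of `t y²` in the amplitude of the asymptotic solution. -/
noncomputable def ampSnd (a : EuclideanSpace ℝ (Fin n) → Matrix (Fin n) (Fin n) ℝ)
    (s p θ A : EuclideanSpace ℝ (Fin n) → ℝ) (x : EuclideanSpace ℝ (Fin n)) : ℝ :=
  (A x / p x) * (-pairGrad (aGrad a θ) p x / (2 * (s x * p x)))

/-- The coefficient of `y` in the amplitude of the asymptotic solution. -/
noncomputable def ampFst (a : EuclideanSpace ℝ (Fin n) → Matrix (Fin n) (Fin n) ℝ)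
    (s p θ A : EuclideanSpace ℝ (Fin n) → ℝ) (x : EuclideanSpace ℝ (Fin n)) : ℝ :=
  (transport a θ (fun x => A x / p x) x + ampSnd a s p θ A x * (2 * s x)) / (2 * (s x * p x))

/-- The asymptotic solution with Neumann datum `t A(x) cos(t θ(x) + τ)`. -/
noncomputable def wkb (a : EuclideanSpace ℝ (Fin n) → Matrix (Fin n) (Fin n) ℝ)
    (s p θ A : EuclideanSpace ℝ (Fin n) → ℝ) (χ : ℝ → ℝ) (t τ : ℝ) (z : Space n) : ℝ :=
  osc t p θ τ 1 χ (fun x => A x / p x) z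
    + (osc t p θ (τ + Real.pi / 2) t⁻¹ χ (fun x => ampFst a s p θ A x / p x) z
    + (osc t p θ (τ + Real.pi / 2) 1 (fun y => y * χ y) (ampFst a s p θ A) z
    + osc t p θ (τ + Real.pi / 2) t (fun y => y * (y * χ y)) (ampSnd a s p θ A) z))

lemma IsEikonal.isAmplitude_div_p (h : IsEikonal a s p θ m) (hα : IsAmplitude K α) :
    IsAmplitude K (fun x => α x / p x) := by
  simp only [div_eq_mul_inv]
  exact hα.mul_right (h.contDiff_p.inv fun x => (h.p_pos x).ne')

lemma IsEikonal.isAmplitude_ampSnd (h : IsEikonal a s p θ m) (hα : IsAmplitude K α) :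
    IsAmplitude K (ampSnd a s p θ α) := by
  refine (h.isAmplitude_div_p hα).mul_right ?_
  refine ((contDiff_pairGrad (contDiff_aGrad h.contDiff_a h.contDiff_θ) h.contDiff_p).neg).div
    (contDiff_const.mul (h.contDiff_s.mul h.contDiff_p)) fun x => ?_
  have := h.s_pos x
  have := h.p_pos x
  positivity

lemma IsEikonal.isAmplitude_ampFst (h : IsEikonal a s p θ m) (hK : IsClosed K)
    (hα : IsAmplitude K α) : IsAmplitude K (ampFst a s p θ α) := by
  unfold ampFst
  simp only [div_eq_mul_inv _ (2 * (s _ * p _))]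
  refine (((h.isAmplitude_div_p hα).transport hK h).add ((h.isAmplitude_ampSnd hα).mul_right
    (contDiff_const.mul h.contDiff_s))).mul_right ?_
  refine (contDiff_const.mul (h.contDiff_s.mul h.contDiff_p)).inv fun x => ?_
  have := h.s_pos x
  have := h.p_pos x
  positivity

variable {χ : ℝ → ℝ}

lemma IsCutoff.contDiff_id_mul (hχ : IsCutoff χ) : ContDiff ℝ ∞ (fun y => y * χ y) :=
  contDiff_id.mul hχ.contDiff

lemma IsCutoff.contDiff_sq_mul (hχ : IsCutoff χ) : ContDiff ℝ ∞ (fun y => y * (y * χ y)) :=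
  contDiff_id.mul hχ.contDiff_id_mul

lemma IsEikonal.contDiff_wkb (h : IsEikonal a s p θ m) (hK : IsClosed K) (hα : IsAmplitude K α)
    (hχ : IsCutoff χ) (t τ : ℝ) : ContDiff ℝ ∞ (wkb a s p θ α χ t τ) := by
  have h1 := h.isAmplitude_ampFst hK hα
  exact (contDiff_osc h.contDiff_p h.contDiff_θ hχ.contDiff (h.isAmplitude_div_p hα).contDiff).add
    ((contDiff_osc h.contDiff_p h.contDiff_θ hχ.contDiff (h.isAmplitude_div_p h1).contDiff).add
    ((contDiff_osc h.contDiff_p h.contDiff_θ hχ.contDiff_id_mul h1.contDiff).add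
    (contDiff_osc h.contDiff_p h.contDiff_θ hχ.contDiff_sq_mul
      (h.isAmplitude_ampSnd hα).contDiff)))

lemma wkb_eq_zero_of_le (hχ : IsCutoff χ) (t τ : ℝ) {z : Space n} (hz : 2 ≤ |z.2|) :
    wkb a s p θ α χ t τ z = 0 := by
  simp [wkb, osc, hχ.eq_zero _ hz]

lemma IsEikonal.isDecaying_wkb (h : IsEikonal a s p θ m) (hK : IsCompact K) (hα : IsAmplitude K α)
    (hχ : IsCutoff χ) : IsDecaying K m (wkb a s p θ α χ) := by
  have h1 := h.isAmplitude_ampFst hK.isClosed hα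
  have c1 : ∀ t : ℝ, 1 ≤ t → |(1 : ℝ)| ≤ 1 * t ^ 0 := fun t _ => by simp
  have c2 : ∀ t : ℝ, 1 ≤ t → |t⁻¹| ≤ 1 * t ^ 0 := fun t ht => by
    rw [abs_of_nonneg (by positivity)]; simpa using inv_le_one_of_one_le₀ ht
  have c3 : ∀ t : ℝ, 1 ≤ t → |(1 : ℝ)| ≤ 1 * t ^ 1 := fun t ht => by simpa using ht
  have c4 : ∀ t : ℝ, 1 ≤ t → |t| ≤ 1 * t ^ 2 := fun t ht => by
    rw [abs_of_nonneg (by linarith)]; nlinarith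
  exact (isDecaying_osc (σ := fun τ => τ) (c := fun _ => 1) hK h.m_pos h.le_p
      (h.isAmplitude_div_p hα) c1 hχ.order_zero).add
    ((isDecaying_osc (σ := fun τ => τ + Real.pi / 2) hK h.m_pos h.le_p (h.isAmplitude_div_p h1) c2
      hχ.order_zero).add
    ((isDecaying_osc (σ := fun τ => τ + Real.pi / 2) (c := fun _ => 1) hK h.m_pos h.le_p h1 c3
      hχ.order_zero.id_mul).add
    (isDecaying_osc (σ := fun τ => τ + Real.pi / 2) (c := fun t => t) hK h.m_pos h.le_p
      (h.isAmplitude_ampSnd hα) c4 hχ.order_zero.id_mul.id_mul)))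

/-- The datum is attained exactly. The correction linear in `y` has slope `ampFst` at `y = 0`, and
the term with coefficient `t⁻¹` and amplitude `ampFst / p` is included to cancel it. The quadratic
correction has zero slope. -/
lemma IsEikonal.derivY_wkb (h : IsEikonal a s p θ m) (hK : IsClosed K) (hα : IsAmplitude K α)
    (hχ : IsCutoff χ) {t : ℝ} (ht : t ≠ 0) (τ : ℝ) (x : EuclideanSpace ℝ (Fin n)) :
    derivY (wkb a s p θ α χ t τ) (x, 0) = -(t * α x * Real.cos (t * θ x + τ)) := by
  have h1 := h.isAmplitude_ampFst hK hα
  have d1 := contDiff_osc (t := t) (τ := τ) (c := 1) h.contDiff_p h.contDiff_θ hχ.contDiff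
    (h.isAmplitude_div_p hα).contDiff
  have d2 := contDiff_osc (t := t) (τ := τ + Real.pi / 2) (c := t⁻¹) h.contDiff_p h.contDiff_θ
    hχ.contDiff (h.isAmplitude_div_p h1).contDiff
  have d3 := contDiff_osc (t := t) (τ := τ + Real.pi / 2) (c := 1) h.contDiff_p h.contDiff_θ
    hχ.contDiff_id_mul h1.contDiff
  have d4 := contDiff_osc (t := t) (τ := τ + Real.pi / 2) (c := t) h.contDiff_p h.contDiff_θ
    hχ.contDiff_sq_mul (h.isAmplitude_ampSnd hα).contDiff
  have hd : ∀ {f : Space n → ℝ}, ContDiff ℝ ∞ f → DifferentiableAt ℝ f (x, 0) :=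
    fun hf => hf.differentiable (by simp) _
  unfold wkb
  rw [derivY_add (hd d1) (hd (d2.add (d3.add d4))), derivY_add (hd d2) (hd (d3.add d4)),
    derivY_add (hd d3) (hd d4),
    derivY_osc h.contDiff_p h.contDiff_θ hχ.contDiff (h.isAmplitude_div_p hα).contDiff,
    derivY_osc h.contDiff_p h.contDiff_θ hχ.contDiff (h.isAmplitude_div_p h1).contDiff,
    derivY_osc h.contDiff_p h.contDiff_θ hχ.contDiff_id_mul h1.contDiff,
    derivY_osc h.contDiff_p h.contDiff_θ hχ.contDiff_sq_mul (h.isAmplitude_ampSnd hα).contDiff,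
    hχ.deriv_id_mul, hχ.deriv_sq_mul]
  have hp := (h.p_pos x).ne'
  have e1 : χ 0 = 1 := hχ.eq_one 0 (by simp)
  have e2 : deriv χ 0 = 0 := hχ.deriv_eq_zero (by simp)
  simp only [osc, e1, e2]
  field_simp
  simp
  ring

/-- At `y = 0` only the leading term and the correction of size `t⁻¹` survive. -/
lemma IsEikonal.abs_wkb_sub_le (h : IsEikonal a s p θ m) (hK : IsCompact K) (hα : IsAmplitude K α)
    (hχ : IsCutoff χ) : ∃ C, 0 ≤ C ∧ ∀ t τ x, 0 < t →
      |wkb a s p θ α χ t τ (x, 0) - α x / p x * Real.cos (t * θ x + τ)| ≤ C / t := by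
  obtain ⟨C, hC0, hC⟩ := (h.isAmplitude_div_p
    (h.isAmplitude_ampFst hK.isClosed hα)).exists_bound hK
  refine ⟨C, hC0, fun t τ x ht => ?_⟩
  have e1 : χ 0 = 1 := hχ.eq_one 0 (by simp)
  have e : wkb a s p θ α χ t τ (x, 0) - α x / p x * Real.cos (t * θ x + τ)
      = t⁻¹ * (ampFst a s p θ α x / p x) * Real.cos (t * θ x + (τ + Real.pi / 2)) := by
    simp [wkb, osc, e1]
  rw [e, abs_mul, abs_mul, abs_of_pos (inv_pos.2 ht), div_eq_inv_mul C t]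
  refine (mul_le_of_le_one_right (by positivity) (Real.abs_cos_le_one _)).trans ?_
  exact mul_le_mul_of_nonneg_left (hC x) (by positivity)

/-- Where the cutoff equals `1`, the values at the phases `0` and `π/2` are, up to sign, the
components of the rotated vector `(X, Y)`, with `X` the leading envelope and `Y` the envelope of the
corrections. Their squares sum to `X² + Y²`, without oscillation. -/
lemma wkb_sq_add_sq_ge (hχ : IsCutoff χ) (t : ℝ) {z : Space n} (hz : |z.2| ≤ 1) :
    (α z.1 / p z.1 * Real.exp (-(t * p z.1 * z.2))) ^ 2 ≤
      wkb a s p θ α χ t 0 z ^ 2 + wkb a s p θ α χ t (Real.pi / 2) z ^ 2 := by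
  have e1 := hχ.eq_one _ hz
  set X := α z.1 / p z.1 * Real.exp (-(t * p z.1 * z.2)) with hX
  set Y := (t⁻¹ * (ampFst a s p θ α z.1 / p z.1) + z.2 * ampFst a s p θ α z.1
    + t * (z.2 * z.2) * ampSnd a s p θ α z.1) * Real.exp (-(t * p z.1 * z.2)) with hY
  have h0 : wkb a s p θ α χ t 0 z = X * Real.cos (t * θ z.1) - Y * Real.sin (t * θ z.1) := by
    simp only [wkb, osc, e1, hX, hY, add_zero, zero_add, Real.cos_add_pi_div_two]; ring
  have h1 : wkb a s p θ α χ t (Real.pi / 2) z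
      = -(X * Real.sin (t * θ z.1) + Y * Real.cos (t * θ z.1)) := by
    simp only [wkb, osc, e1, hX, hY, ← add_assoc, Real.cos_add_pi_div_two,
      Real.sin_add_pi_div_two]; ring
  rw [h0, h1]
  have h2 : (X * Real.cos (t * θ z.1) - Y * Real.sin (t * θ z.1)) ^ 2
      + (-(X * Real.sin (t * θ z.1) + Y * Real.cos (t * θ z.1))) ^ 2 = X ^ 2 + Y ^ 2 := by
    linear_combination (X ^ 2 + Y ^ 2) * Real.sin_sq_add_cos_sq (t * θ z.1)
  rw [h2]
  nlinarith [sq_nonneg Y]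

/-- The residual of the asymptotic solution is bounded and exponentially decaying. -/
lemma IsDecaying.congr {n : ℕ} {K : Set (EuclideanSpace ℝ (Fin n))} {m : ℝ}
    {R Q : ℝ → ℝ → Space n → ℝ} (hR : IsDecaying K m R) (h : ∀ t τ z, Q t τ z = R t τ z) :
    IsDecaying K m Q := by
  have : Q = R := funext fun t => funext fun τ => funext (h t τ)
  rwa [this]

/-- After the eikonal equation, the leading amplitude `α/p` still leaves two terms that are too
large, both with phase shifted by `π/2`: one of type `t² y`, from the gradient of `p` along `a∇θ`,
and one of type `t`, from the transport operator. The vertical second derivative of `t y² · ampSnd`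
cancels the first, which fixes `ampSnd`, and leaves a further term of type `t`. The correction `y ·
ampFst` cancels all terms of type `t`, which fixes `ampFst`. Every other term has at least as many
powers of `y` as of `t` and decays. -/
lemma IsEikonal.isDecaying_ellOp_wkb (h : IsEikonal a s p θ m) (hK : IsCompact K)
    (hα : IsAmplitude K α) (hχ : IsCutoff χ) :
    IsDecaying K m (fun t τ => ellOp a s (wkb a s p θ α χ t τ)) := by
  have hKc := hK.isClosed
  have a0 := h.isAmplitude_div_p hα
  have a2 := h.isAmplitude_ampFst hKc hα
  have a1 := h.isAmplitude_div_p a2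
  have a3 := h.isAmplitude_ampSnd hα
  have c1 : ∀ t : ℝ, 1 ≤ t → |(1 : ℝ)| ≤ 1 * t ^ 0 := fun t _ => by simp
  have c2 : ∀ t : ℝ, 1 ≤ t → |t⁻¹| ≤ 1 * t ^ 0 := fun t ht => by
    rw [abs_of_nonneg (by positivity)]; simpa using inv_le_one_of_one_le₀ ht
  have c2' : ∀ t : ℝ, 1 ≤ t → |t * t⁻¹| ≤ 1 * t ^ 0 := fun t ht => by
    rw [mul_inv_cancel₀ (by linarith)]; simp
  have c3 : ∀ t : ℝ, 1 ≤ t → |(1 : ℝ)| ≤ 1 * t ^ 1 := fun t ht => by simpa using ht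
  have c3' : ∀ t : ℝ, 1 ≤ t → |t * 1| ≤ 1 * t ^ 1 := fun t ht => by
    rw [abs_of_nonneg (by linarith)]; simp
  have c4 : ∀ t : ℝ, 1 ≤ t → |t| ≤ 1 * t ^ 2 := fun t ht => by
    rw [abs_of_nonneg (by linarith)]; nlinarith
  have c4' : ∀ t : ℝ, 1 ≤ t → |t * t| ≤ 1 * t ^ 2 := fun t ht => by
    rw [abs_of_nonneg (by positivity)]; nlinarith
  have cD : ∀ (k : ℝ) (j : ℕ) (t : ℝ), 1 ≤ t → |k * t ^ j| ≤ |k| * t ^ j := fun k j t ht => by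
    rw [abs_mul, abs_of_nonneg (by positivity : (0 : ℝ) ≤ t ^ j)]
  have hsp := h.contDiff_s.mul h.contDiff_p
  have L0 := h.isDecaying_lower (σ := fun τ => τ) (c := fun _ => 1) hK a0 c1 hχ.order_zero
  have L1 := h.isDecaying_lower (σ := fun τ => τ + Real.pi / 2) hK a1 c2 hχ.order_zero
  have L2 := h.isDecaying_lower (σ := fun τ => τ + Real.pi / 2) (c := fun _ => 1) hK a2 c3
    hχ.order_zero.id_mul
  have L3 := h.isDecaying_lower (σ := fun τ => τ + Real.pi / 2) (c := fun t => t) hK a3 c4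
    hχ.order_zero.id_mul.id_mul
  -- The corrections already carry one phase shift, so their own shifted terms carry two. These are
  -- admissible because each correction is one order smaller than the leading term.
  have U1 := h.isDecaying_upper (σ := fun τ => τ + Real.pi / 2 + Real.pi / 2) hK a1 c2' hχ.order_zero
  have U2 := h.isDecaying_upper (σ := fun τ => τ + Real.pi / 2 + Real.pi / 2) (c := fun _ => 1) hK a2
    c3' hχ.order_zero.id_mul
  have U3 := h.isDecaying_upper (σ := fun τ => τ + Real.pi / 2 + Real.pi / 2) (c := fun t => t) hK a3
    c4' hχ.order_zero.id_mul.id_mul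
  have D0 := isDecaying_osc (σ := fun τ => τ) (c := fun t => 2 * t * 1) (θ := θ) hK h.m_pos h.le_p
    (a0.mul_left hsp) (c₀ := 2) (fun t ht => by simp [abs_of_nonneg (zero_le_one.trans ht)])
    hχ.deriv_order_one
  have E0 := isDecaying_osc (σ := fun τ => τ) (c := fun _ => 1) (θ := θ) hK h.m_pos h.le_p
    (a0.mul_left h.contDiff_s) c1 hχ.deriv_deriv_order_zero
  have D1 := isDecaying_osc (σ := fun τ => τ + Real.pi / 2) (c := fun t => 2 * t * t⁻¹) (θ := θ) hK
    h.m_pos h.le_p (a1.mul_left hsp) (c₀ := 2) (fun t ht => by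
      rw [mul_assoc, mul_inv_cancel₀ (by linarith)]; simp) hχ.deriv_order_zero
  have E1 := isDecaying_osc (σ := fun τ => τ + Real.pi / 2) (c := fun t => t⁻¹) (θ := θ) hK h.m_pos
    h.le_p (a1.mul_left h.contDiff_s) c2 hχ.deriv_deriv_order_zero
  -- The profiles left over from differentiating `yχ` and `y²χ`, once the parts involving `χ` itself
  -- have been set aside for cancellation.
  have hχ1 : VanishesToOrder 1 (fun y => y * deriv χ y) := hχ.deriv_order_zero.id_mul
  have hχ2 : VanishesToOrder 0 (fun y => 2 * deriv χ y + y * deriv (deriv χ) y) := by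
    refine (hχ.deriv_order_zero.const_mul 2).add (IsCutoff.vanishesToOrder_zero_of_compact ?_ ?_)
    · have := hχ.contDiff_deriv_deriv.continuous
      fun_prop
    · exact hχ.hasCompactSupport.deriv.deriv.mul_left
  have hχ3 : VanishesToOrder 1 (fun y => 4 * (y * deriv χ y) + y * (y * deriv (deriv χ) y)) := by
    refine (hχ1.const_mul 4).add
      (VanishesToOrder.id_mul (IsCutoff.vanishesToOrder_zero_of_compact ?_ ?_))
    · have := hχ.contDiff_deriv_deriv.continuous
      fun_prop
    · exact hχ.hasCompactSupport.deriv.deriv.mul_left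
  have E2 := isDecaying_osc (σ := fun τ => τ + Real.pi / 2) (c := fun _ => 1) (θ := θ) hK h.m_pos
    h.le_p (a2.mul_left h.contDiff_s) c1 hχ2
  have F1 := isDecaying_osc (σ := fun τ => τ + Real.pi / 2) (c := fun t => 2 * t) (θ := θ) hK h.m_pos
    h.le_p (a2.mul_left hsp) (c₀ := 2) (fun t ht => by simp [abs_of_nonneg (zero_le_one.trans ht)]) hχ1
  have F2 := isDecaying_osc (σ := fun τ => τ + Real.pi / 2) (c := fun t => 2 * t ^ 2) (θ := θ) hK
    h.m_pos h.le_p (a3.mul_left hsp) (c₀ := 2) (fun t ht => by simp) hχ1.id_mul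
  have F3 := isDecaying_osc (σ := fun τ => τ + Real.pi / 2) (c := fun t => t) (θ := θ) hK h.m_pos
    h.le_p (a3.mul_left h.contDiff_s) (c₀ := 1)
    (fun t ht => by simp [abs_of_nonneg (zero_le_one.trans ht)]) hχ3
  -- The cancellation of all terms that would grow: the defining equations `h1` of `ampSnd` and `h2`
  -- of `ampFst` remove the profiles `t² yχ` and `tχ`, leaving only terms with derivatives of the
  -- cutoff.
  have key : ∀ (t τ : ℝ) (z : Space n),
      - osc t p θ (τ + Real.pi / 2) (t * 1) χ (fun x => pairGrad (aGrad a fun x => α x / p x) θ x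
          + diverg (fun k x => α x / p x * aGrad a θ k x) x) z
        + osc t p θ (τ + Real.pi / 2) (2 * t ^ 2 * 1) (fun y => y * χ y)
          (fun x => α x / p x * pairGrad (aGrad a θ) p x) z
        + osc t p θ (τ + Real.pi / 2) (2 * t * 1) (fun y => χ y + y * deriv χ y)
          (fun x => s x * p x * ampFst a s p θ α x) z
        + osc t p θ (τ + Real.pi / 2) (2 * t * t) (fun y => 2 * (y * χ y) + y * (y * deriv χ y))
          (fun x => s x * p x * ampSnd a s p θ α x) z
        - osc t p θ (τ + Real.pi / 2) t
          (fun y => 2 * χ y + (4 * (y * deriv χ y) + y * (y * deriv (deriv χ) y)))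
          (fun x => s x * ampSnd a s p θ α x) z
      = osc t p θ (τ + Real.pi / 2) (2 * t) (fun y => y * deriv χ y)
          (fun x => s x * p x * ampFst a s p θ α x) z
        + osc t p θ (τ + Real.pi / 2) (2 * t ^ 2) (fun y => y * (y * deriv χ y))
          (fun x => s x * p x * ampSnd a s p θ α x) z
        - osc t p θ (τ + Real.pi / 2) t
          (fun y => 4 * (y * deriv χ y) + y * (y * deriv (deriv χ) y))
          (fun x => s x * ampSnd a s p θ α x) z := by
    intro t τ z
    have hs := (h.s_pos z.1).ne'
    have hp := (h.p_pos z.1).ne'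
    have h1 : 2 * (s z.1 * p z.1 * ampSnd a s p θ α z.1)
        = -(α z.1 / p z.1 * pairGrad (aGrad a θ) p z.1) := by
      rw [ampSnd]; field_simp
    have h2 : 2 * (s z.1 * p z.1 * ampFst a s p θ α z.1)
        = (pairGrad (aGrad a fun x => α x / p x) θ z.1
          + diverg (fun k x => α x / p x * aGrad a θ k x) z.1)
          + 2 * (s z.1 * ampSnd a s p θ α z.1) := by
      rw [ampFst, transport]; field_simp
    simp only [osc]
    linear_combination (Real.exp (-(t * p z.1 * z.2)) * Real.cos (t * θ z.1 + (τ + Real.pi / 2)))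
      * (t * χ z.2 * h2 + 2 * t ^ 2 * z.2 * χ z.2 * h1)
  have S := ((((D0.sub E0).add L0).add (((U1.add D1).sub E1).add L1)).add ((U2.sub E2).add L2)).add
    ((U3.add L3).add ((F1.add F2).sub F3))
  refine S.congr fun t τ z => ?_
  have d1 := contDiff_osc (t := t) (τ := τ) (c := 1) h.contDiff_p h.contDiff_θ hχ.contDiff
    a0.contDiff
  have d2 := contDiff_osc (t := t) (τ := τ + Real.pi / 2) (c := t⁻¹) h.contDiff_p h.contDiff_θ
    hχ.contDiff a1.contDiff
  have d3 := contDiff_osc (t := t) (τ := τ + Real.pi / 2) (c := 1) h.contDiff_p h.contDiff_θ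
    hχ.contDiff_id_mul a2.contDiff
  have d4 := contDiff_osc (t := t) (τ := τ + Real.pi / 2) (c := t) h.contDiff_p h.contDiff_θ
    hχ.contDiff_sq_mul a3.contDiff
  unfold wkb
  rw [ellOp_add h.contDiff_a d1 (d2.add (d3.add d4)), ellOp_add h.contDiff_a d2 (d3.add d4),
    ellOp_add h.contDiff_a d3 d4,
    ellOp_osc h.contDiff_a h.symm h.contDiff_p h.contDiff_θ hχ.contDiff a0.contDiff h.eikonal,
    ellOp_osc h.contDiff_a h.symm h.contDiff_p h.contDiff_θ hχ.contDiff a1.contDiff h.eikonal,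
    ellOp_osc h.contDiff_a h.symm h.contDiff_p h.contDiff_θ hχ.contDiff_id_mul a2.contDiff
      h.eikonal,
    ellOp_osc h.contDiff_a h.symm h.contDiff_p h.contDiff_θ hχ.contDiff_sq_mul a3.contDiff
      h.eikonal, hχ.deriv_deriv_id_mul, hχ.deriv_deriv_sq_mul, hχ.deriv_id_mul,
    hχ.deriv_sq_mul]
  have := key t τ z
  linear_combination this

end


/-! ### Green's formula and the weak equation of a smooth function -/

lemma IsC1Bottom.mul_left {n : ℕ} {Ω : Set (EuclideanSpace ℝ (Fin n))} {f φ : Space n → ℝ}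
    (hf : ContDiff ℝ 1 f) (hφ : IsC1Bottom Ω φ) : IsC1Bottom Ω (fun z => f z * φ z) :=
  ⟨hf.mul hφ.contDiff, hφ.compactSupport.mul_left,
    (tsupport_mul_subset_right (f := f) (g := φ)).trans hφ.tsupport_subset⟩

lemma IsC1Bottom.setIntegral_gradX {n : ℕ} {Ω : Set (EuclideanSpace ℝ (Fin n))} {φ : Space n → ℝ}
    (hφ : IsC1Bottom Ω φ) (k : Fin n) : ∫ z in cyl Ω, gradX φ z k = 0 := by
  rw [← setIntegral_cyl_eq MeasurableSet.univ (subset_univ _) fun z hz => by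
    rw [hφ.gradX_eq_zero hz]; rfl]
  exact NDMap.setIntegral_gradX hφ.contDiff hφ.compactSupport k

lemma derivY_comp_fst_mul {n : ℕ} {s : EuclideanSpace ℝ (Fin n) → ℝ} {f : Space n → ℝ} {z : Space n}
    (hs : DifferentiableAt ℝ s z.1) (hf : DifferentiableAt ℝ f z) :
    derivY (fun z => s z.1 * f z) z = s z.1 * derivY f z := by
  refine derivY_eq_of_hasDerivAt
    (DifferentiableAt.mul (hs.comp z differentiableAt_fst) hf) ?_
  exact (hasDerivAt_slice hf).const_mul (s z.1)

lemma continuous_ellOp {n : ℕ}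
    {a : EuclideanSpace ℝ (Fin n) → Matrix (Fin n) (Fin n) ℝ} {s : EuclideanSpace ℝ (Fin n) → ℝ}
    (ha : ∀ i j, ContDiff ℝ ∞ (fun x => a x i j)) (hs : ContDiff ℝ ∞ s)
    {U : Space n → ℝ} (hU : ContDiff ℝ ∞ U) : Continuous (ellOp a s U) := by
  unfold ellOp
  have h1 : ∀ k, Continuous (fun z => gradX (flux a U k) z k) := fun k =>
    (contDiff_gradX_apply (contDiff_flux ha hU k) k).continuous
  have h2 := (contDiff_derivY (contDiff_derivY hU)).continuous
  have h3 := hs.continuous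
  fun_prop

/-- Green's formula on the cylinder. -/
lemma setIntegral_flux_gradX {n : ℕ} {Ω : Set (EuclideanSpace ℝ (Fin n))}
    {a : EuclideanSpace ℝ (Fin n) → Matrix (Fin n) (Fin n) ℝ} {s : EuclideanSpace ℝ (Fin n) → ℝ}
    (ha : ∀ i j, ContDiff ℝ ∞ (fun x => a x i j)) (hs : ContDiff ℝ ∞ s)
    {U φ : Space n → ℝ} (hU : ContDiff ℝ ∞ U) (hφ : IsC1Bottom Ω φ) :
    ∫ z in cyl Ω, ((∑ k, flux a U k z * gradX φ z k) + s z.1 * (derivY U z * derivY φ z))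
      = (∫ x in Ω, s x * -derivY U (x, 0) * φ (x, 0)) + ∫ z in cyl Ω, ellOp a s U z * φ z := by
  have hfl := fun k => contDiff_flux ha hU k
  have hUy := contDiff_derivY hU
  have hd := hφ.contDiff.differentiable one_ne_zero
  have hF : ∀ k, IsC1Bottom Ω (fun z => flux a U k z * φ z) := fun k =>
    hφ.mul_left ((hfl k).of_le (by simp))
  have hY' : ContDiff ℝ 1 (fun z : Space n => s z.1 * derivY U z) :=
    ((hs.comp contDiff_fst).mul hUy).of_le (by simp)
  have hY : IsC1Bottom Ω (fun z => s z.1 * derivY U z * φ z) := hφ.mul_left hY'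
  have hop := continuous_ellOp ha hs hU
  have hint : ∀ h : Space n → ℝ, Continuous h → HasCompactSupport h →
      Integrable h (volume.restrict (cyl Ω)) := fun h h1 h2 =>
    (h1.integrable_of_hasCompactSupport h2).restrict
  have i0 : Integrable (fun z => ellOp a s U z * φ z) (volume.restrict (cyl Ω)) :=
    hint _ (hop.mul hφ.contDiff.continuous) hφ.compactSupport.mul_left
  have i1 : ∀ k, Integrable (fun z => gradX (fun z => flux a U k z * φ z) z k)
      (volume.restrict (cyl Ω)) := fun k => hint _ (continuous_gradX_apply (hF k).contDiff k)
        (hasCompactSupport_gradX_apply (hF k).compactSupport k)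
  have i2 : Integrable (derivY (fun z => s z.1 * derivY U z * φ z)) (volume.restrict (cyl Ω)) :=
    hint _ (continuous_derivY hY.contDiff) (hasCompactSupport_derivY hY.compactSupport)
  have i3 : Integrable (fun z => ∑ k, gradX (fun z => flux a U k z * φ z) z k)
      (volume.restrict (cyl Ω)) := integrable_finsetSum _ fun k _ => i1 k
  have e : ∀ z, (∑ k, flux a U k z * gradX φ z k) + s z.1 * (derivY U z * derivY φ z)
      = ((∑ k, gradX (fun z => flux a U k z * φ z) z k)
        + derivY (fun z => s z.1 * derivY U z * φ z) z) + ellOp a s U z * φ z := by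
    intro z
    rw [derivY_mul (hY'.differentiable one_ne_zero z) (hd z),
      derivY_comp_fst_mul (hs.differentiable (by simp) _) (hUy.differentiable (by simp) _)]
    simp only [gradX_mul ((hfl _).differentiable (by simp) z) (hd z), Finset.sum_add_distrib,
      ← Finset.sum_mul, ellOp]
    ring
  simp only [e]
  rw [integral_add (by exact i3.add i2) i0, integral_add i3 i2,
    integral_finsetSum _ fun k _ => i1 k, setIntegral_derivY hY.contDiff hY.compactSupport,
    Finset.sum_eq_zero fun k _ => (hF k).setIntegral_gradX k, zero_add, ← integral_neg]
  congr 1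
  refine integral_congr_ae (Eventually.of_forall fun x => ?_)
  simp only []
  ring

lemma isC1Bottom_of_eq_zero {n : ℕ} {Ω K : Set (EuclideanSpace ℝ (Fin n))} (hK : IsCompact K)
    (hKΩ : K ⊆ Ω) {U : Space n → ℝ} (hU : ContDiff ℝ ∞ U) (hUK : ∀ z, z.1 ∉ K → U z = 0)
    (hUy : ∀ z, 2 ≤ |z.2| → U z = 0) : IsC1Bottom Ω U := by
  have h : Function.support U ⊆ K ×ˢ Icc (-2 : ℝ) 2 := by
    intro z hz
    refine ⟨by_contra fun h => hz (hUK z h), ?_⟩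
    have : ¬ 2 ≤ |z.2| := fun h => hz (hUy z h)
    exact abs_le.1 (not_le.1 this).le
  have hc : IsCompact (K ×ˢ Icc (-2 : ℝ) 2) := hK.prod isCompact_Icc
  have ht : tsupport U ⊆ K ×ˢ Icc (-2 : ℝ) 2 := closure_minimal h hc.isClosed
  exact ⟨hU.of_le (by simp), HasCompactSupport.of_support_subset_isCompact hc h,
    ht.trans (Set.prod_mono hKΩ (subset_univ _))⟩

lemma jet_eq_zero_of_eq_zero {n : ℕ} {K : Set (EuclideanSpace ℝ (Fin n))} (hK : IsClosed K)
    {U : Space n → ℝ} (hUK : ∀ z, z.1 ∉ K → U z = 0) {z : Space n} (hz : z.1 ∉ K) :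
    U z = 0 ∧ gradX U z = 0 ∧ derivY U z = 0 := by
  have h : U =ᶠ[𝓝 z] fun _ => 0 := by
    filter_upwards [(hK.isOpen_compl.preimage continuous_fst).mem_nhds hz] with y hy
    exact hUK y hy
  have h1 : fderiv ℝ U z = 0 := by rw [h.fderiv_eq]; simp
  exact ⟨hUK z hz, gradX_eq_zero_of_fderiv h1, by simp [derivY, h1]⟩

lemma hasCompactSupport_ellOp {n : ℕ} (a : EuclideanSpace ℝ (Fin n) → Matrix (Fin n) (Fin n) ℝ)
    (s : EuclideanSpace ℝ (Fin n) → ℝ) {U : Space n → ℝ} (hU : HasCompactSupport U) :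
    HasCompactSupport (ellOp a s U) := by
  refine HasCompactSupport.intro hU fun z hz => ?_
  have h0 : U =ᶠ[𝓝 z] fun _ => 0 := by
    filter_upwards [(isClosed_tsupport U).isOpen_compl.mem_nhds hz] with y hy
    exact image_eq_zero_of_notMem_tsupport hy
  have h1 : fderiv ℝ U =ᶠ[𝓝 z] fun _ => 0 := by
    filter_upwards [h0.eventuallyEq_nhds] with y hy
    rw [hy.fderiv_eq]; simp
  have h2 : ∀ k, flux a U k =ᶠ[𝓝 z] fun _ => 0 := fun k => by
    filter_upwards [h1] with y hy
    simp [flux, gradX_eq_zero_of_fderiv hy]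
  have h3 : derivY U =ᶠ[𝓝 z] fun _ => 0 := by
    filter_upwards [h1] with y hy
    simp [derivY, hy]
  rw [ellOp, derivY, h3.fderiv_eq]
  simp [gradX, (h2 _).fderiv_eq]

lemma memLp_ellOp_add {n : ℕ} {Ω : Set (EuclideanSpace ℝ (Fin n))}
    (hΩ : IsOpen Ω) (hb : Bornology.IsBounded Ω) {V : EuclideanSpace ℝ (Fin n) → ℝ}
    (hV : IsPotential Ω V) {a : EuclideanSpace ℝ (Fin n) → Matrix (Fin n) (Fin n) ℝ}
    {s : EuclideanSpace ℝ (Fin n) → ℝ} (ha : ∀ i j, ContDiff ℝ ∞ (fun x => a x i j))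
    (hs : ContDiff ℝ ∞ s) {U : Space n → ℝ} (hU : IsC1Bottom Ω U) (hUs : ContDiff ℝ ∞ U) :
    MemLp (fun z => ellOp a s U z + (V z.1 * s z.1) * U z) 2 (volume.restrict (cyl Ω)) := by
  refine (((continuous_ellOp ha hs hUs).memLp_of_hasCompactSupport
    (hasCompactSupport_ellOp a s hU.compactSupport)).restrict _).add ?_
  have hVs : ContinuousOn (fun x => V x * s x) (closure Ω) :=
    hV.smooth.continuousOn.mul hs.continuous.continuousOn
  obtain ⟨M, hM0, hM⟩ := exists_bound_of_continuousOn_closure hb hVs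
  have h1 : MemLp (fun z => M * U z) 2 (volume.restrict (cyl Ω)) :=
    ((hU.contDiff.continuous.memLp_of_hasCompactSupport hU.compactSupport).const_mul M).restrict _
  refine h1.mono ((aestronglyMeasurable_comp_fst hΩ hVs).mul
    hU.contDiff.continuous.aestronglyMeasurable) ?_
  refine (ae_restrict_iff' (measurableSet_cyl hΩ.measurableSet)).2 (Eventually.of_forall ?_)
  intro z hz
  rw [norm_mul _ (U z), norm_mul M, Real.norm_eq_abs, Real.norm_of_nonneg hM0]
  exact mul_le_mul_of_nonneg_right (hM _ (subset_closure hz.1)) (norm_nonneg _)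

/-- The equation satisfied by a smooth compactly supported function, tested against the elements
of the energy domain. -/
lemma IsEllipticMetric.lpForm_toEnergy {n : ℕ} {Ω K : Set (EuclideanSpace ℝ (Fin n))}
    (hΩ : IsOpen Ω) (hb : Bornology.IsBounded Ω)
    {g : EuclideanSpace ℝ (Fin n) → Matrix (Fin n) (Fin n) ℝ}
    {V : EuclideanSpace ℝ (Fin n) → ℝ} (hg : IsEllipticMetric Ω g) (hV : IsPotential Ω V)
    {a : EuclideanSpace ℝ (Fin n) → Matrix (Fin n) (Fin n) ℝ} {s : EuclideanSpace ℝ (Fin n) → ℝ}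
    (ha : ∀ i j, ContDiff ℝ ∞ (fun x => a x i j)) (hasymm : ∀ x, (a x).IsSymm)
    (hs : ContDiff ℝ ∞ s)
    (hag : ∀ x ∈ K, ∀ i j, (g x)⁻¹ i j * √((g x).det) = a x i j) (hsg : ∀ x ∈ K, √((g x).det) = s x)
    (hK : IsCompact K) {U : Space n → ℝ} (hU : IsC1Bottom Ω U)
    (hUs : ContDiff ℝ ∞ U) (hUK : ∀ z, z.1 ∉ K → U z = 0) :
    ∀ v ∈ energyDomain Ω, lpForm (hg.isBddForm hΩ hb hV) hU.toEnergy.fst v.fst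
      = (∫ x in Ω, s x * -derivY U (x, 0) * v.snd x)
        + ∫ z in cyl Ω, (ellOp a s U z + (V z.1 * s z.1) * U z) * (v.fst z).fst := by
  have hop := continuous_ellOp ha hs hUs
  have hopc := hasCompactSupport_ellOp a s hU.compactSupport
  have hF : MemLp (fun x => s x * -derivY U (x, 0)) 2 (volume.restrict Ω) := by
    have h1 := (contDiff_derivY hUs).continuous
    have h2 := hs.continuous
    have h3 := (hasCompactSupport_slice_left (hasCompactSupport_derivY hU.compactSupport) 0).comp_left
      (g := fun r : ℝ => -r) neg_zero
    exact (Continuous.memLp_of_hasCompactSupport (by fun_prop) h3.mul_left).restrict _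
  have hR := memLp_ellOp_add hΩ hb hV ha hs hU hUs
  refine energyDomain_induction ?_ ?_
  -- Both integrals on the right are inner products with fixed `L²` elements, so the identity is a
  -- closed condition on `v`. It remains to prove it for `C¹` test functions, where it is Green's
  -- formula.
  · have h1 : Continuous (fun x : EnergySpace Ω => x.fst) := WithLp.continuous_fst 2 _ _
    have h2 : Continuous (fun x : EnergySpace Ω => x.snd) := WithLp.continuous_snd 2 _ _
    have hR' := memLp_jet_mk hR (MemLp.zero (ε := EuclideanSpace ℝ (Fin n))) (MemLp.zero (ε := ℝ))
    have e1 : ∀ v : EnergySpace Ω, ∫ x in Ω, s x * -derivY U (x, 0) * v.snd x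
        = inner ℝ (hF.toLp _) v.snd := fun v => by
      rw [inner_toLp_eq_integral]
      refine integral_congr_ae (Eventually.of_forall fun x => ?_)
      simp [mul_comm]
    have e2 : ∀ v : EnergySpace Ω,
        ∫ z in cyl Ω, (ellOp a s U z + (V z.1 * s z.1) * U z) * (v.fst z).fst
        = inner ℝ (hR'.toLp _) v.fst := fun v => by
      rw [inner_toLp_eq_integral]
      refine integral_congr_ae (Eventually.of_forall fun x => ?_)
      simp only [Jet.inner_mk]
      simp
    simp only [e1, e2]
    refine isClosed_eq ((lpForm (hg.isBddForm hΩ hb hV) _).continuous.comp h1) ?_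
    fun_prop
  · intro φ hφ
    have e1 : ∫ x in Ω, s x * -derivY U (x, 0) * hφ.toEnergy.snd x
        = ∫ x in Ω, s x * -derivY U (x, 0) * φ (x, 0) := by
      refine integral_congr_ae ?_
      filter_upwards [hφ.toEnergy_snd] with x hx
      rw [hx]
    have e2 : ∫ z in cyl Ω, (ellOp a s U z + (V z.1 * s z.1) * U z) * (hφ.toEnergy.fst z).fst
        = ∫ z in cyl Ω, (ellOp a s U z + (V z.1 * s z.1) * U z) * φ z := by
      refine integral_congr_ae ?_
      filter_upwards [hφ.toEnergy_fst] with x hx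
      rw [hx]; rfl
    have hφL : MemLp φ 2 (volume.restrict (cyl Ω)) := memLp_fst hφ.memLp_jet
    have i1 : Integrable (fun z => (ellOp a s U z + (V z.1 * s z.1) * U z) * φ z)
        (volume.restrict (cyl Ω)) := MemLp.integrable_mul (p := 2) (q := 2) hR hφL
    have i2 : Integrable (fun z => ellOp a s U z * φ z) (volume.restrict (cyl Ω)) :=
      MemLp.integrable_mul (p := 2) (q := 2) ((hop.memLp_of_hasCompactSupport hopc).restrict _) hφL
    have i3 : Integrable (fun z => V z.1 * s z.1 * U z * φ z) (volume.restrict (cyl Ω)) := by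
      refine (i1.sub i2).congr (Eventually.of_forall fun z => ?_)
      simp only [Pi.sub_apply]; ring
    have i4 : Integrable (fun z => (∑ k, flux a U k z * gradX φ z k)
        + s z.1 * (derivY U z * derivY φ z)) (volume.restrict (cyl Ω)) := by
      have h1 : ∀ k, Continuous (fun z => flux a U k z) := fun k =>
        (contDiff_flux ha hUs k).continuous
      have h2 := (contDiff_derivY hUs).continuous
      have h3 := hs.continuous
      have h4 := fun k => continuous_gradX_apply hφ.contDiff k
      have h5 := continuous_derivY hφ.contDiff
      refine (Continuous.integrable_of_hasCompactSupport (by fun_prop) ?_).restrict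
      refine HasCompactSupport.intro hφ.compactSupport fun z hz => ?_
      have h6 : fderiv ℝ φ z = 0 := by
        by_contra h; exact hz (support_fderiv_subset ℝ h)
      simp [gradX_eq_zero_of_fderiv h6, derivY, h6]
    have e3 : lpForm (hg.isBddForm hΩ hb hV) hU.toEnergy.fst hφ.toEnergy.fst
        = ∫ z in cyl Ω, (((∑ k, flux a U k z * gradX φ z k)
        + s z.1 * (derivY U z * derivY φ z)) + V z.1 * s z.1 * U z * φ z) := by
      rw [lpForm_apply]
      refine integral_congr_ae ?_
      filter_upwards [hU.toEnergy_fst, hφ.toEnergy_fst] with z h1 h2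
      rw [h1, h2, metricForm_expand]
      change (∑ i, ∑ j, ((g z.1)⁻¹ i j * √((g z.1).det)) * (gradX U z i * gradX φ z j))
        + √((g z.1).det) * (derivY U z * derivY φ z) + (V z.1 * √((g z.1).det)) * (U z * φ z) = _
      -- The global coefficients agree with those of the metric only over `K`. Elsewhere the jet of
      -- `U` vanishes, and both integrands with it.
      by_cases hz : z.1 ∈ K
      · simp only [flux, Finset.sum_mul]
        rw [Finset.sum_comm]
        rw [hsg _ hz]
        congr 1
        · congr 1
          refine Finset.sum_congr rfl fun i _ => Finset.sum_congr rfl fun j _ => ?_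
          rw [(hasymm z.1).apply, ← hag _ hz, hsg _ hz]; ring
        · ring
      · obtain ⟨h3, h4, h5⟩ := jet_eq_zero_of_eq_zero hK.isClosed hUK hz
        simp [flux, h3, h4, h5]
    rw [e1, e2, e3, integral_add i4 i3, setIntegral_flux_gradX ha hs hUs hφ, add_assoc,
      ← integral_add i2 i3]
    congr 1
    refine integral_congr_ae (Eventually.of_forall fun x => ?_)
    simp only []
    ring


/-! ### Global extension of the metric and solution of the eikonal equation -/

/-- The ellipticity bounds are convex conditions on the matrix, and as `l < 1` the identity
satisfies them with the same constant. -/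
lemma isEllipticMatrix_interpolate {n : ℕ} {l c : ℝ} {A : Matrix (Fin n) (Fin n) ℝ}
    (hA : IsEllipticMatrix l A) (hl : l < 1) (hc : c ∈ Icc (0 : ℝ) 1) :
    IsEllipticMatrix l (c • A + (1 - c) • (1 : Matrix (Fin n) (Fin n) ℝ)) := by
  have h0 := hA.pos
  have hn : ∀ ξ : Fin n → ℝ, 0 ≤ ξ ⬝ᵥ ξ := fun ξ => by
    simp only [dotProduct]; exact Finset.sum_nonneg fun i _ => mul_self_nonneg _
  have e : ∀ ξ : Fin n → ℝ, ξ ⬝ᵥ ((c • A + (1 - c) • (1 : Matrix (Fin n) (Fin n) ℝ)) *ᵥ ξ)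
      = c * (ξ ⬝ᵥ (A *ᵥ ξ)) + (1 - c) * (ξ ⬝ᵥ ξ) := fun ξ => by
    simp [Matrix.add_mulVec, Matrix.smul_mulVec, dotProduct_add, dotProduct_smul]
  refine ⟨h0, ?_, fun ξ => ?_, fun ξ => ?_⟩
  · exact (hA.symm.smul c).add (Matrix.isSymm_one.smul _)
  · rw [e]
    nlinarith [mul_le_mul_of_nonneg_left (hA.lower ξ) hc.1,
      mul_nonneg (mul_nonneg (sub_nonneg.2 hc.2) (sub_nonneg.2 hl.le)) (hn ξ)]
  · rw [e]
    have hl' : 1 ≤ l⁻¹ := (one_le_inv₀ h0).2 hl.le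
    nlinarith [mul_le_mul_of_nonneg_left (hA.upper ξ) hc.1,
      mul_nonneg (mul_nonneg (sub_nonneg.2 hc.2) (sub_nonneg.2 hl')) (hn ξ)]

/-- An elliptic metric agrees near a given closed set with one defined on the whole space. -/
lemma IsEllipticMetric.exists_extension {n : ℕ} {Ω C : Set (EuclideanSpace ℝ (Fin n))}
    (hΩ : IsOpen Ω) (hC : IsClosed C) (hCΩ : C ⊆ Ω)
    {g : EuclideanSpace ℝ (Fin n) → Matrix (Fin n) (Fin n) ℝ} (hg : IsEllipticMetric Ω g) :
    ∃ (G : EuclideanSpace ℝ (Fin n) → Matrix (Fin n) (Fin n) ℝ) (l : ℝ),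
      (∀ i j, ContDiff ℝ ∞ (fun x => G x i j)) ∧ (∀ x, IsEllipticMatrix l (G x)) ∧
        ∀ x ∈ C, G x = g x := by
  obtain ⟨l, hl1, hl0, hl⟩ := hg.exists_closure
  obtain ⟨ζ, hζ0, hζ1, hζ⟩ := exists_contMDiffMap_zero_one_nhds_of_isClosed (n := ⊤)
    (modelWithCornersSelf ℝ (EuclideanSpace ℝ (Fin n))) hΩ.isClosed_compl hC
    (disjoint_compl_left_iff_subset.2 hCΩ)
  have hζs : ContDiff ℝ ∞ ζ := ζ.contMDiff.contDiff
  -- The metric is blended into the identity. Since `ζ` vanishes near the complement of `Ω`, the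
  -- values of `g` outside `Ω` do not affect smoothness.
  refine ⟨fun x => ζ x • g x + (1 - ζ x) • 1, l, fun i j => ?_, fun x => ?_, fun x hx => ?_⟩
  · simp only [Matrix.add_apply, Matrix.smul_apply, smul_eq_mul]
    refine ContDiff.add ?_ ((contDiff_const.sub hζs).mul contDiff_const)
    refine contDiff_iff_contDiffAt.2 fun x => ?_
    by_cases hx : x ∈ Ω
    · exact hζs.contDiffAt.mul (((hg.smooth i j).mono subset_closure).contDiffAt (hΩ.mem_nhds hx))
    · refine (contDiffAt_const (c := (0 : ℝ))).congr_of_eventuallyEq ?_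
      filter_upwards [Filter.Eventually.filter_mono (nhds_le_nhdsSet (s := Ωᶜ) hx) hζ0] with y hy
      rw [hy, zero_mul]
  · by_cases hx : x ∈ Ω
    · exact isEllipticMatrix_interpolate (hl x (subset_closure hx)) hl1 (hζ x)
    · have h1 : IsEllipticMatrix l (1 : Matrix (Fin n) (Fin n) ℝ) := by
        have hn : ∀ ξ : Fin n → ℝ, 0 ≤ ξ ⬝ᵥ ξ := fun ξ => by
          simp only [dotProduct]; exact Finset.sum_nonneg fun i _ => mul_self_nonneg _
        have hl' : 1 ≤ l⁻¹ := (one_le_inv₀ hl0).2 hl1.le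
        refine ⟨hl0, Matrix.isSymm_one, fun ξ => ?_, fun ξ => ?_⟩
        · rw [Matrix.one_mulVec]; nlinarith [hn ξ]
        · rw [Matrix.one_mulVec]; nlinarith [hn ξ]
      have h2 : ζ x = 0 := hζ0.self_of_nhdsSet x hx
      simpa [h2] using h1
  · have h2 : ζ x = 1 := hζ1.self_of_nhdsSet x hx
    simp [h2]

/-- The density `√det G`. -/
noncomputable def density {n : ℕ} (G : EuclideanSpace ℝ (Fin n) → Matrix (Fin n) (Fin n) ℝ)
    (x : EuclideanSpace ℝ (Fin n)) : ℝ := √((G x).det)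

/-- The coefficient matrix `√det G · G⁻¹` of the Laplace-Beltrami operator. -/
noncomputable def coeffMatrix {n : ℕ} (G : EuclideanSpace ℝ (Fin n) → Matrix (Fin n) (Fin n) ℝ)
    (x : EuclideanSpace ℝ (Fin n)) : Matrix (Fin n) (Fin n) ℝ := density G x • (G x)⁻¹

/-- The length of the covector `ξ` in the dual metric of `G`. -/
noncomputable def covLength {n : ℕ} (G : EuclideanSpace ℝ (Fin n) → Matrix (Fin n) (Fin n) ℝ)
    (ξ : Fin n → ℝ) (x : EuclideanSpace ℝ (Fin n)) : ℝ := √(ξ ⬝ᵥ ((G x)⁻¹ *ᵥ ξ))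

/-- The linear function with differential `ξ`. -/
noncomputable def linPhase {n : ℕ} (ξ : Fin n → ℝ) (x : EuclideanSpace ℝ (Fin n)) : ℝ :=
  ∑ i, ξ i * x i

lemma contDiff_linPhase {n : ℕ} (ξ : Fin n → ℝ) : ContDiff ℝ ∞ (linPhase ξ) := by
  unfold linPhase
  fun_prop

lemma pd_linPhase {n : ℕ} (ξ : Fin n → ℝ) (k : Fin n) (x : EuclideanSpace ℝ (Fin n)) :
    pd k (linPhase ξ) x = ξ k := by
  have h1 := hasDerivAt_line ((contDiff_linPhase ξ).differentiable (by simp) x) k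
  have h2 : HasDerivAt (fun r : ℝ => linPhase ξ (x + r • EuclideanSpace.single k (1 : ℝ)))
      (ξ k) 0 := by
    have e : ∀ r : ℝ, linPhase ξ (x + r • EuclideanSpace.single k (1 : ℝ))
        = linPhase ξ x + r * ξ k := by
      intro r
      simp only [linPhase, PiLp.add_apply, PiLp.smul_apply, mul_add, Finset.sum_add_distrib]
      simp [mul_comm]
    simp only [e]
    simpa using ((hasDerivAt_id (0 : ℝ)).mul_const (ξ k)).const_add (linPhase ξ x)
  exact h1.unique h2

/-- For a linear phase `∇θ = ξ` is constant. The density occurs on both sides of the eikonal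
equation and cancels, leaving `p² = ξ · G⁻¹ξ`. Ellipticity keeps this positive, so its root is
smooth and bounded below. -/
lemma exists_isEikonal {n : ℕ} {G : EuclideanSpace ℝ (Fin n) → Matrix (Fin n) (Fin n) ℝ} {l : ℝ}
    (hG : ∀ i j, ContDiff ℝ ∞ (fun x => G x i j)) (hl : ∀ x, IsEllipticMatrix l (G x))
    {ξ : Fin n → ℝ} (hξ : ξ ≠ 0) :
    ∃ m, IsEikonal (coeffMatrix G) (density G) (covLength G ξ) (linPhase ξ) m := by
  have hl0 : 0 < l := (hl 0).pos
  have hξ0 : 0 < ξ ⬝ᵥ ξ := by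
    have h2 : 0 ≤ ξ ⬝ᵥ ξ := by
      simp only [dotProduct]; exact Finset.sum_nonneg fun i _ => mul_self_nonneg _
    exact lt_of_le_of_ne h2 fun h3 => hξ (dotProduct_self_eq_zero.1 h3.symm)
  have hinv : ∀ i j, ContDiff ℝ ∞ (fun x => (G x)⁻¹ i j) := fun i j => contDiffOn_univ.1
    (contDiffOn_inv_apply (fun i j => (hG i j).contDiffOn) (fun x _ => (hl x).det_pos.ne') i j)
  have hdet : ContDiff ℝ ∞ (fun x => (G x).det) := contDiffOn_univ.1
    (contDiffOn_det (fun i j => (hG i j).contDiffOn))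
  have hs : ContDiff ℝ ∞ (density G) := hdet.sqrt fun x => (hl x).det_pos.ne'
  have hq : ∀ x, 0 < ξ ⬝ᵥ ((G x)⁻¹ *ᵥ ξ) := fun x =>
    (mul_pos hl0 hξ0).trans_le ((hl x).inv_lower ξ)
  have hqs : ContDiff ℝ ∞ (fun x => ξ ⬝ᵥ ((G x)⁻¹ *ᵥ ξ)) := by
    simp only [dotProduct, Matrix.mulVec]
    exact ContDiff.sum fun i _ => contDiff_const.mul
      (ContDiff.sum fun j _ => (hinv i j).mul contDiff_const)
  refine ⟨√(l * (ξ ⬝ᵥ ξ)) / 2, ?_⟩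
  constructor
  · intro i j
    exact hs.mul (hinv i j)
  · intro x
    exact (hl x).inv_symm.smul _
  · exact hs
  · exact fun x => Real.sqrt_pos.2 (hl x).det_pos
  · exact hqs.sqrt fun x => (hq x).ne'
  · exact div_pos (Real.sqrt_pos.2 (mul_pos hl0 hξ0)) two_pos
  · intro x
    rw [mul_div_cancel₀ _ two_ne_zero]
    exact Real.sqrt_le_sqrt ((hl x).inv_lower ξ)
  · exact contDiff_linPhase ξ
  · intro x
    rw [covLength, Real.sq_sqrt (hq x).le]
    simp only [pairGrad, aGrad, pd_linPhase, coeffMatrix, Matrix.smul_apply, smul_eq_mul, dotProduct,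
      Matrix.mulVec, Finset.mul_sum, Finset.sum_mul]
    exact Finset.sum_congr rfl fun i _ => Finset.sum_congr rfl fun j _ => by ring

/-- The length of covectors determines the metric. -/
lemma eq_of_inv_quadratic_eq {n : ℕ} {l l' : ℝ} {A B : Matrix (Fin n) (Fin n) ℝ}
    (hA : IsEllipticMatrix l A) (hB : IsEllipticMatrix l' B)
    (h : ∀ ξ : Fin n → ℝ, ξ ⬝ᵥ (A⁻¹ *ᵥ ξ) = ξ ⬝ᵥ (B⁻¹ *ᵥ ξ)) : A = B := by
  have h1 : A⁻¹ = B⁻¹ := by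
    ext i j
    have e : ∀ (M : Matrix (Fin n) (Fin n) ℝ) (i j : Fin n),
        Pi.single i (1 : ℝ) ⬝ᵥ (M *ᵥ Pi.single j 1) = M i j := fun M i j => by simp
    -- Polarization recovers the entries of the symmetric inverse matrices from their quadratic
    -- forms.
    have h2 := h (Pi.single i 1 + Pi.single j 1)
    have h3 := h (Pi.single i 1)
    have h4 := h (Pi.single j 1)
    simp only [Matrix.mulVec_add, dotProduct_add, add_dotProduct, e] at h2 h3 h4
    have h5 := hA.inv_symm.apply i j
    have h6 := hB.inv_symm.apply i j
    linarith
  have hA' := Matrix.nonsing_inv_nonsing_inv A (isUnit_iff_ne_zero.2 hA.det_pos.ne')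
  have hB' := Matrix.nonsing_inv_nonsing_inv B (isUnit_iff_ne_zero.2 hB.det_pos.ne')
  rw [← hA', ← hB', h1]


/-! ### Distance between the solution and the asymptotic solution -/

/-- The oscillating Neumann datum `t α(x) cos(t θ(x) + τ)`. -/
noncomputable def oscDatum {n : ℕ} (θ α : EuclideanSpace ℝ (Fin n) → ℝ) (t τ : ℝ)
    (x : EuclideanSpace ℝ (Fin n)) : ℝ := t * α x * Real.cos (t * θ x + τ)

lemma isTestFunction_oscDatum {n : ℕ} {K Γ : Set (EuclideanSpace ℝ (Fin n))} (hK : IsCompact K)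
    (hKΓ : K ⊆ Γ) {θ α : EuclideanSpace ℝ (Fin n) → ℝ} (hθ : ContDiff ℝ ∞ θ)
    (hα : IsAmplitude K α) (t τ : ℝ) : IsTestFunction Γ (oscDatum θ α t τ) := by
  have h : Function.support (oscDatum θ α t τ) ⊆ K := by
    intro x hx
    by_contra h
    exact hx (by simp [oscDatum, hα.eq_zero x h])
  refine ⟨?_, HasCompactSupport.of_support_subset_isCompact hK h,
    (closure_minimal h hK.isClosed).trans hKΓ⟩
  have := hα.contDiff
  unfold oscDatum
  fun_prop

/-- The residual of the asymptotic solution. -/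
noncomputable def residual {n : ℕ} (a : EuclideanSpace ℝ (Fin n) → Matrix (Fin n) (Fin n) ℝ)
    (s V p θ α : EuclideanSpace ℝ (Fin n) → ℝ) (χ : ℝ → ℝ) (t τ : ℝ) (z : Space n) : ℝ :=
  ellOp a s (wkb a s p θ α χ t τ) z + (V z.1 * s z.1) * wkb a s p θ α χ t τ z

/-- A metric and a potential on `Ω`, together with global coefficients that agree with those of the
metric on a compact set `K`, and the data of an asymptotic solution supported over `K`. -/
structure WKBData {n : ℕ} (Ω K : Set (EuclideanSpace ℝ (Fin n)))
    (g : EuclideanSpace ℝ (Fin n) → Matrix (Fin n) (Fin n) ℝ) (V : EuclideanSpace ℝ (Fin n) → ℝ)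
    (a : EuclideanSpace ℝ (Fin n) → Matrix (Fin n) (Fin n) ℝ)
    (s p θ : EuclideanSpace ℝ (Fin n) → ℝ) (m : ℝ) (α : EuclideanSpace ℝ (Fin n) → ℝ) (χ : ℝ → ℝ) :
    Prop where
  isOpen : IsOpen Ω
  isBounded : Bornology.IsBounded Ω
  metric : IsEllipticMetric Ω g
  potential : IsPotential Ω V
  isCompact : IsCompact K
  subset : K ⊆ Ω
  eikonal : IsEikonal a s p θ m
  matrix_eq : ∀ x ∈ K, ∀ i j, (g x)⁻¹ i j * √((g x).det) = a x i j
  density_eq : ∀ x ∈ K, √((g x).det) = s x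
  amplitude : IsAmplitude K α
  cutoff : IsCutoff χ

namespace WKBData

variable {n : ℕ} {Ω K : Set (EuclideanSpace ℝ (Fin n))}
  {g : EuclideanSpace ℝ (Fin n) → Matrix (Fin n) (Fin n) ℝ} {V : EuclideanSpace ℝ (Fin n) → ℝ}
  {a : EuclideanSpace ℝ (Fin n) → Matrix (Fin n) (Fin n) ℝ}
  {s p θ : EuclideanSpace ℝ (Fin n) → ℝ} {m : ℝ} {α : EuclideanSpace ℝ (Fin n) → ℝ} {χ : ℝ → ℝ}

/-- The energy form of the metric and the potential. -/
noncomputable abbrev form (D : WKBData Ω K g V a s p θ m α χ) :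
    Lp (Jet n) 2 (volume.restrict (cyl Ω)) →L[ℝ] Lp (Jet n) 2 (volume.restrict (cyl Ω)) →L[ℝ] ℝ :=
  lpForm (D.metric.isBddForm D.isOpen D.isBounded D.potential)

lemma contDiff_wkb (D : WKBData Ω K g V a s p θ m α χ) (t τ : ℝ) :
    ContDiff ℝ ∞ (wkb a s p θ α χ t τ) :=
  D.eikonal.contDiff_wkb D.isCompact.isClosed D.amplitude D.cutoff t τ

lemma isDecaying_wkb (D : WKBData Ω K g V a s p θ m α χ) : IsDecaying K m (wkb a s p θ α χ) :=
  D.eikonal.isDecaying_wkb D.isCompact D.amplitude D.cutoff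

lemma isC1Bottom (D : WKBData Ω K g V a s p θ m α χ) (t τ : ℝ) :
    IsC1Bottom Ω (wkb a s p θ α χ t τ) :=
  isC1Bottom_of_eq_zero D.isCompact D.subset (D.contDiff_wkb t τ)
    (fun z hz => D.isDecaying_wkb.eq_zero t τ z hz) (fun _ hz => wkb_eq_zero_of_le D.cutoff t τ hz)

/-- The asymptotic solution as an element of the energy space. -/
noncomputable def approx (D : WKBData Ω K g V a s p θ m α χ) (t τ : ℝ) : EnergySpace Ω :=
  (D.isC1Bottom t τ).toEnergy

lemma approx_mem (D : WKBData Ω K g V a s p θ m α χ) (t τ : ℝ) : D.approx t τ ∈ energyDomain Ω :=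
  (D.isC1Bottom t τ).toEnergy_mem

lemma exists_bound_mul (D : WKBData Ω K g V a s p θ m α χ) {W : EuclideanSpace ℝ (Fin n) → ℝ}
    (hW : ContinuousOn W (closure Ω)) : ∃ M, ∀ x ∈ K, |W x * s x| ≤ M := by
  obtain ⟨M, -, hM⟩ := exists_bound_of_continuousOn_closure D.isBounded
    (hW.mul D.eikonal.contDiff_s.continuous.continuousOn)
  exact ⟨M, fun x hx => hM x (subset_closure (D.subset hx))⟩

lemma isDecaying_residual (D : WKBData Ω K g V a s p θ m α χ) :
    IsDecaying K m (residual a s V p θ α χ) := by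
  obtain ⟨M, hM⟩ := D.exists_bound_mul D.potential.smooth.continuousOn
  exact (D.eikonal.isDecaying_ellOp_wkb D.isCompact D.amplitude D.cutoff).add
    (D.isDecaying_wkb.bounded_mul hM)

/-- The asymptotic solution satisfies the weak equation with exactly the prescribed datum, up to the
residual paired with the value of the test element. -/
lemma form_approx (D : WKBData Ω K g V a s p θ m α χ) {t : ℝ} (ht : t ≠ 0) (τ : ℝ)
    {v : EnergySpace Ω} (hv : v ∈ energyDomain Ω) :
    D.form (D.approx t τ).fst v.fst = (∫ x in Ω, oscDatum θ α t τ x * √((g x).det) * v.snd x)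
      + ∫ z in cyl Ω, residual a s V p θ α χ t τ z * (v.fst z).fst := by
  have h := D.metric.lpForm_toEnergy D.isOpen D.isBounded D.potential D.eikonal.contDiff_a
    D.eikonal.symm D.eikonal.contDiff_s D.matrix_eq D.density_eq D.isCompact (D.isC1Bottom t τ)
    (D.contDiff_wkb t τ) (fun z hz => D.isDecaying_wkb.eq_zero t τ z hz) v hv
  refine h.trans ?_
  congr 1
  refine integral_congr_ae (Eventually.of_forall fun x => ?_)
  simp only [D.eikonal.derivY_wkb D.isCompact.isClosed D.amplitude D.cutoff ht, neg_neg]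
  by_cases hx : x ∈ K
  · rw [D.density_eq x hx, oscDatum]; ring
  · simp [oscDatum, D.amplitude.eq_zero x hx]

lemma volume_ne_top (D : WKBData Ω K g V a s p θ m α χ) : volume K ≠ ⊤ :=
  D.isCompact.measure_lt_top.ne

/-- Pairing of a decaying family with an element of the energy space. -/
lemma abs_integral_mul_fst_le (D : WKBData Ω K g V a s p θ m α χ) {R : ℝ → ℝ → Space n → ℝ}
    (hR : IsDecaying K m R) : ∃ C, 0 ≤ C ∧ ∀ t τ r, 1 ≤ t → 0 < r →
      ∀ v : Lp (Jet n) 2 (volume.restrict (cyl Ω)),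
      |∫ z in cyl Ω, R t τ z * (v z).fst| ≤
        C * (r * (∫ z in cyl K, Real.exp (-(m * t * z.2)) * (v z).fst ^ 2) + 1 / (r * t)) := by
  obtain ⟨C, hC0, hC⟩ := hR.bound
  have hm := D.eikonal.m_pos
  refine ⟨C * (1 + volume.real K / m), by positivity, fun t τ r ht hr v => ?_⟩
  have ht0 : 0 < t := zero_lt_one.trans_le ht
  refine (NDMap.abs_integral_mul_fst_le D.isOpen.measurableSet D.isCompact.measurableSet D.subset
    D.volume_ne_top (mul_pos hm ht0) hC0 hr (fun z hz => hC t τ z ht hz)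
    (fun z hz => hR.eq_zero t τ z hz) v).trans ?_
  have h1 : 0 ≤ ∫ z in cyl K, Real.exp (-(m * t * z.2)) * (v z).fst ^ 2 :=
    integral_nonneg fun z => by positivity
  rw [mul_assoc]
  refine mul_le_mul_of_nonneg_left ?_ hC0
  have h2 : volume.real K / (r * (m * t)) = volume.real K / m * (1 / (r * t)) := by
    field_simp
  rw [h2, add_mul, one_mul, mul_add (volume.real K / m)]
  have h3 : 0 ≤ volume.real K / m * (r * ∫ z in cyl K, Real.exp (-(m * t * z.2)) * (v z).fst ^ 2) := by
    positivity
  have h4 : 0 ≤ 1 / (r * t) := by positivity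
  linarith

/-- A crude bound without any gain in `t`, the weight being at most `1`. It suffices for a first
estimate of the error. -/
lemma integral_weight_mul_sq_le (D : WKBData Ω K g V a s p θ m α χ) {t : ℝ} (ht : 0 ≤ t)
    (v : EnergySpace Ω) :
    ∫ z in cyl K, Real.exp (-(m * t * z.2)) * (v.fst z).fst ^ 2 ≤ ‖v‖ ^ 2 := by
  have hm := D.eikonal.m_pos
  have i1 : Integrable (fun z => ‖v.fst z‖ ^ 2) (volume.restrict (cyl Ω)) :=
    (Lp.memLp v.fst).norm.integrable_sq
  have hcK : cyl K ⊆ cyl Ω := Set.prod_mono_left D.subset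
  calc _ ≤ ∫ z in cyl K, ‖v.fst z‖ ^ 2 := by
        refine integral_mono_of_nonneg (Eventually.of_forall fun z => by positivity)
          (i1.mono_measure (Measure.restrict_mono_set _ hcK)) ?_
        refine (ae_restrict_iff' (measurableSet_cyl D.isCompact.measurableSet)).2
          (Eventually.of_forall fun z hz => ?_)
        have hz2 : 0 < z.2 := hz.2
        have h1 : Real.exp (-(m * t * z.2)) ≤ 1 := Real.exp_le_one_iff.2 (by
          have : 0 ≤ m * t * z.2 := by positivity
          linarith)
        refine (mul_le_of_le_one_left (sq_nonneg _) h1).trans ?_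
        rw [← sq_abs]
        exact pow_le_pow_left₀ (abs_nonneg _) (Jet.abs_fst_le _) 2
    _ ≤ ∫ z in cyl Ω, ‖v.fst z‖ ^ 2 :=
        setIntegral_mono_set i1 (Eventually.of_forall fun z => by positivity)
          (LE.le.eventuallyLE hcK)
    _ ≤ ‖v‖ ^ 2 := by
        rw [norm_sq_energySpace]
        exact le_add_of_nonneg_right (integral_nonneg fun x => sq_nonneg _)

/-- The asymptotic solution is close to the solution. -/
lemma exists_error_le (D : WKBData Ω K g V a s p θ m α χ) (i : Fin n) :
    ∃ C, 0 ≤ C ∧ ∀ t τ, 1 ≤ t → ∀ x ∈ energyDomain Ω, (∀ v ∈ energyDomain Ω, D.form x.fst v.fst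
      = ∫ y in Ω, oscDatum θ α t τ y * √((g y).det) * v.snd y) →
      ‖x - D.approx t τ‖ ^ 2 ≤ C / t := by
  obtain ⟨c, hc0, hc⟩ := D.metric.coercive i D.isOpen D.isBounded D.potential
  obtain ⟨C, hC0, hC⟩ := D.abs_integral_mul_fst_le D.isDecaying_residual
  -- With this `r` the quadratic part of the residual pairing is at most half of the coercivity
  -- bound and can be absorbed. The `+ 1` keeps the denominator positive when `C = 0`.
  set r := c / (2 * (C + 1)) with hr
  have hr0 : 0 < r := by positivity
  refine ⟨2 * (C / r) / c, by positivity, fun t τ ht x hx h => ?_⟩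
  have ht0 : 0 < t := zero_lt_one.trans_le ht
  set e := x - D.approx t τ with he
  have hem : e ∈ energyDomain Ω := Submodule.sub_mem _ hx (D.approx_mem t τ)
  have h1 := hc e hem
  -- The data cancel in the equation for the error, and only the residual remains.
  have h2 : D.form e.fst e.fst = - ∫ z in cyl Ω, residual a s V p θ α χ t τ z * (e.fst z).fst := by
    have h3 : e.fst = x.fst - (D.approx t τ).fst := rfl
    have h4 : D.form e.fst e.fst = D.form x.fst e.fst - D.form (D.approx t τ).fst e.fst := by
      conv_lhs => rw [show D.form e.fst = D.form x.fst - D.form (D.approx t τ).fst by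
        rw [← map_sub, ← h3]]
      rfl
    rw [h4, h e hem, D.form_approx ht0.ne' τ hem]; ring
  rw [show lpForm (D.metric.isBddForm D.isOpen D.isBounded D.potential) = D.form from rfl, h2] at h1
  have h5 := (neg_le_abs _).trans (hC t τ r ht hr0 e.fst)
  have h6 := mul_le_mul_of_nonneg_left (D.integral_weight_mul_sq_le ht0.le e)
    (mul_nonneg hC0 hr0.le)
  have h7 : C * r ≤ c / 2 := by
    rw [hr, mul_div_assoc', div_le_div_iff₀ (by positivity) two_pos]; nlinarith
  have h8 := mul_le_mul_of_nonneg_right h7 (sq_nonneg ‖e‖)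
  rw [div_div, le_div_iff₀ (by positivity)]
  have h9 : c / 2 * ‖e‖ ^ 2 ≤ C * (1 / (r * t)) := by nlinarith
  have h10 : C * (1 / (r * t)) * t = C / r := by field_simp
  nlinarith [mul_le_mul_of_nonneg_right h9 ht0.le]

end WKBData


/-! ### Determination of the metric -/

lemma SamePartialND.symm {n : ℕ} {Ω Γ : Set (EuclideanSpace ℝ (Fin n))}
    {g₁ g₂ : EuclideanSpace ℝ (Fin n) → Matrix (Fin n) (Fin n) ℝ}
    {V₁ V₂ : EuclideanSpace ℝ (Fin n) → ℝ} (h : SamePartialND Ω Γ g₁ V₁ g₂ V₂) :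
    SamePartialND Ω Γ g₂ V₂ g₁ V₁ := fun f hf w₁ w₂ h₁ h₂ => (h f hf w₂ w₁ h₂ h₁).symm

lemma norm_sub_sq_le {X : Type*} [SeminormedAddCommGroup X] (x y : X) :
    ‖x - y‖ ^ 2 ≤ 2 * ‖x‖ ^ 2 + 2 * ‖y‖ ^ 2 := by
  have h := norm_sub_le x y
  nlinarith [sq_nonneg (‖x‖ - ‖y‖), norm_nonneg (x - y), norm_nonneg x, norm_nonneg y]

lemma integral_snd_sq_le {n : ℕ} {Ω : Set (EuclideanSpace ℝ (Fin n))} (v : EnergySpace Ω) :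
    ∫ x in Ω, v.snd x ^ 2 ≤ ‖v‖ ^ 2 := by
  rw [norm_sq_energySpace]
  exact le_add_of_nonneg_left (integral_nonneg fun x => sq_nonneg _)

lemma integrable_snd_sq {n : ℕ} {Ω : Set (EuclideanSpace ℝ (Fin n))} (v : EnergySpace Ω) :
    Integrable (fun x => v.snd x ^ 2) (volume.restrict Ω) := (Lp.memLp v.snd).integrable_sq

namespace WKBData

variable {n : ℕ} {Ω K Γ : Set (EuclideanSpace ℝ (Fin n))}
  {g g₁ g₂ : EuclideanSpace ℝ (Fin n) → Matrix (Fin n) (Fin n) ℝ}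
  {V V₁ V₂ : EuclideanSpace ℝ (Fin n) → ℝ}
  {a a₁ a₂ : EuclideanSpace ℝ (Fin n) → Matrix (Fin n) (Fin n) ℝ}
  {s p s₁ p₁ s₂ p₂ θ : EuclideanSpace ℝ (Fin n) → ℝ} {m m₁ m₂ : ℝ}
  {α : EuclideanSpace ℝ (Fin n) → ℝ} {χ : ℝ → ℝ}

/-- The trace of the solution is close to the leading term of the asymptotic solution. -/
lemma exists_trace_error_le (D : WKBData Ω K g V a s p θ m α χ) (i : Fin n) :
    ∃ C, 0 ≤ C ∧ ∀ t τ, 1 ≤ t → ∀ x ∈ energyDomain Ω, (∀ v ∈ energyDomain Ω, D.form x.fst v.fst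
      = ∫ y in Ω, oscDatum θ α t τ y * √((g y).det) * v.snd y) →
      Integrable (fun y => (x.snd y - α y / p y * Real.cos (t * θ y + τ)) ^ 2) (volume.restrict Ω) ∧
      ∫ y in Ω, (x.snd y - α y / p y * Real.cos (t * θ y + τ)) ^ 2 ≤ C / t := by
  obtain ⟨C, hC0, hC⟩ := D.exists_error_le i
  obtain ⟨C', hC0', hC'⟩ := D.eikonal.abs_wkb_sub_le D.isCompact D.amplitude D.cutoff
  refine ⟨2 * C + 2 * (C' ^ 2 * volume.real K), by positivity, fun t τ ht x hx h => ?_⟩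
  have ht0 : 0 < t := zero_lt_one.trans_le ht
  have hA := D.eikonal.isAmplitude_div_p D.amplitude
  have hB : Continuous (fun y => α y / p y * Real.cos (t * θ y + τ)) := by
    have h1 := hA.contDiff.continuous
    have h2 := D.eikonal.contDiff_θ.continuous
    fun_prop
  have hBc : HasCompactSupport (fun y => α y / p y * Real.cos (t * θ y + τ)) :=
    HasCompactSupport.intro D.isCompact fun y hy => by rw [hA.eq_zero y hy, zero_mul]
  have hi : Integrable (fun y => (x.snd y - α y / p y * Real.cos (t * θ y + τ)) ^ 2)
      (volume.restrict Ω) :=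
    ((Lp.memLp x.snd).sub ((hB.memLp_of_hasCompactSupport hBc).restrict Ω)).integrable_sq
  refine ⟨hi, ?_⟩
  set e := x - D.approx t τ with he
  have he1 : (e.snd : EuclideanSpace ℝ (Fin n) → ℝ) =ᵐ[volume.restrict Ω]
      fun y => x.snd y - wkb a s p θ α χ t τ (y, 0) := by
    have h1 : e.snd = x.snd - (D.approx t τ).snd := rfl
    rw [h1]
    filter_upwards [Lp.coeFn_sub x.snd (D.approx t τ).snd, (D.isC1Bottom t τ).toEnergy_snd]
      with y h2 h3
    rw [h2, Pi.sub_apply]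
    exact congrArg (x.snd y - ·) h3
  -- The ansatz and its leading term differ at the bottom by at most `C'/t`, and only over `K`,
  -- which has finite volume. The squared `L²` difference is thus `O(t⁻²)`, smaller than the error
  -- of the solution.
  have hk : Integrable (K.indicator fun _ => (C' / t) ^ 2) (volume.restrict Ω) :=
    ((integrableOn_const D.volume_ne_top).integrable_indicator
      D.isCompact.measurableSet).restrict
  have hk' : ∫ y in Ω, K.indicator (fun _ => (C' / t) ^ 2) y = volume.real K * (C' / t) ^ 2 := by
    rw [integral_indicator D.isCompact.measurableSet, Measure.restrict_restrict_of_subset D.subset,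
      setIntegral_const, smul_eq_mul]
  have hle : ∫ y in Ω, (x.snd y - α y / p y * Real.cos (t * θ y + τ)) ^ 2
      ≤ ∫ y in Ω, (2 * e.snd y ^ 2 + 2 * K.indicator (fun _ => (C' / t) ^ 2) y) := by
    refine integral_mono_ae hi (((integrable_snd_sq e).const_mul 2).add (hk.const_mul 2)) ?_
    filter_upwards [he1] with y hy
    simp only [hy]
    have h1 : (wkb a s p θ α χ t τ (y, 0) - α y / p y * Real.cos (t * θ y + τ)) ^ 2
        ≤ K.indicator (fun _ => (C' / t) ^ 2) y := by
      by_cases hyK : y ∈ K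
      · rw [indicator_of_mem hyK, ← sq_abs]
        exact pow_le_pow_left₀ (abs_nonneg _) (hC' t τ y ht0) 2
      · rw [indicator_of_notMem hyK, hA.eq_zero y hyK, D.isDecaying_wkb.eq_zero t τ (y, 0) hyK]
        simp
    nlinarith [sq_nonneg ((x.snd y - wkb a s p θ α χ t τ (y, 0))
      - (wkb a s p θ α χ t τ (y, 0) - α y / p y * Real.cos (t * θ y + τ)))]
  rw [integral_add ((integrable_snd_sq e).const_mul 2) (hk.const_mul 2), integral_const_mul,
    integral_const_mul, hk'] at hle
  have h1 := (integral_snd_sq_le e).trans (hC t τ ht x hx h)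
  have h2 : volume.real K * (C' / t) ^ 2 ≤ C' ^ 2 * volume.real K / t := by
    rw [div_pow, mul_div_assoc', mul_comm (volume.real K)]
    exact div_le_div_of_nonneg_left (by positivity) ht0 (by nlinarith)
  refine hle.trans ?_
  rw [add_div, mul_div_assoc, mul_div_assoc 2 (C' ^ 2 * _)]
  linarith

/-- Solutions for two metrics and potentials with the same partial Neumann-to-Dirichlet maps. -/
lemma exists_solutions (i : Fin n) (D₁ : WKBData Ω K g₁ V₁ a₁ s₁ p₁ θ m₁ α χ)
    (D₂ : WKBData Ω K g₂ V₂ a₂ s₂ p₂ θ m₂ α χ) (hKΓ : K ⊆ Γ)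
    (hND : SamePartialND Ω Γ g₁ V₁ g₂ V₂) (t τ : ℝ) :
    ∃ x₁ ∈ energyDomain Ω, ∃ x₂ ∈ energyDomain Ω, (∀ v ∈ energyDomain Ω, D₁.form x₁.fst v.fst
      = ∫ y in Ω, oscDatum θ α t τ y * √((g₁ y).det) * v.snd y) ∧
      (∀ v ∈ energyDomain Ω, D₂.form x₂.fst v.fst
      = ∫ y in Ω, oscDatum θ α t τ y * √((g₂ y).det) * v.snd y) ∧
      x₁.snd =ᵐ[volume.restrict Γ] x₂.snd := by
  have hf := isTestFunction_oscDatum D₁.isCompact hKΓ D₁.eikonal.contDiff_θ D₁.amplitude t τ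
  obtain ⟨x₁, hx₁, h₁, h₁'⟩ := D₁.metric.exists_isNDImage i D₁.isOpen D₁.isBounded D₁.potential hf
  obtain ⟨x₂, hx₂, h₂, h₂'⟩ := D₂.metric.exists_isNDImage i D₂.isOpen D₂.isBounded D₂.potential hf
  exact ⟨x₁, hx₁, x₂, hx₂, h₁, h₂, hND _ hf _ _ h₁' h₂'⟩

/-- The leading terms of the asymptotic solutions for two metrics with the same partial
Neumann-to-Dirichlet maps are close. -/
lemma exists_integral_leading_sub_le (i : Fin n) (D₁ : WKBData Ω K g₁ V₁ a₁ s₁ p₁ θ m₁ α χ)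
    (D₂ : WKBData Ω K g₂ V₂ a₂ s₂ p₂ θ m₂ α χ) (hKΓ : K ⊆ Γ)
    (hND : SamePartialND Ω Γ g₁ V₁ g₂ V₂) :
    ∃ C, 0 ≤ C ∧ ∀ t τ, 1 ≤ t →
      ∫ y in K, ((α y / p₁ y - α y / p₂ y) * Real.cos (t * θ y + τ)) ^ 2 ≤ C / t := by
  obtain ⟨C₁, hC₁0, hC₁⟩ := D₁.exists_trace_error_le i
  obtain ⟨C₂, hC₂0, hC₂⟩ := D₂.exists_trace_error_le i
  refine ⟨2 * (C₁ + C₂), by positivity, fun t τ ht => ?_⟩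
  obtain ⟨x₁, hx₁, x₂, hx₂, h₁, h₂, h⟩ := exists_solutions i D₁ D₂ hKΓ hND t τ
  obtain ⟨i₁, e₁⟩ := hC₁ t τ ht x₁ hx₁ h₁
  obtain ⟨i₂, e₂⟩ := hC₂ t τ ht x₂ hx₂ h₂
  have hKΩ : K ⊆ Ω := D₁.subset
  have j₁ := i₁.mono_measure (Measure.restrict_mono_set volume hKΩ)
  have j₂ := i₂.mono_measure (Measure.restrict_mono_set volume hKΩ)
  have k₁ := setIntegral_mono_set i₁ (Eventually.of_forall fun z => sq_nonneg _)
    (LE.le.eventuallyLE hKΩ)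
  have k₂ := setIntegral_mono_set i₂ (Eventually.of_forall fun z => sq_nonneg _)
    (LE.le.eventuallyLE hKΩ)
  -- Used with `w` the common trace of the two solutions: both leading terms are close to it, hence
  -- to each other.
  have hsq : ∀ w b c : ℝ, (b - c) ^ 2 ≤ 2 * (w - b) ^ 2 + 2 * (w - c) ^ 2 := fun w b c => by
    nlinarith [sq_nonneg ((w - b) + (w - c))]
  calc _ ≤ ∫ y in K, (2 * (x₁.snd y - α y / p₁ y * Real.cos (t * θ y + τ)) ^ 2
        + 2 * (x₂.snd y - α y / p₂ y * Real.cos (t * θ y + τ)) ^ 2) := by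
        refine integral_mono_of_nonneg (Eventually.of_forall fun y => sq_nonneg _)
          ((j₁.const_mul 2).add (j₂.const_mul 2)) ?_
        filter_upwards [ae_restrict_of_ae_restrict_of_subset hKΓ h] with y hy
        rw [hy, sub_mul]
        exact hsq _ _ _
    _ = 2 * (∫ y in K, (x₁.snd y - α y / p₁ y * Real.cos (t * θ y + τ)) ^ 2)
        + 2 * ∫ y in K, (x₂.snd y - α y / p₂ y * Real.cos (t * θ y + τ)) ^ 2 := by
        rw [integral_add (j₁.const_mul 2) (j₂.const_mul 2), integral_const_mul,
          integral_const_mul]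
    _ ≤ 2 * (C₁ / t) + 2 * (C₂ / t) := by
        have := k₁.trans e₁
        have := k₂.trans e₂
        linarith
    _ = _ := by ring

/-- A function with compact support whose products with oscillating cosines are small vanishes. -/
lemma eq_zero_of_integral_mul_cos_sq_le {d θ : EuclideanSpace ℝ (Fin n) → ℝ} (hd : Continuous d)
    (hK : IsCompact K) (hd0 : ∀ y, y ∉ K → d y = 0) (hθ : Continuous θ) {C : ℝ}
    (h : ∀ t τ, 1 ≤ t → ∫ y in K, (d y * Real.cos (t * θ y + τ)) ^ 2 ≤ C / t)
    (x₀ : EuclideanSpace ℝ (Fin n)) : d x₀ = 0 := by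
  have hds : HasCompactSupport d := HasCompactSupport.intro hK hd0
  have hle : ∀ t, 1 ≤ t → ∫ y, d y ^ 2 ≤ 2 * C / t := by
    intro t ht
    have hci : ∀ τ, Integrable (fun y => (d y * Real.cos (t * θ y + τ)) ^ 2)
        (volume.restrict K) := fun τ =>
      (((Continuous.memLp_of_hasCompactSupport (by fun_prop) hds.mul_right :
        MemLp (fun y => d y * Real.cos (t * θ y + τ)) 2 volume)).restrict K).integrable_sq
    have e1 : ∫ y, d y ^ 2 = ∫ y in K, d y ^ 2 :=
      (setIntegral_eq_integral_of_forall_compl_eq_zero fun y hy => by rw [hd0 y hy]; simp).symm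
    -- The phases `0` and `π/2` together remove the oscillation, since `cos² + sin² = 1`.
    have e2 : ∫ y in K, d y ^ 2 = (∫ y in K, (d y * Real.cos (t * θ y + 0)) ^ 2)
        + ∫ y in K, (d y * Real.cos (t * θ y + Real.pi / 2)) ^ 2 := by
      rw [← integral_add (hci _) (hci _)]
      refine integral_congr_ae (Eventually.of_forall fun y => ?_)
      simp only [add_zero, Real.cos_add_pi_div_two]
      linear_combination - d y ^ 2 * Real.sin_sq_add_cos_sq (t * θ y)
    rw [e1, e2]
    calc _ ≤ C / t + C / t := add_le_add (h t 0 ht) (h t (Real.pi / 2) ht)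
      _ = _ := by ring
  have h0 : ∫ y, d y ^ 2 ≤ 0 := by
    refine ge_of_tendsto (f := fun t : ℝ => 2 * C / t) (x := atTop)
      (tendsto_const_nhds.div_atTop tendsto_id) ?_
    filter_upwards [eventually_ge_atTop 1] with t ht using hle t ht
  by_contra hne
  have hpos : 0 < ∫ y, d y ^ 2 :=
    Continuous.integral_pos_of_hasCompactSupport_nonneg_nonzero (hd.pow 2)
      (hds.comp_left (g := fun r : ℝ => r ^ 2) (by simp)) (fun y => sq_nonneg _) (x := x₀)
      (pow_ne_zero 2 hne)
  linarith

/-- The decay rates at points of the boundary patch are determined by the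
Neumann-to-Dirichlet map. -/
lemma rate_eq (i : Fin n) (D₁ : WKBData Ω K g₁ V₁ a₁ s₁ p₁ θ m₁ α χ)
    (D₂ : WKBData Ω K g₂ V₂ a₂ s₂ p₂ θ m₂ α χ) (hKΓ : K ⊆ Γ)
    (hND : SamePartialND Ω Γ g₁ V₁ g₂ V₂) {x₀ : EuclideanSpace ℝ (Fin n)} (h₀ : α x₀ ≠ 0) :
    p₁ x₀ = p₂ x₀ := by
  obtain ⟨C, -, hC⟩ := exists_integral_leading_sub_le i D₁ D₂ hKΓ hND
  have hA₁ := D₁.eikonal.isAmplitude_div_p D₁.amplitude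
  have hA₂ := D₂.eikonal.isAmplitude_div_p D₂.amplitude
  have h := eq_zero_of_integral_mul_cos_sq_le (d := fun y => α y / p₁ y - α y / p₂ y)
    (hA₁.contDiff.continuous.sub hA₂.contDiff.continuous) D₁.isCompact
    (fun y hy => by rw [hA₁.eq_zero y hy, hA₂.eq_zero y hy, sub_zero])
    D₁.eikonal.contDiff_θ.continuous hC x₀
  rw [sub_eq_zero, div_eq_div_iff (D₁.eikonal.p_pos x₀).ne' (D₂.eikonal.p_pos x₀).ne'] at h
  exact (mul_left_cancel₀ h₀ h).symm

end WKBData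

lemma exists_bump {n : ℕ} {x₀ : EuclideanSpace ℝ (Fin n)} {N : Set (EuclideanSpace ℝ (Fin n))}
    (hN : N ∈ 𝓝 x₀) : ∃ K α, IsCompact K ∧ K ⊆ N ∧ IsAmplitude K α ∧ α x₀ = 1 := by
  obtain ⟨α, h1, h2, h3, -, h5⟩ := exists_contDiff_tsupport_subset (n := ⊤) hN
  exact ⟨tsupport α, α, h2, h1, ⟨h3, fun x hx => image_eq_zero_of_notMem_tsupport hx⟩, h5⟩

/-- The data of an asymptotic solution exist for each nonzero covector. -/
lemma IsEllipticMetric.exists_wkbData {n : ℕ} {Ω K : Set (EuclideanSpace ℝ (Fin n))}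
    (hΩ : IsOpen Ω) (hb : Bornology.IsBounded Ω)
    {g : EuclideanSpace ℝ (Fin n) → Matrix (Fin n) (Fin n) ℝ} {V : EuclideanSpace ℝ (Fin n) → ℝ}
    (hg : IsEllipticMetric Ω g) (hV : IsPotential Ω V) (hK : IsCompact K) (hKΩ : K ⊆ Ω)
    {α : EuclideanSpace ℝ (Fin n) → ℝ} (hα : IsAmplitude K α) {χ : ℝ → ℝ} (hχ : IsCutoff χ)
    {ξ : Fin n → ℝ} (hξ : ξ ≠ 0) :
    ∃ (G : EuclideanSpace ℝ (Fin n) → Matrix (Fin n) (Fin n) ℝ) (m : ℝ),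
      (∀ x ∈ K, G x = g x) ∧
      WKBData Ω K g V (coeffMatrix G) (density G) (covLength G ξ) (linPhase ξ) m α χ := by
  obtain ⟨G, l, hG, hl, hGg⟩ := hg.exists_extension hΩ hK.isClosed hKΩ
  obtain ⟨m, hm⟩ := exists_isEikonal hG hl hξ
  refine ⟨G, m, hGg, hΩ, hb, hg, hV, hK, hKΩ, hm, fun x hx i j => ?_, fun x hx => ?_, hα, hχ⟩
  · rw [coeffMatrix, density, hGg x hx, Matrix.smul_apply, smul_eq_mul, mul_comm]
  · rw [density, hGg x hx]

/-- The metric is determined on the boundary patch. -/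
lemma metric_eq_of_samePartialND {n : ℕ} (i : Fin n) {Ω Γ : Set (EuclideanSpace ℝ (Fin n))}
    (hΩ : IsOpen Ω) (hb : Bornology.IsBounded Ω) (hΓ : IsOpen Γ) (hΓΩ : Γ ⊆ Ω)
    {g₁ g₂ : EuclideanSpace ℝ (Fin n) → Matrix (Fin n) (Fin n) ℝ}
    {V₁ V₂ : EuclideanSpace ℝ (Fin n) → ℝ}
    (hg₁ : IsEllipticMetric Ω g₁) (hg₂ : IsEllipticMetric Ω g₂)
    (hV₁ : IsPotential Ω V₁) (hV₂ : IsPotential Ω V₂)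
    (hND : SamePartialND Ω Γ g₁ V₁ g₂ V₂) {x₀ : EuclideanSpace ℝ (Fin n)} (hx₀ : x₀ ∈ Γ) :
    g₁ x₀ = g₂ x₀ := by
  obtain ⟨l₁, -, -, hl₁⟩ := hg₁.exists_closure
  obtain ⟨l₂, -, -, hl₂⟩ := hg₂.exists_closure
  have hx : x₀ ∈ closure Ω := subset_closure (hΓΩ hx₀)
  refine eq_of_inv_quadratic_eq (hl₁ x₀ hx) (hl₂ x₀ hx) fun ξ => ?_
  by_cases hξ : ξ = 0
  · simp [hξ]
  obtain ⟨K, α, hK, hKΓ, hα, hα1⟩ := exists_bump (hΓ.mem_nhds hx₀)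
  obtain ⟨χ, hχ⟩ := exists_isCutoff
  obtain ⟨G₁, m₁, hG₁, D₁⟩ := hg₁.exists_wkbData hΩ hb hV₁ hK (hKΓ.trans hΓΩ) hα hχ hξ
  obtain ⟨G₂, m₂, hG₂, D₂⟩ := hg₂.exists_wkbData hΩ hb hV₂ hK (hKΓ.trans hΓΩ) hα hχ hξ
  have hxK : x₀ ∈ K := by
    by_contra h
    rw [hα.eq_zero x₀ h] at hα1
    exact zero_ne_one hα1
  have h := WKBData.rate_eq i D₁ D₂ hKΓ hND (x₀ := x₀) (by rw [hα1]; exact one_ne_zero)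
  have hn : ∀ ξ : Fin n → ℝ, 0 ≤ ξ ⬝ᵥ ξ := fun ξ => by
    simp only [dotProduct]; exact Finset.sum_nonneg fun i _ => mul_self_nonneg _
  rw [covLength, covLength, hG₁ x₀ hxK, hG₂ x₀ hxK, Real.sqrt_inj
    ((mul_nonneg (hl₁ x₀ hx).pos.le (hn ξ)).trans ((hl₁ x₀ hx).inv_lower ξ))
    ((mul_nonneg (hl₂ x₀ hx).pos.le (hn ξ)).trans ((hl₂ x₀ hx).inv_lower ξ))] at h
  exact h


/-! ### Determination of the potential -/

/-- The difference of two potentials times the asymptotic solution. -/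
noncomputable def potentialTerm {n : ℕ} (V₁ V₂ : EuclideanSpace ℝ (Fin n) → ℝ)
    (a : EuclideanSpace ℝ (Fin n) → Matrix (Fin n) (Fin n) ℝ)
    (s p θ α : EuclideanSpace ℝ (Fin n) → ℝ) (χ : ℝ → ℝ) (t τ : ℝ) (z : Space n) : ℝ :=
  ((V₂ z.1 - V₁ z.1) * s z.1) * wkb a s p θ α χ t τ z

lemma residual_eq_add {n : ℕ} (V₁ V₂ : EuclideanSpace ℝ (Fin n) → ℝ)
    (a : EuclideanSpace ℝ (Fin n) → Matrix (Fin n) (Fin n) ℝ)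
    (s p θ α : EuclideanSpace ℝ (Fin n) → ℝ) (χ : ℝ → ℝ) (t τ : ℝ) (z : Space n) :
    residual a s V₂ p θ α χ t τ z
      = residual a s V₁ p θ α χ t τ z + potentialTerm V₁ V₂ a s p θ α χ t τ z := by
  simp only [residual, potentialTerm]; ring

namespace WKBData

variable {n : ℕ} {Ω K Γ : Set (EuclideanSpace ℝ (Fin n))}
  {g g₁ g₂ : EuclideanSpace ℝ (Fin n) → Matrix (Fin n) (Fin n) ℝ}
  {V V₁ V₂ : EuclideanSpace ℝ (Fin n) → ℝ}
  {a : EuclideanSpace ℝ (Fin n) → Matrix (Fin n) (Fin n) ℝ}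
  {s p θ : EuclideanSpace ℝ (Fin n) → ℝ} {m : ℝ} {α : EuclideanSpace ℝ (Fin n) → ℝ} {χ : ℝ → ℝ}

lemma form_symm (D : WKBData Ω K g V a s p θ m α χ)
    (u v : Lp (Jet n) 2 (volume.restrict (cyl Ω))) : D.form u v = D.form v u :=
  lpForm_metricForm_symm D.isOpen D.metric _ u v

lemma memLp_residual (D : WKBData Ω K g V a s p θ m α χ) (t τ : ℝ) :
    MemLp (residual a s V p θ α χ t τ) 2 (volume.restrict (cyl Ω)) :=
  memLp_ellOp_add D.isOpen D.isBounded D.potential D.eikonal.contDiff_a D.eikonal.contDiff_s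
    (D.isC1Bottom t τ) (D.contDiff_wkb t τ)

lemma memLp_wkb (D : WKBData Ω K g V a s p θ m α χ) (t τ : ℝ) :
    MemLp (wkb a s p θ α χ t τ) 2 (volume.restrict (cyl Ω)) :=
  memLp_fst (D.isC1Bottom t τ).memLp_jet

lemma isDecaying_potentialTerm (D₁ : WKBData Ω K g₁ V₁ a s p θ m α χ)
    (D₂ : WKBData Ω K g₂ V₂ a s p θ m α χ) :
    IsDecaying K m (potentialTerm V₁ V₂ a s p θ α χ) := by
  obtain ⟨M, hM⟩ := D₁.exists_bound_mul
    (D₂.potential.smooth.continuousOn.sub D₁.potential.smooth.continuousOn)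
  exact D₁.isDecaying_wkb.bounded_mul hM

lemma integrable_mul_fst {R : Space n → ℝ} (hR : MemLp R 2 (volume.restrict (cyl Ω)))
    (v : Lp (Jet n) 2 (volume.restrict (cyl Ω))) :
    Integrable (fun z => R z * (v z).fst) (volume.restrict (cyl Ω)) :=
  MemLp.integrable_mul (p := 2) (q := 2) hR (memLp_fst (Lp.memLp v))

lemma integral_mul_fst_sub {R : Space n → ℝ} (hR : MemLp R 2 (volume.restrict (cyl Ω)))
    (x y : EnergySpace Ω) :
    ∫ z in cyl Ω, R z * ((x - y).fst z).fst
      = (∫ z in cyl Ω, R z * (x.fst z).fst) - ∫ z in cyl Ω, R z * (y.fst z).fst := by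
  rw [← integral_sub (integrable_mul_fst hR _) (integrable_mul_fst hR _)]
  refine integral_congr_ae ?_
  have h1 : (x - y).fst = x.fst - y.fst := rfl
  rw [h1]
  filter_upwards [Lp.coeFn_sub x.fst y.fst] with z hz
  rw [hz]
  simp only [Pi.sub_apply, WithLp.sub_fst]
  ring

/-- The integral identity relating the residuals for two potentials. -/
lemma integral_residual_mul_sub (D₁ : WKBData Ω K g₁ V₁ a s p θ m α χ)
    (D₂ : WKBData Ω K g₂ V₂ a s p θ m α χ) (hKΓ : K ⊆ Γ) {t τ : ℝ} (ht : t ≠ 0)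
    {x₁ x₂ : EnergySpace Ω} (hx₁ : x₁ ∈ energyDomain Ω) (hx₂ : x₂ ∈ energyDomain Ω)
    (h₁ : ∀ v ∈ energyDomain Ω, D₁.form x₁.fst v.fst
      = ∫ y in Ω, oscDatum θ α t τ y * √((g₁ y).det) * v.snd y)
    (h₂ : ∀ v ∈ energyDomain Ω, D₂.form x₂.fst v.fst
      = ∫ y in Ω, oscDatum θ α t τ y * √((g₂ y).det) * v.snd y)
    (h : x₁.snd =ᵐ[volume.restrict Γ] x₂.snd) :
    ∫ z in cyl Ω, residual a s V₁ p θ α χ t τ z * ((x₁ - x₂).fst z).fst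
      = ∫ z in cyl Ω, potentialTerm V₁ V₂ a s p θ α χ t τ z * (x₂.fst z).fst := by
  have hR₁ := D₁.memLp_residual t τ
  have hR₂ := D₂.memLp_residual t τ
  have hQ : MemLp (potentialTerm V₁ V₂ a s p θ α χ t τ) 2 (volume.restrict (cyl Ω)) := by
    refine (hR₂.sub hR₁).ae_eq (Eventually.of_forall fun z => ?_)
    rw [Pi.sub_apply, residual_eq_add V₁ V₂]; ring
  have hf : ∀ y, oscDatum θ α t τ y * √((g₁ y).det) = oscDatum θ α t τ y * √((g₂ y).det) := by
    intro y
    by_cases hy : y ∈ K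
    · rw [D₁.density_eq y hy, D₂.density_eq y hy]
    · simp [oscDatum, D₁.amplitude.eq_zero y hy]
  have e1 := D₁.form_approx ht τ hx₁
  have e2 := D₂.form_approx ht τ hx₂
  -- By symmetry of the form, the solution can also be tested against the ansatz. This expresses the
  -- same energy pairing through the datum alone, and equating it with the residual identity
  -- eliminates the form.
  rw [D₁.form_symm, h₁ _ (D₁.approx_mem t τ)] at e1
  rw [D₂.form_symm, h₂ _ (D₂.approx_mem t τ)] at e2
  -- The ansatz involves only the shared coefficients, phase, amplitude and cutoff, and neither the
  -- metrics nor the potentials directly.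
  have e3 : D₁.approx t τ = D₂.approx t τ := rfl
  have e4 : ∫ y in Ω, oscDatum θ α t τ y * √((g₂ y).det) * x₁.snd y
      = ∫ y in Ω, oscDatum θ α t τ y * √((g₂ y).det) * x₂.snd y := by
    have h0 : ∀ x : EnergySpace Ω, ∫ y in Ω, oscDatum θ α t τ y * √((g₂ y).det) * x.snd y
        = ∫ y in K, oscDatum θ α t τ y * √((g₂ y).det) * x.snd y := fun x =>
      setIntegral_eq_of_subset_of_forall_sdiff_eq_zero D₁.isOpen.measurableSet D₁.subset
        fun y hy => by simp [oscDatum, D₁.amplitude.eq_zero y hy.2]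
    rw [h0, h0]
    refine integral_congr_ae ?_
    filter_upwards [ae_restrict_of_ae_restrict_of_subset hKΓ h] with y hy
    rw [hy]
  simp only [hf, e4, e3] at e1
  have e5 : ∫ z in cyl Ω, residual a s V₂ p θ α χ t τ z * (x₂.fst z).fst
      = (∫ z in cyl Ω, residual a s V₁ p θ α χ t τ z * (x₂.fst z).fst)
        + ∫ z in cyl Ω, potentialTerm V₁ V₂ a s p θ α χ t τ z * (x₂.fst z).fst := by
    rw [← integral_add (integrable_mul_fst hR₁ _) (integrable_mul_fst hQ _)]
    refine integral_congr_ae (Eventually.of_forall fun z => ?_)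
    simp only [residual_eq_add V₁ V₂]; ring
  rw [integral_mul_fst_sub hR₁]
  linarith

/-- The weighted norm of an element of the energy domain with vanishing trace over `K`. -/
lemma integral_weight_le_of_trace_eq_zero (D : WKBData Ω K g V a s p θ m α χ) {t : ℝ} (ht : 0 < t)
    {v : EnergySpace Ω} (hv : v ∈ energyDomain Ω) (h : ∀ᵐ y ∂(volume.restrict K), v.snd y = 0) :
    ∫ z in cyl K, Real.exp (-(m * t * z.2)) * (v.fst z).fst ^ 2 ≤ 4 / (m * t) ^ 2 * ‖v‖ ^ 2 := by
  refine (energyDomain_weighted_le D.isCompact.measurableSet D.subset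
    (mul_pos D.eikonal.m_pos ht) v hv).trans ?_
  have h0 : ∫ y in K, v.snd y ^ 2 = 0 := by
    refine integral_eq_zero_of_ae ?_
    filter_upwards [h] with y hy
    simp [hy]
  rw [h0, mul_zero, zero_add]

/-- When the trace need not vanish, the boundary term of the Hardy inequality limits the gain to one
power of `1/t`. This is applied to the error of the ansatz. -/
lemma integral_weight_le (D : WKBData Ω K g V a s p θ m α χ) {t : ℝ} (ht : 1 ≤ t)
    {v : EnergySpace Ω} (hv : v ∈ energyDomain Ω) :
    ∫ z in cyl K, Real.exp (-(m * t * z.2)) * (v.fst z).fst ^ 2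
      ≤ (2 / m + 4 / m ^ 2) / t * ‖v‖ ^ 2 := by
  have hm := D.eikonal.m_pos
  have ht0 : 0 < t := zero_lt_one.trans_le ht
  refine (energyDomain_weighted_le D.isCompact.measurableSet D.subset
    (mul_pos hm ht0) v hv).trans ?_
  have h1 : ∫ y in K, v.snd y ^ 2 ≤ ‖v‖ ^ 2 :=
    (setIntegral_mono_set (integrable_snd_sq v) (Eventually.of_forall fun z => sq_nonneg _)
      (LE.le.eventuallyLE D.subset)).trans (integral_snd_sq_le v)
  have h2 : 4 / (m * t) ^ 2 ≤ 4 / m ^ 2 / t := by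
    rw [div_div]
    refine div_le_div_of_nonneg_left (by norm_num) (by positivity) ?_
    rw [mul_pow]
    exact mul_le_mul_of_nonneg_left (by nlinarith) (by positivity)
  have h3 : 2 / (m * t) = 2 / m / t := by rw [div_div]
  rw [add_div, add_mul, h3]
  exact add_le_add (mul_le_mul_of_nonneg_left h1 (by positivity))
    (mul_le_mul_of_nonneg_right h2 (sq_nonneg _))

/-- The potential term paired with the asymptotic solution is small when the partial
Neumann-to-Dirichlet maps agree. -/
lemma exists_integral_potentialTerm_le (i : Fin n) (D₁ : WKBData Ω K g₁ V₁ a s p θ m α χ)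
    (D₂ : WKBData Ω K g₂ V₂ a s p θ m α χ) (hKΓ : K ⊆ Γ)
    (hND : SamePartialND Ω Γ g₁ V₁ g₂ V₂) :
    ∃ C, 0 ≤ C ∧ ∀ t τ, 1 ≤ t → ∫ z in cyl Ω, potentialTerm V₁ V₂ a s p θ α χ t τ z
      * wkb a s p θ α χ t τ z ≤ C / (t * √t) := by
  have hm := D₁.eikonal.m_pos
  obtain ⟨C₁, hC₁0, hC₁⟩ := D₁.exists_error_le i
  obtain ⟨C₂, hC₂0, hC₂⟩ := D₂.exists_error_le i
  obtain ⟨A, hA0, hA⟩ := D₁.abs_integral_mul_fst_le D₁.isDecaying_residual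
  obtain ⟨B, hB0, hB⟩ := D₁.abs_integral_mul_fst_le (D₁.isDecaying_potentialTerm D₂)
  set N := 2 / m + 4 / m ^ 2 with hN
  have hN0 : 0 < N := by positivity
  refine ⟨A * (4 / m ^ 2 * (2 * C₁ + 2 * C₂) + 1) + B * (N * C₂ + 1), by positivity,
    fun t τ ht => ?_⟩
  have ht0 : 0 < t := zero_lt_one.trans_le ht
  have hst : 0 < √t := Real.sqrt_pos.2 ht0
  have hst2 : √t * √t = t := Real.mul_self_sqrt ht0.le
  obtain ⟨x₁, hx₁, x₂, hx₂, h₁, h₂, h⟩ := exists_solutions i D₁ D₂ hKΓ hND t τ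
  have hid := integral_residual_mul_sub D₁ D₂ hKΓ ht0.ne' hx₁ hx₂ h₁ h₂ h
  have n₁ := hC₁ t τ ht x₁ hx₁ h₁
  have n₂ := hC₂ t τ ht x₂ hx₂ h₂
  have hx12 : x₁ - x₂ ∈ energyDomain Ω := Submodule.sub_mem _ hx₁ hx₂
  have n3 : ‖x₁ - x₂‖ ^ 2 ≤ (2 * C₁ + 2 * C₂) / t := by
    have e : x₁ - x₂ = (x₁ - D₁.approx t τ) - (x₂ - D₂.approx t τ) := by
      rw [show D₂.approx t τ = D₁.approx t τ from rfl]; abel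
    rw [e]
    refine (norm_sub_sq_le _ _).trans ?_
    rw [add_div, mul_div_assoc, mul_div_assoc]
    linarith
  have hz : ∀ᵐ y ∂(volume.restrict K), (x₁ - x₂).snd y = 0 := by
    have e : (x₁ - x₂).snd = x₁.snd - x₂.snd := rfl
    rw [e]
    filter_upwards [ae_restrict_of_ae_restrict_of_subset hKΓ h,
      ae_restrict_of_ae_restrict_of_subset D₁.subset (Lp.coeFn_sub x₁.snd x₂.snd)] with y h3 h4
    rw [h4, Pi.sub_apply, h3, sub_self]
  have w1 := D₁.integral_weight_le_of_trace_eq_zero ht0 hx12 hz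
  -- The weighted norm of `x₁ - x₂` is `O(t⁻³)`: two powers from the vanishing trace and one from
  -- the error estimate. The choice `r = t` balances the two terms at `t⁻²`.
  have b1 := hA t τ t ht ht0 (x₁ - x₂).fst
  have hQ : MemLp (potentialTerm V₁ V₂ a s p θ α χ t τ) 2 (volume.restrict (cyl Ω)) := by
    refine ((D₂.memLp_residual t τ).sub (D₁.memLp_residual t τ)).ae_eq
      (Eventually.of_forall fun z => ?_)
    rw [Pi.sub_apply, residual_eq_add V₁ V₂]; ring
  have hem : x₂ - D₂.approx t τ ∈ energyDomain Ω := Submodule.sub_mem _ hx₂ (D₂.approx_mem t τ)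
  have w2 := D₂.integral_weight_le ht hem
  -- Here the weighted norm is only `O(t⁻²)`, so the balance is at `r = √t` and gives `t^{-3/2}`.
  -- This still beats the lower bound of order `t⁻¹`.
  have b2 := hB t τ (√t) ht hst (x₂ - D₂.approx t τ).fst
  rw [hid] at b1
  rw [integral_mul_fst_sub hQ] at b2
  have e6 : ∫ z in cyl Ω, potentialTerm V₁ V₂ a s p θ α χ t τ z * ((D₂.approx t τ).fst z).fst
      = ∫ z in cyl Ω, potentialTerm V₁ V₂ a s p θ α χ t τ z * wkb a s p θ α χ t τ z := by
    refine integral_congr_ae ?_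
    filter_upwards [(D₂.isC1Bottom t τ).toEnergy_fst] with z hz
    exact congrArg (fun j : Jet n => potentialTerm V₁ V₂ a s p θ α χ t τ z * j.fst) hz
  rw [e6] at b2
  have b3 : t * (∫ z in cyl K, Real.exp (-(m * t * z.2)) * ((x₁ - x₂).fst z).fst ^ 2)
      + 1 / (t * t) ≤ (4 / m ^ 2 * (2 * C₁ + 2 * C₂) + 1) / (t * √t) := by
    have h5 : √t ≤ t := by nlinarith [Real.one_le_sqrt.2 ht]
    have h6 : t * (4 / (m * t) ^ 2 * ((2 * C₁ + 2 * C₂) / t))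
        = 4 / m ^ 2 * (2 * C₁ + 2 * C₂) / (t * t) := by field_simp
    have h7 := mul_le_mul_of_nonneg_left
      (w1.trans (mul_le_mul_of_nonneg_left n3 (by positivity))) ht0.le
    calc _ ≤ 4 / m ^ 2 * (2 * C₁ + 2 * C₂) / (t * t) + 1 / (t * t) := by linarith
      _ = (4 / m ^ 2 * (2 * C₁ + 2 * C₂) + 1) / (t * t) := by ring
      _ ≤ _ := div_le_div_of_nonneg_left (by positivity) (by positivity)
          (mul_le_mul_of_nonneg_left h5 ht0.le)
  have b4 : √t * (∫ z in cyl K, Real.exp (-(m * t * z.2))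
      * ((x₂ - D₂.approx t τ).fst z).fst ^ 2) + 1 / (√t * t) ≤ (N * C₂ + 1) / (t * √t) := by
    have h7 := mul_le_mul_of_nonneg_left
      (w2.trans (mul_le_mul_of_nonneg_left n₂ (by positivity))) hst.le
    have h8 : √t * (N / t * (C₂ / t)) = N * C₂ / (t * √t) := by
      rw [eq_div_iff (by positivity)]
      calc _ = (√t * √t) * (N / t * C₂) := by field_simp
        _ = _ := by rw [hst2]; field_simp
    rw [h8] at h7
    rw [add_div, mul_comm (√t) t]
    linarith
  have b5 := mul_le_mul_of_nonneg_left b3 hA0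
  have b6 := mul_le_mul_of_nonneg_left b4 hB0
  have b7 := (le_abs_self _).trans b1
  have b8 := (neg_le_abs _).trans b2
  rw [add_div, mul_div_assoc A, mul_div_assoc B]
  linarith

/-- The potential term paired with the asymptotic solution is large where the potentials differ. -/
lemma exists_le_integral_potentialTerm (D₁ : WKBData Ω K g₁ V₁ a s p θ m α χ)
    (D₂ : WKBData Ω K g₂ V₂ a s p θ m α χ) {δ : ℝ} (hδ : 0 < δ)
    (hV : ∀ x ∈ K, δ ≤ V₂ x - V₁ x) {x₀ : EuclideanSpace ℝ (Fin n)} (h₀ : α x₀ ≠ 0) :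
    ∃ c, 0 < c ∧ ∀ t, 1 ≤ t → c / t ≤
      (∫ z in cyl Ω, potentialTerm V₁ V₂ a s p θ α χ t 0 z * wkb a s p θ α χ t 0 z)
      + ∫ z in cyl Ω, potentialTerm V₁ V₂ a s p θ α χ t (Real.pi / 2) z
        * wkb a s p θ α χ t (Real.pi / 2) z := by
  have hA := D₁.eikonal.isAmplitude_div_p D₁.amplitude
  have hpc := D₁.eikonal.contDiff_p.continuous
  have hsc := D₁.eikonal.contDiff_s.continuous
  -- A lower bound for the summed integrand, independent of `t` and `y`, valid in the layer `0 < y ≤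
  -- 1/t`: there `t p y ≤ p`, and the two phases together dominate the square of the leading
  -- envelope.
  set F : EuclideanSpace ℝ (Fin n) → ℝ := fun x => δ * s x * (α x / p x * Real.exp (-p x)) ^ 2
    with hF
  have hFc : Continuous F := by
    have := hA.contDiff.continuous
    fun_prop
  have hF0 : ∀ x, x ∉ K → F x = 0 := fun x hx => by simp [hF, D₁.amplitude.eq_zero x hx]
  have hFn : ∀ x, 0 ≤ F x := fun x => by
    have := D₁.eikonal.s_pos x
    positivity
  have hFs : HasCompactSupport F := HasCompactSupport.intro D₁.isCompact hF0
  have hpos : 0 < ∫ x, F x := by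
    refine Continuous.integral_pos_of_hasCompactSupport_nonneg_nonzero hFc hFs hFn (x := x₀) ?_
    have := D₁.eikonal.s_pos x₀
    have := D₁.eikonal.p_pos x₀
    have : α x₀ / p x₀ ≠ 0 := div_ne_zero h₀ this.ne'
    positivity
  refine ⟨∫ x, F x, hpos, fun t ht => ?_⟩
  have ht0 : 0 < t := zero_lt_one.trans_le ht
  have hQ : ∀ τ, MemLp (potentialTerm V₁ V₂ a s p θ α χ t τ) 2 (volume.restrict (cyl Ω)) := by
    intro τ
    refine ((D₂.memLp_residual t τ).sub (D₁.memLp_residual t τ)).ae_eq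
      (Eventually.of_forall fun z => ?_)
    rw [Pi.sub_apply, residual_eq_add V₁ V₂]; ring
  have hi : ∀ τ, Integrable (fun z => potentialTerm V₁ V₂ a s p θ α χ t τ z
      * wkb a s p θ α χ t τ z) (volume.restrict (cyl Ω)) := fun τ =>
    MemLp.integrable_mul (p := 2) (q := 2) (hQ τ) (D₁.memLp_wkb t τ)
  rw [← integral_add (hi _) (hi _)]
  have hn : ∀ z : Space n, 0 ≤ potentialTerm V₁ V₂ a s p θ α χ t 0 z * wkb a s p θ α χ t 0 z
      + potentialTerm V₁ V₂ a s p θ α χ t (Real.pi / 2) z * wkb a s p θ α χ t (Real.pi / 2) z := by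
    intro z
    by_cases hz : z.1 ∈ K
    · have h1 : 0 ≤ (V₂ z.1 - V₁ z.1) * s z.1 :=
        mul_nonneg (hδ.le.trans (hV _ hz)) (D₁.eikonal.s_pos _).le
      simp only [potentialTerm, mul_assoc _ (wkb _ _ _ _ _ _ _ _ _)]
      exact add_nonneg (mul_nonneg h1 (mul_self_nonneg _)) (mul_nonneg h1 (mul_self_nonneg _))
    · simp [D₁.isDecaying_wkb.eq_zero t _ z hz]
  -- The integrand is nonnegative, so it may be restricted to the layer. Its height `t⁻¹` is the
  -- source of the factor `1/t`.
  have hsub : K ×ˢ Ioc (0 : ℝ) t⁻¹ ⊆ cyl Ω := Set.prod_mono D₁.subset Ioc_subset_Ioi_self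
  have e1 : (∫ x, F x) / t = ∫ z in K ×ˢ Ioc (0 : ℝ) t⁻¹, F z.1 := by
    have h1 := setIntegral_prod_mul (L := ℝ) (μ := (volume : Measure (EuclideanSpace ℝ (Fin n))))
      (ν := (volume : Measure ℝ)) F (fun _ : ℝ => (1 : ℝ)) K (Ioc (0 : ℝ) t⁻¹)
    have h2 : ∫ x, F x = ∫ x in K, F x :=
      (setIntegral_eq_integral_of_forall_compl_eq_zero hF0).symm
    simp only [mul_one] at h1
    rw [h2]
    refine Eq.trans ?_ h1.symm
    rw [setIntegral_const, Real.volume_real_Ioc_of_le (by positivity)]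
    simp [div_eq_mul_inv]
  rw [e1]
  have hFi : IntegrableOn (fun z : Space n => F z.1) (K ×ˢ Ioc (0 : ℝ) t⁻¹) :=
    ((hFc.comp continuous_fst).continuousOn.integrableOn_compact
      (D₁.isCompact.prod isCompact_Icc)).mono_set (Set.prod_mono_right Ioc_subset_Icc_self)
  refine le_trans (setIntegral_mono_on hFi
    (((hi 0).add (hi (Real.pi / 2))).mono_measure (Measure.restrict_mono_set _ hsub))
    (D₁.isCompact.measurableSet.prod measurableSet_Ioc) ?_)
    (setIntegral_mono_set ((hi 0).add (hi (Real.pi / 2))) (Eventually.of_forall hn)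
      (LE.le.eventuallyLE hsub))
  rintro ⟨x, y⟩ ⟨hx, hy0, hy1⟩
  simp only [] at hx hy0 hy1
  have hy2 : |y| ≤ 1 := by
    rw [abs_of_pos hy0]
    exact hy1.trans (inv_le_one_of_one_le₀ ht)
  have h1 := wkb_sq_add_sq_ge (a := a) (s := s) (p := p) (θ := θ) (α := α) D₁.cutoff t
    (z := (x, y)) hy2
  have hp := D₁.eikonal.p_pos x
  have hs := D₁.eikonal.s_pos x
  have h2 : (α x / p x * Real.exp (-p x)) ^ 2 ≤ (α x / p x * Real.exp (-(t * p x * y))) ^ 2 := by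
    rw [mul_pow, mul_pow]
    refine mul_le_mul_of_nonneg_left (pow_le_pow_left₀ (Real.exp_pos _).le
      (Real.exp_le_exp.2 (neg_le_neg ?_)) 2) (sq_nonneg _)
    have h3 : t * y ≤ 1 := by
      calc t * y ≤ t * t⁻¹ := mul_le_mul_of_nonneg_left hy1 ht0.le
        _ = 1 := mul_inv_cancel₀ ht0.ne'
    nlinarith
  have h4 : δ * s x ≤ (V₂ x - V₁ x) * s x := mul_le_mul_of_nonneg_right (hV x hx) hs.le
  calc F x ≤ δ * s x * (wkb a s p θ α χ t 0 (x, y) ^ 2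
        + wkb a s p θ α χ t (Real.pi / 2) (x, y) ^ 2) :=
        mul_le_mul_of_nonneg_left (h2.trans h1) (by positivity)
    _ ≤ (V₂ x - V₁ x) * s x * (wkb a s p θ α χ t 0 (x, y) ^ 2
        + wkb a s p θ α χ t (Real.pi / 2) (x, y) ^ 2) :=
        mul_le_mul_of_nonneg_right h4 (by positivity)
    _ = _ := by simp only [potentialTerm, Pi.add_apply]; ring

end WKBData

/-- The potentials are ordered at points of the boundary patch. -/
lemma potential_le_of_samePartialND {n : ℕ} (i : Fin n) {Ω Γ : Set (EuclideanSpace ℝ (Fin n))}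
    (hΩ : IsOpen Ω) (hb : Bornology.IsBounded Ω) (hΓ : IsOpen Γ) (hΓΩ : Γ ⊆ Ω)
    {g₁ g₂ : EuclideanSpace ℝ (Fin n) → Matrix (Fin n) (Fin n) ℝ}
    {V₁ V₂ : EuclideanSpace ℝ (Fin n) → ℝ}
    (hg₁ : IsEllipticMetric Ω g₁) (hg₂ : IsEllipticMetric Ω g₂)
    (hV₁ : IsPotential Ω V₁) (hV₂ : IsPotential Ω V₂) (hg : ∀ x ∈ Γ, g₁ x = g₂ x)
    (hND : SamePartialND Ω Γ g₁ V₁ g₂ V₂) {x₀ : EuclideanSpace ℝ (Fin n)} (hx₀ : x₀ ∈ Γ) :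
    V₂ x₀ ≤ V₁ x₀ := by
  by_contra! hlt
  set δ := (V₂ x₀ - V₁ x₀) / 2 with hδ
  have hδ0 : 0 < δ := by linarith
  have hc : ContinuousAt (fun x => V₂ x - V₁ x) x₀ :=
    ((hV₂.smooth.continuousOn.sub hV₁.smooth.continuousOn).mono subset_closure).continuousAt
      (hΩ.mem_nhds (hΓΩ hx₀))
  have hev : ∀ᶠ x in 𝓝 x₀, δ < V₂ x - V₁ x := hc.eventually (lt_mem_nhds (by linarith))
  obtain ⟨K, α, hK, hKN, hα, hα1⟩ := exists_bump (inter_mem (hΓ.mem_nhds hx₀) hev)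
  have hKΓ : K ⊆ Γ := hKN.trans inter_subset_left
  have hKδ : ∀ x ∈ K, δ ≤ V₂ x - V₁ x := fun x hx => le_of_lt (hKN hx).2
  obtain ⟨χ, hχ⟩ := exists_isCutoff
  -- For the potential a single oscillation direction is enough, and any nonzero covector would do.
  have hξ : (Pi.single i 1 : Fin n → ℝ) ≠ 0 := by simp
  obtain ⟨G, m, hG, D₁⟩ := hg₁.exists_wkbData hΩ hb hV₁ hK (hKΓ.trans hΓΩ) hα hχ hξ
  have D₂ : WKBData Ω K g₂ V₂ (coeffMatrix G) (density G) (covLength G (Pi.single i 1))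
      (linPhase (Pi.single i 1)) m α χ :=
    ⟨hΩ, hb, hg₂, hV₂, hK, hKΓ.trans hΓΩ, D₁.eikonal,
      fun x hx => by rw [← hg x (hKΓ hx)]; exact D₁.matrix_eq x hx,
      fun x hx => by rw [← hg x (hKΓ hx)]; exact D₁.density_eq x hx, hα, hχ⟩
  obtain ⟨C, hC0, hC⟩ := WKBData.exists_integral_potentialTerm_le i D₁ D₂ hKΓ hND
  obtain ⟨c, hc0, hc⟩ := WKBData.exists_le_integral_potentialTerm D₁ D₂ hδ0 hKδ (x₀ := x₀)
    (by rw [hα1]; exact one_ne_zero)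
  -- The bounds `c/t ≤ 2C/(t√t)` force `c√t ≤ 2C`. This `t` has a rational root expression with `c√t
  -- = c + 2C`, a contradiction.
  set t : ℝ := (1 + 2 * C / c) ^ 2 with ht
  have hq : 0 ≤ 2 * C / c := by positivity
  have ht1 : 1 ≤ t := one_le_pow₀ (by linarith)
  have ht0 : 0 < t := zero_lt_one.trans_le ht1
  have hsq : √t = 1 + 2 * C / c := Real.sqrt_sq (by linarith)
  have h := (hc t ht1).trans (add_le_add (hC t 0 ht1) (hC t (Real.pi / 2) ht1))
  rw [← add_div, div_le_div_iff₀ ht0 (by rw [hsq]; positivity), hsq] at h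
  have h1 : c * (t * (1 + 2 * C / c)) = t * (c + 2 * C) := by field_simp
  rw [h1] at h
  nlinarith

end NDMap

theorem theorem3p1 (n : ℕ) (hn : 2 ≤ n)
    (Ω Γ : Set (EuclideanSpace ℝ (Fin n)))
    (hΩ : NDMap.IsSmoothDomain Ω) (hΩb : Bornology.IsBounded Ω)
    (hΓ : NDMap.IsSmoothDomain Γ) (hΓΩ : closure Γ ⊆ Ω) (hconn : IsConnected (Ω \ closure Γ))
    (g₁ g₂ : EuclideanSpace ℝ (Fin n) → Matrix (Fin n) (Fin n) ℝ)
    (V₁ V₂ : EuclideanSpace ℝ (Fin n) → ℝ)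
    (hg₁ : NDMap.IsEllipticMetric Ω g₁) (hg₂ : NDMap.IsEllipticMetric Ω g₂)
    (hV₁ : NDMap.IsPotential Ω V₁) (hV₂ : NDMap.IsPotential Ω V₂)
    (hND : NDMap.SamePartialND Ω Γ g₁ V₁ g₂ V₂) :
    (∀ x ∈ Γ, g₁ x = g₂ x) ∧ (∀ x ∈ Γ, V₁ x = V₂ x) := by
  -- A coordinate direction, along which Poincaré's inequality is applied.
  have i : Fin n := ⟨0, by omega⟩
  have hs : Γ ⊆ Ω := subset_closure.trans hΓΩ
  have hg : ∀ x ∈ Γ, g₁ x = g₂ x := fun x hx =>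
    NDMap.metric_eq_of_samePartialND i hΩ.isOpen hΩb hΓ.isOpen hs hg₁ hg₂ hV₁ hV₂ hND hx
  refine ⟨hg, fun x hx => le_antisymm ?_ ?_⟩
  -- The hypotheses are symmetric in the two problems, so the one-sided comparison of potentials
  -- applies in both orders.
  · exact NDMap.potential_le_of_samePartialND i hΩ.isOpen hΩb hΓ.isOpen hs hg₂ hg₁ hV₂ hV₁
      (fun y hy => (hg y hy).symm) hND.symm hx
  · exact NDMap.potential_le_of_samePartialND i hΩ.isOpen hΩb hΓ.isOpen hs hg₁ hg₂ hV₁ hV₂ hg hND hx
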